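/- Consider the one-dimensional cubic Gabitov--Turitsyn equation $$i u_t+\gamma\,\partial_x^2u+\int_0^1 e^{-i\sigma\partial_x^2}\Big[\big|e^{i\sigma\partial_x^2}u\big|^2\,e^{i\sigma\partial_x^2}u\Big]\,d\sigma=0,\qquad u(0,x)=u_0(x),\tag{GT}$$ for $u:(-T,T)\times\mathbb R\to\mathbb C$, where $\gamma\in\mathbb R$, $\gamma\neq0$, is a constant. A solution on $(-T,T)$ is a function $u\in C((-T,T);L^2(\mathbb R))$ that satisfies the Duhamel formula $$u(t)=e^{i\gamma t\partial_x^2}u_0+i\int_0^t e^{i\gamma(t-\tau)\partial_x^2}\int_0^1e^{-i\sigma\partial_x^2}\Big[\big|e^{i\sigma\partial_x^2}u(\tau)\big|^2e^{i\sigma\partial_x^2}u(\tau)\Big]\,d\sigma\,d\tau ,\qquad |t|<T,$$ with integrals in $L^2(\mathbb R)$. Let $\|f\|_{H^s}^2=\int_{\mathbb R}(1+\xi^2)^s|\widehat f(\xi)|^2\,d\xi$ with $\widehat f(\xi)=\frac1{\sqrt{2\pi}}\int e^{-i\xi x}f(x)\,dx$. Let $\gamma\ne0$ and $s<-\frac32$.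 Then: 1. (Norm inflation in $H^s$.) For every $\epsilon>0$ there are Schwartz (in particular smooth) initial data $u_0$, a corresponding solution $u$ of (GT) on some interval $(-T_0,T_0)$, and a time $t\in(-T_0,T_0)$ with $$\|u_0\|_{H^s}<\epsilon,\qquad |t|<\epsilon,\qquad \|u(t)\|_{H^s}>\epsilon^{-1}.$$ 2. For every $T>0$, every $u_0\in L^2(\mathbb R)$ has exactly one solution of (GT) on $(-T,T)$, and the data-to-solution map $u_0\mapsto u$, even when restricted to Schwartz data, fails to be continuous at $u_0=0$ from the $H^s$ norm to the norm $\sup_{|t|<T}\|u(t)\|_{H^s}$ of $C_tH^s_x((-T,T))$. -/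

import Mathlib

open MeasureTheory Set
open scoped FourierTransform ENNReal SchwartzMap

noncomputable section

namespace GT

/-- The Hilbert space `L²(ℝ; ℂ)`. -/
abbrev L2 : Type := Lp ℂ 2 (volume : Measure ℝ)

/-- The symbol of `e^{itΔ}`. The transform `𝓕` has kernel `e^{-2πixζ}`, so that the angular
frequency is `ξ = 2πζ` and the symbol is `e^{-itξ²}`. -/
def schrodingerSymbol (t ζ : ℝ) : ℂ :=
  Complex.exp (-(Complex.I * ((t * (2 * Real.pi * ζ) ^ 2 : ℝ) : ℂ)))

theorem memLp_schrodingerSymbol_mul (t : ℝ) (g : L2) :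
    MemLp (fun ζ : ℝ => schrodingerSymbol t ζ * g ζ) 2 volume := by
  have hc : Continuous (schrodingerSymbol t) := by
    unfold schrodingerSymbol
    fun_prop
  refine (Lp.memLp g).of_le (hc.aestronglyMeasurable.mul (Lp.aestronglyMeasurable g)) ?_
  refine Filter.Eventually.of_forall fun ζ => ?_
  have h : ‖schrodingerSymbol t ζ‖ = 1 := by
    have h' : -(Complex.I * ((t * (2 * Real.pi * ζ) ^ 2 : ℝ) : ℂ)) =
        ((-(t * (2 * Real.pi * ζ) ^ 2) : ℝ) : ℂ) * Complex.I := by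
      push_cast
      ring
    rw [schrodingerSymbol, h', Complex.norm_exp_ofReal_mul_I]
  rw [norm_mul, h, one_mul]

/-- The free Schrödinger propagator `e^{itΔ}` on `L²(ℝ)`, as a Fourier multiplier. -/
def schrodinger (t : ℝ) (f : L2) : L2 :=
  𝓕⁻ ((memLp_schrodingerSymbol_mul t (𝓕 f)).toLp
    (fun ζ : ℝ => schrodingerSymbol t ζ * (𝓕 f : L2) ζ))

/-- `f` has a cube `|f|² f` in `L²(ℝ)` (that is, `f ∈ L⁶`). -/
def HasCube (f : L2) : Prop :=
  MemLp (fun x : ℝ => ((‖f x‖ ^ 2 : ℝ) : ℂ) * f x) 2 volume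

open Classical in
/-- The cubic expression `|f|² f` as an element of `L²(ℝ)`; it is only meaningful under
`HasCube f`. -/
def cube (f : L2) : L2 :=
  if h : HasCube f then MemLp.toLp (fun x : ℝ => ((‖f x‖ ^ 2 : ℝ) : ℂ) * f x) h else 0

/-- The integrand `e^{-iσΔ} [ |e^{iσΔ} f|² e^{iσΔ} f ]` of the nonlinearity. -/
def nonlinearityIntegrand (f : L2) (σ : ℝ) : L2 :=
  schrodinger (-σ) (cube (schrodinger σ f))

/-- The nonlinearity `∫₀¹ e^{-iσΔ} [ |e^{iσΔ} f|² e^{iσΔ} f ] dσ`, an integral in `L²(ℝ)`. -/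
def nonlinearity (f : L2) : L2 :=
  ∫ σ in (0 : ℝ)..1, nonlinearityIntegrand f σ

/-- `u ∈ C((-T,T); L²(ℝ))` is a strong solution on `(-T,T)` of
`i u_t + γ Δu + ∫₀¹ e^{-iσΔ} [ |e^{iσΔ} u|² e^{iσΔ} u ] dσ = 0`, `u(0) = u₀`, that is, it satisfies
the Duhamel formula. The fields `hasCube`, `integrable_nonlinearity` and `integrable_duhamel` say
that every expression in that formula is meaningful. -/
structure IsSolution (γ T : ℝ) (u₀ : L2) (u : ℝ → L2) : Prop where
  continuousOn : ContinuousOn u (Ioo (-T) T)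
  hasCube : ∀ t ∈ Ioo (-T) T, ∀ᵐ σ ∂(volume.restrict (Icc (0 : ℝ) 1)),
    HasCube (schrodinger σ (u t))
  integrable_nonlinearity : ∀ t ∈ Ioo (-T) T,
    IntervalIntegrable (nonlinearityIntegrand (u t)) volume 0 1
  integrable_duhamel : ∀ t ∈ Ioo (-T) T,
    IntervalIntegrable (fun τ => schrodinger (γ * (t - τ)) (nonlinearity (u τ))) volume 0 t
  duhamel : ∀ t ∈ Ioo (-T) T,
    u t = schrodinger (γ * t) u₀ +
      Complex.I • ∫ τ in (0 : ℝ)..t, schrodinger (γ * (t - τ)) (nonlinearity (u τ))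

/-- The inhomogeneous Sobolev norm `(∫ (1 + ξ²)^s |f̂(ξ)|² dξ)^{1/2}`, with values in `[0,∞]`. Here
`f̂` is the unitary transform `f̂(ξ) = (2π)^{-1/2} ∫ e^{-iξx} f(x) dx`; the substitution `ξ = 2πζ`
turns the integral into the one below. -/
def sobolevNorm (s : ℝ) (f : L2) : ℝ≥0∞ :=
  (∫⁻ ζ : ℝ, ENNReal.ofReal ((1 + (2 * Real.pi * ζ) ^ 2) ^ s) *
    ENNReal.ofReal (‖(𝓕 f : L2) ζ‖ ^ 2)) ^ (1 / 2 : ℝ)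

/-- Norm inflation in `H^s`: arbitrarily small Schwartz data with a solution whose `H^s` norm is
arbitrarily large at an arbitrarily small time. -/
def NormInflation (γ s : ℝ) : Prop :=
  ∀ ε : ℝ, 0 < ε → ∃ (φ : 𝓢(ℝ, ℂ)) (T : ℝ) (u : ℝ → L2) (t : ℝ),
    IsSolution γ T (φ.toLp 2) u ∧ t ∈ Ioo (-T) T ∧ |t| < ε ∧
    sobolevNorm s (φ.toLp 2) < ENNReal.ofReal ε ∧
    ENNReal.ofReal ε⁻¹ < sobolevNorm s (u t)

/-- `S` is the data-to-solution map on `(-T,T)`: for each `u₀ ∈ L²`, `S u₀` is a solution with data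
`u₀`, and it is the only one (functions of time are compared on `(-T,T)`). -/
def IsDataToSolutionMap (γ T : ℝ) (S : L2 → ℝ → L2) : Prop :=
  ∀ u₀ : L2, IsSolution γ T u₀ (S u₀) ∧
    ∀ u : ℝ → L2, IsSolution γ T u₀ u → EqOn u (S u₀) (Ioo (-T) T)

/-- The map `S`, restricted to Schwartz data, is continuous at `0` from the `H^s` norm to the norm
`sup_{|t| < T} ‖·‖_{H^s}` of `C((-T,T); H^s)`. -/
def ContinuousAtZero (s T : ℝ) (S : L2 → ℝ → L2) : Prop :=
  ∀ ε : ℝ, 0 < ε → ∃ δ : ℝ, 0 < δ ∧ ∀ φ : 𝓢(ℝ, ℂ),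
    sobolevNorm s (φ.toLp 2) < ENNReal.ofReal δ →
      (⨆ t ∈ Ioo (-T) T, sobolevNorm s (S (φ.toLp 2) t - S 0 t)) < ENNReal.ofReal ε

end GT

end

noncomputable section

namespace GT

open Filter Topology

/-! In the interaction picture w(t) = e^{-iγtΔ}u(t) the equation is an ODE w' = iF(t,w) in L². The
L⁶ Strichartz estimate `lintegral_sixthPower_le` makes the nonlinearity Lipschitz on balls
(`norm_nonlinearity_sub_le`), and its pairing with its argument is real, so mass is conserved. This
gives uniqueness and global existence (`IsSolution.eqOn`, `exists_isSolution`).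

Inflation is a high-to-low frequency transfer already visible in the first Picard iterate. Take data
whose Fourier transform has height l on frequencies of order N, and pair the solution with a fixed ψ
of frequencies in [-1,1]. The linear term drops out. The cubic term is an integral of exp(iσ·phase)
over σ in [0,1] and over quadruples of one low and three high frequencies; on these the phase is
positive, of size N². Averaging in σ turns the imaginary part into an integral of (1 - cos
phase)/phase ≥ 0, so nothing cancels. A frequency region of measure about N² divided by a phase of
about N² leaves a lower bound c l³ (`intervalIntegral_im_inner_ge`). Hence |⟨ψ,u(t)⟩| is at least of
order t l³, and the H^s norm controls this pairing (`IsTestFunction.enorm_inner_le`).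

With l = N^{-s-1/2-k} the data have H^s norm O(N^{-k}); with t = N^{2s-2k} the quantity t‖u₀‖² in L²
is O(N^{-4k}). Then t l³ = N^{-s-3/2-5k}, which is at least N^k for small k > 0 because s < -3/2.

It remains to see that the solution follows its first iterate up to errors o(l³)
(`IsSolution.norm_inner_testFunction_ge`, `error_le`). Strichartz alone bounds the drift too
crudely, by a power of N. But the data have L¹ norm O(l) uniformly in N, so they disperse:
interpolating the decay l|σ|^{-1/2} with the trivial bound lN gives l N^k |σ|^{-(1-k)/2}, whose
square is integrable in σ (`exists_norm_freeEvolution_datum_le`). The relative error is then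
O(N^{-k}). The free flow generated by γ matters little since |γ|t is tiny and ψ has low frequency.
Discontinuity at 0 follows, zero data having the zero solution. -/

theorem enorm_sq_eq_lintegral (f : L2) : ‖f‖ₑ ^ 2 = ∫⁻ x, ‖f x‖ₑ ^ 2 := by
  rw [Lp.enorm_def, eLpNorm_eq_lintegral_rpow_enorm_toReal (by norm_num) (by norm_num)]
  simp only [ENNReal.toReal_ofNat, ENNReal.rpow_ofNat]
  rw [← ENNReal.rpow_natCast, ← ENNReal.rpow_mul]
  norm_num

/-- Dominated convergence in `L²`, along a countably generated filter. -/
theorem tendsto_L2_of_dominated {ι : Type*} {l : Filter ι} [l.IsCountablyGenerated]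
    {F : ι → L2} {f : L2} {G : ι → ℝ → ℂ} {g : ℝ → ℝ} (hg : MemLp g 2 volume)
    (hFG : ∀ i, F i =ᵐ[volume] G i) (hb : ∀ i, ∀ᵐ x, ‖G i x‖ ≤ g x)
    (hlim : ∀ᵐ x, Tendsto (fun i => G i x) l (𝓝 (f x))) : Tendsto F l (𝓝 f) := by
  rw [tendsto_iff_edist_tendsto_0]
  have h2 : Tendsto (fun i => ∫⁻ x, ‖G i x - f x‖ₑ ^ 2) l (𝓝 0) := by
    have hz : (0 : ℝ≥0∞) = ∫⁻ _ : ℝ, 0 := by simp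
    rw [hz]
    refine tendsto_lintegral_filter_of_dominated_convergence'
      (fun x => (‖‖g x‖ + ‖f x‖‖ₑ) ^ 2) ?_ ?_ ?_ ?_
    · refine Eventually.of_forall fun i => ?_
      have := ((Lp.aestronglyMeasurable (F i)).congr (hFG i)).sub (Lp.aestronglyMeasurable f)
      exact this.enorm.pow_const 2
    · refine Eventually.of_forall fun i => ?_
      filter_upwards [hb i] with x hx
      gcongr
      rw [enorm_le_iff_norm_le]
      rw [Real.norm_of_nonneg (by positivity)]
      refine (norm_sub_le _ _).trans ?_
      gcongr
      exact hx.trans (le_abs_self _)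
    · have h3 : MemLp (fun x => ‖g x‖ + ‖f x‖) 2 volume := hg.norm.add (Lp.memLp f).norm
      have h4 := h3.eLpNorm_lt_top
      have h5 := lintegral_rpow_enorm_lt_top_of_eLpNorm_lt_top (by norm_num) (by norm_num) h4
      simp only [ENNReal.toReal_ofNat, ENNReal.rpow_ofNat] at h5
      exact h5.ne
    · filter_upwards [hlim] with x hx
      have h3 : Tendsto (fun i => G i x - f x) l (𝓝 0) := by
        simpa using hx.sub_const (f x)
      have h4 := ((ENNReal.continuous_pow 2).tendsto _).comp h3.enorm
      simpa [Function.comp_def] using h4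
  have h3 : ∀ i, edist (F i) f = (∫⁻ x, ‖G i x - f x‖ₑ ^ 2) ^ (1 / 2 : ℝ) := by
    intro i
    have h4 : ∫⁻ x, ‖G i x - f x‖ₑ ^ 2 = ‖F i - f‖ₑ ^ 2 := by
      rw [enorm_sq_eq_lintegral]
      refine lintegral_congr_ae ?_
      filter_upwards [hFG i, Lp.coeFn_sub (F i) f] with x h1 h2
      rw [h2, Pi.sub_apply, h1]
    rw [h4, edist_eq_enorm_sub, ← ENNReal.rpow_natCast, ← ENNReal.rpow_mul]
    norm_num
  simp_rw [h3]
  have := h2.ennrpow_const (1 / 2)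
  simpa using this

/-! ### The symbol -/

theorem schrodingerSymbol_eq (t ζ : ℝ) :
    schrodingerSymbol t ζ = Complex.exp (((-(t * (2 * Real.pi * ζ) ^ 2) : ℝ) : ℂ) * Complex.I) := by
  rw [schrodingerSymbol]
  congr 1
  push_cast
  ring

@[simp]
theorem norm_schrodingerSymbol (t ζ : ℝ) : ‖schrodingerSymbol t ζ‖ = 1 := by
  rw [schrodingerSymbol_eq, Complex.norm_exp_ofReal_mul_I]

theorem schrodingerSymbol_add (s t ζ : ℝ) :
    schrodingerSymbol (s + t) ζ = schrodingerSymbol s ζ * schrodingerSymbol t ζ := by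
  simp only [schrodingerSymbol, ← Complex.exp_add]
  congr 1
  push_cast
  ring

@[simp]
theorem schrodingerSymbol_zero (ζ : ℝ) : schrodingerSymbol 0 ζ = 1 := by
  simp [schrodingerSymbol]

theorem continuous_schrodingerSymbol :
    Continuous (fun p : ℝ × ℝ => schrodingerSymbol p.1 p.2) := by
  unfold schrodingerSymbol
  fun_prop

/-- Every derivative has modulus 1. This is what lets the propagator act as a Fourier multiplier on
Schwartz functions. -/
theorem hasTemperateGrowth_exp_mul_I :
    Function.HasTemperateGrowth (fun x : ℝ => Complex.exp ((x : ℂ) * Complex.I)) := by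
  have hd : ∀ n : ℕ, iteratedDeriv n (fun x : ℝ => Complex.exp ((x : ℂ) * Complex.I)) =
      fun x : ℝ => Complex.I ^ n * Complex.exp ((x : ℂ) * Complex.I) := by
    intro n
    induction n with
    | zero => simp
    | succ n ih =>
      rw [iteratedDeriv_succ, ih]
      funext x
      have h1 : HasDerivAt (fun x : ℝ => (x : ℂ) * Complex.I) Complex.I x := by
        simpa using (Complex.ofRealCLM.hasDerivAt (x := x)).mul_const Complex.I
      have := (h1.cexp.const_mul (Complex.I ^ n)).deriv
      rw [this]
      ring
  refine ⟨?_, fun n => ⟨0, 1, fun x => ?_⟩⟩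
  · exact (Complex.ofRealCLM.contDiff.mul contDiff_const).cexp
  · rw [norm_iteratedFDeriv_eq_norm_iteratedDeriv, hd n]
    simp [Complex.norm_exp_ofReal_mul_I]

theorem hasTemperateGrowth_schrodingerSymbol (t : ℝ) :
    (schrodingerSymbol t).HasTemperateGrowth := by
  have h1 : (fun ζ : ℝ => -(t * (2 * Real.pi * ζ) ^ 2)).HasTemperateGrowth := by
    have : (fun ζ : ℝ => -(t * (2 * Real.pi * ζ) ^ 2)) =
        fun ζ : ℝ => (-(t * (2 * Real.pi) ^ 2)) * ‖ζ‖ ^ 2 := by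
      funext ζ
      rw [Real.norm_eq_abs, sq_abs]
      ring
    rw [this]
    exact (Function.HasTemperateGrowth.const _).mul (Function.hasTemperateGrowth_norm_sq ℝ)
  have h2 := hasTemperateGrowth_exp_mul_I.comp h1
  convert h2 using 1
  funext ζ
  exact schrodingerSymbol_eq t ζ

/-! ### The propagator on `L²` -/

theorem fourier_schrodinger (t : ℝ) (f : L2) :
    (𝓕 (schrodinger t f) : L2) =ᵐ[volume] fun ζ => schrodingerSymbol t ζ * (𝓕 f : L2) ζ := by
  rw [schrodinger, FourierTransform.fourier_fourierInv_eq]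
  exact MemLp.coeFn_toLp _

theorem fourier_injective {f g : L2} (h : (𝓕 f : L2) =ᵐ[volume] (𝓕 g : L2)) : f = g := by
  have h1 : (𝓕 f : L2) = 𝓕 g := Lp.ext h
  rw [← FourierTransform.fourierInv_fourier_eq (F := L2) f, h1,
    FourierTransform.fourierInv_fourier_eq (F := L2) g]

theorem schrodinger_add (t : ℝ) (f g : L2) :
    schrodinger t (f + g) = schrodinger t f + schrodinger t g := by
  apply fourier_injective
  rw [FourierTransform.fourier_add]
  filter_upwards [fourier_schrodinger t (f + g), fourier_schrodinger t f, fourier_schrodinger t g,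
    Lp.coeFn_add (𝓕 f : L2) (𝓕 g), Lp.coeFn_add (𝓕 (schrodinger t f) : L2) (𝓕 (schrodinger t g))]
    with x h1 h2 h3 h4 h5
  rw [FourierTransform.fourier_add] at h1
  rw [h1, h5, h4, Pi.add_apply, Pi.add_apply, h2, h3]
  ring

theorem schrodinger_smul (t : ℝ) (c : ℂ) (f : L2) :
    schrodinger t (c • f) = c • schrodinger t f := by
  apply fourier_injective
  rw [FourierTransform.fourier_smul]
  filter_upwards [fourier_schrodinger t (c • f), fourier_schrodinger t f,
    Lp.coeFn_smul c (𝓕 f : L2), Lp.coeFn_smul c (𝓕 (schrodinger t f) : L2)]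
    with x h1 h2 h3 h4
  rw [FourierTransform.fourier_smul] at h1
  rw [h1, h3, h4, Pi.smul_apply, Pi.smul_apply, h2]
  simp only [smul_eq_mul]
  ring

theorem norm_schrodinger (t : ℝ) (f : L2) : ‖schrodinger t f‖ = ‖f‖ := by
  rw [← Lp.norm_fourier_eq (schrodinger t f), ← Lp.norm_fourier_eq f]
  refine le_antisymm (Lp.norm_le_norm_of_ae_le ?_) (Lp.norm_le_norm_of_ae_le ?_) <;>
  · filter_upwards [fourier_schrodinger t f] with x h1
    rw [h1, norm_mul, norm_schrodingerSymbol, one_mul]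

theorem schrodinger_schrodinger (s t : ℝ) (f : L2) :
    schrodinger s (schrodinger t f) = schrodinger (s + t) f := by
  apply fourier_injective
  filter_upwards [fourier_schrodinger s (schrodinger t f), fourier_schrodinger t f,
    fourier_schrodinger (s + t) f] with x h1 h2 h3
  rw [h1, h2, h3, schrodingerSymbol_add, mul_assoc]

@[simp]
theorem schrodinger_zero_left (f : L2) : schrodinger 0 f = f := by
  apply fourier_injective
  filter_upwards [fourier_schrodinger 0 f] with x h1
  rw [h1, schrodingerSymbol_zero, one_mul]

/-- The free propagator as a linear isometry. -/
def propagator (t : ℝ) : L2 →ₗᵢ[ℂ] L2 where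
  toFun := schrodinger t
  map_add' := schrodinger_add t
  map_smul' := schrodinger_smul t
  norm_map' := norm_schrodinger t

@[simp]
theorem schrodinger_zero_right (t : ℝ) : schrodinger t 0 = 0 := (propagator t).map_zero

theorem schrodinger_sub (t : ℝ) (f g : L2) :
    schrodinger t (f - g) = schrodinger t f - schrodinger t g := (propagator t).map_sub f g

/-- Strong continuity only: on the Fourier side the symbol converges pointwise with |f̂| as
dominating function. -/
theorem continuous_schrodinger_left (f : L2) : Continuous fun t => schrodinger t f := by
  have h : Continuous fun t => (𝓕 (schrodinger t f) : L2) := by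
    rw [continuous_iff_continuousAt]
    intro t₀
    refine tendsto_L2_of_dominated (g := fun ζ => ‖(𝓕 f : L2) ζ‖)
      (G := fun t ζ => schrodingerSymbol t ζ * (𝓕 f : L2) ζ) (Lp.memLp _).norm
      (fun t => fourier_schrodinger t f) (fun t => ?_) ?_
    · refine Eventually.of_forall fun ζ => ?_
      rw [norm_mul, norm_schrodingerSymbol, one_mul]
    · filter_upwards [fourier_schrodinger t₀ f] with ζ h1
      rw [h1]
      have : Continuous fun t => schrodingerSymbol t ζ * (𝓕 f : L2) ζ :=
        (continuous_schrodingerSymbol.comp (by fun_prop : Continuous fun t : ℝ => (t, ζ))).mul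
          continuous_const
      exact this.tendsto t₀
  have h2 : Continuous fun t => (𝓕⁻ (𝓕 (schrodinger t f) : L2) : L2) :=
    (Lp.fourierTransformₗᵢ ℝ ℂ).symm.continuous.comp h
  simpa only [FourierTransform.fourierInv_fourier_eq] using h2

/-- Strong continuity upgrades to joint continuity because the propagators are isometries. -/
theorem continuous_schrodinger : Continuous fun p : ℝ × L2 => schrodinger p.1 p.2 := by
  rw [continuous_iff_continuousAt]
  rintro ⟨t₀, f₀⟩
  rw [ContinuousAt, tendsto_iff_norm_sub_tendsto_zero]
  have h1 : Tendsto (fun p : ℝ × L2 => ‖p.2 - f₀‖ + ‖schrodinger p.1 f₀ - schrodinger t₀ f₀‖)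
      (𝓝 (t₀, f₀)) (𝓝 0) := by
    have h2 : Continuous fun p : ℝ × L2 =>
        ‖p.2 - f₀‖ + ‖schrodinger p.1 f₀ - schrodinger t₀ f₀‖ :=
      (continuous_snd.sub continuous_const).norm.add
        (((continuous_schrodinger_left f₀).comp continuous_fst).sub continuous_const).norm
    simpa using h2.tendsto (t₀, f₀)
  refine squeeze_zero (fun _ => norm_nonneg _) (fun p => ?_) h1
  calc ‖schrodinger p.1 p.2 - schrodinger t₀ f₀‖
      = ‖schrodinger p.1 (p.2 - f₀) + (schrodinger p.1 f₀ - schrodinger t₀ f₀)‖ := by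
        rw [schrodinger_sub]; congr 1; abel
    _ ≤ _ := by
        refine (norm_add_le _ _).trans ?_
        rw [norm_schrodinger]

theorem continuousOn_schrodinger {X : Type*} [TopologicalSpace X] {a : X → ℝ} {f : X → L2}
    {s : Set X} (ha : ContinuousOn a s) (hf : ContinuousOn f s) :
    ContinuousOn (fun x => schrodinger (a x) (f x)) s := by
  have h := continuous_schrodinger.comp_continuousOn (ha.prodMk hf)
  exact h

theorem inner_schrodinger (t : ℝ) (f g : L2) :
    inner ℂ (schrodinger t f) (schrodinger t g) = inner ℂ f g :=
  (propagator t).inner_map_map f g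

theorem inner_schrodinger_right (t : ℝ) (f g : L2) :
    inner ℂ f (schrodinger t g) = inner ℂ (schrodinger (-t) f) g := by
  rw [← inner_schrodinger (-t) f, schrodinger_schrodinger]
  simp

/-! ### The propagator on Schwartz functions -/

/-- The free propagator on Schwartz functions. -/
def freeEvolution (t : ℝ) (φ : 𝓢(ℝ, ℂ)) : 𝓢(ℝ, ℂ) :=
  SchwartzMap.fourierMultiplierCLM ℂ (schrodingerSymbol t) φ

theorem fourier_freeEvolution (t : ℝ) (φ : 𝓢(ℝ, ℂ)) (ζ : ℝ) :
    (𝓕 (freeEvolution t φ) : 𝓢(ℝ, ℂ)) ζ = schrodingerSymbol t ζ * (𝓕 φ : 𝓢(ℝ, ℂ)) ζ := by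
  rw [freeEvolution, SchwartzMap.fourierMultiplierCLM_apply,
    FourierTransform.fourier_fourierInv_eq,
    SchwartzMap.smulLeftCLM_apply_apply (hasTemperateGrowth_schrodingerSymbol t), smul_eq_mul]

theorem schrodinger_toLp (t : ℝ) (φ : 𝓢(ℝ, ℂ)) :
    schrodinger t (φ.toLp 2) = (freeEvolution t φ).toLp 2 := by
  apply fourier_injective
  rw [SchwartzMap.toLp_fourier_eq]
  have h0 := fourier_schrodinger t (φ.toLp 2)
  rw [SchwartzMap.toLp_fourier_eq] at h0
  filter_upwards [h0, SchwartzMap.coeFn_toLp (𝓕 φ) 2 volume,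
    SchwartzMap.coeFn_toLp (𝓕 (freeEvolution t φ)) 2 volume] with x h1 h2 h3
  rw [h1, h2, h3, fourier_freeEvolution]

/-! ### The cube on `L²` and sixth powers -/

/-- The integral `∫ |f|⁶`. -/
def sixthPower (f : L2) : ℝ≥0∞ := ∫⁻ x, ‖f x‖ₑ ^ 6

/-- The function `z ↦ |z|² z`. -/
def cubeFun (z : ℂ) : ℂ := ((‖z‖ ^ 2 : ℝ) : ℂ) * z

theorem norm_cubeFun (z : ℂ) : ‖cubeFun z‖ = ‖z‖ ^ 3 := by
  rw [cubeFun, norm_mul, Complex.norm_real, Real.norm_of_nonneg (by positivity)]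
  ring

theorem continuous_cubeFun : Continuous cubeFun := by
  unfold cubeFun
  fun_prop

theorem enorm_cubeFun_sq (z : ℂ) : ‖cubeFun z‖ₑ ^ 2 = ‖z‖ₑ ^ 6 := by
  rw [← ofReal_norm, norm_cubeFun, ← ofReal_norm, ← ENNReal.ofReal_pow,
    ← ENNReal.ofReal_pow, ← pow_mul] <;> positivity

theorem norm_cubeFun_sub_le (z w : ℂ) :
    ‖cubeFun z - cubeFun w‖ ≤ 3 / 2 * (‖z‖ ^ 2 + ‖w‖ ^ 2) * ‖z - w‖ := by
  have h1 : cubeFun z - cubeFun w =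
      ((‖z‖ ^ 2 : ℝ) : ℂ) * (z - w) + ((‖z‖ ^ 2 - ‖w‖ ^ 2 : ℝ) : ℂ) * w := by
    simp only [cubeFun]
    push_cast
    ring
  have h2 : |‖z‖ - ‖w‖| ≤ ‖z - w‖ := abs_norm_sub_norm_le z w
  have h3 : |‖z‖ ^ 2 - ‖w‖ ^ 2| ≤ ‖z - w‖ * (‖z‖ + ‖w‖) := by
    have : ‖z‖ ^ 2 - ‖w‖ ^ 2 = (‖z‖ - ‖w‖) * (‖z‖ + ‖w‖) := by ring
    rw [this, abs_mul, abs_of_nonneg (by positivity : 0 ≤ ‖z‖ + ‖w‖)]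
    gcongr
  calc ‖cubeFun z - cubeFun w‖
      ≤ ‖z‖ ^ 2 * ‖z - w‖ + |‖z‖ ^ 2 - ‖w‖ ^ 2| * ‖w‖ := by
        rw [h1]
        refine (norm_add_le _ _).trans ?_
        rw [norm_mul, norm_mul, Complex.norm_real, Complex.norm_real,
          Real.norm_of_nonneg (by positivity : (0 : ℝ) ≤ ‖z‖ ^ 2), Real.norm_eq_abs]
    _ ≤ ‖z‖ ^ 2 * ‖z - w‖ + ‖z - w‖ * (‖z‖ + ‖w‖) * ‖w‖ := by gcongr
    _ = (‖z‖ ^ 2 + ‖z‖ * ‖w‖ + ‖w‖ ^ 2) * ‖z - w‖ := by ring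
    _ ≤ _ := by
        gcongr
        nlinarith [sq_nonneg (‖z‖ - ‖w‖)]

theorem pow_four_mul_sq_le {x y : ℝ} (hx : 0 ≤ x) (hy : 0 ≤ y) : x ^ 4 * y ^ 2 ≤ x ^ 6 + y ^ 6 := by
  rcases le_total x y with h | h
  · calc x ^ 4 * y ^ 2 ≤ y ^ 4 * y ^ 2 := by gcongr
      _ = y ^ 6 := by ring
      _ ≤ _ := by linarith [pow_nonneg hx 6]
  · calc x ^ 4 * y ^ 2 ≤ x ^ 4 * x ^ 2 := by gcongr
      _ = x ^ 6 := by ring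
      _ ≤ _ := by linarith [pow_nonneg hy 6]

/-- A substitute for Hölder's inequality with exponents 3 and 3/2. The parameters R and d stand for
the expected sizes of z, w and of z - w; when they match, each normalised sixth power integrates to
O(1) by Strichartz and the prefactor R⁴d² gives the Lipschitz bound. -/
theorem norm_cubeFun_sub_sq_le (z w : ℂ) {R d : ℝ} (hR : 0 < R) (hd : 0 < d) :
    ‖cubeFun z - cubeFun w‖ ^ 2 ≤
      9 * R ^ 4 * d ^ 2 * (‖z‖ ^ 6 * R⁻¹ ^ 6 + ‖w‖ ^ 6 * R⁻¹ ^ 6 + ‖z - w‖ ^ 6 * d⁻¹ ^ 6) := by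
  set X := ‖z‖ * R⁻¹ with hX
  set Y := ‖w‖ * R⁻¹ with hY
  set Z := ‖z - w‖ * d⁻¹ with hZ
  have hX0 : 0 ≤ X := by positivity
  have hY0 : 0 ≤ Y := by positivity
  have hZ0 : 0 ≤ Z := by positivity
  have e1 : ‖z‖ = R * X := by rw [hX]; field_simp
  have e2 : ‖w‖ = R * Y := by rw [hY]; field_simp
  have e3 : ‖z - w‖ = d * Z := by rw [hZ]; field_simp
  have h1 := norm_cubeFun_sub_le z w
  rw [e1, e2, e3] at h1
  have h2 : ‖z‖ ^ 6 * R⁻¹ ^ 6 + ‖w‖ ^ 6 * R⁻¹ ^ 6 + ‖z - w‖ ^ 6 * d⁻¹ ^ 6 = X ^ 6 + Y ^ 6 + Z ^ 6 := by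
    rw [hX, hY, hZ]; ring
  rw [h2]
  calc ‖cubeFun z - cubeFun w‖ ^ 2
      ≤ (3 / 2 * ((R * X) ^ 2 + (R * Y) ^ 2) * (d * Z)) ^ 2 := by gcongr
    _ = R ^ 4 * d ^ 2 * (9 / 4 * (X ^ 2 + Y ^ 2) ^ 2 * Z ^ 2) := by ring
    _ ≤ R ^ 4 * d ^ 2 * (9 * (X ^ 6 + Y ^ 6 + Z ^ 6)) := by
        refine mul_le_mul_of_nonneg_left ?_ (by positivity)
        have h3 := pow_four_mul_sq_le hX0 hZ0
        have h4 := pow_four_mul_sq_le hY0 hZ0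
        have h5 : (X ^ 2 + Y ^ 2) ^ 2 * Z ^ 2 ≤ 2 * (X ^ 4 * Z ^ 2 + Y ^ 4 * Z ^ 2) := by
          nlinarith [mul_nonneg (sq_nonneg (X ^ 2 - Y ^ 2)) (sq_nonneg Z)]
        nlinarith [pow_nonneg hX0 6, pow_nonneg hY0 6]
    _ = _ := by ring

theorem aestronglyMeasurable_cubeFun (f : L2) :
    AEStronglyMeasurable (fun x => cubeFun (f x)) volume :=
  continuous_cubeFun.comp_aestronglyMeasurable (Lp.aestronglyMeasurable f)

theorem hasCube_iff (f : L2) : HasCube f ↔ sixthPower f < ∞ := by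
  have h1 : HasCube f ↔ eLpNorm (fun x => cubeFun (f x)) 2 volume < ∞ :=
    ⟨fun h => h.eLpNorm_lt_top, fun h => ⟨aestronglyMeasurable_cubeFun f, h⟩⟩
  rw [h1, eLpNorm_lt_top_iff_lintegral_rpow_enorm_lt_top (by norm_num) (by norm_num)]
  simp only [ENNReal.toReal_ofNat, ENNReal.rpow_ofNat, enorm_cubeFun_sq]
  rfl

theorem coeFn_cube {f : L2} (h : HasCube f) : cube f =ᵐ[volume] fun x => cubeFun (f x) := by
  rw [cube, dif_pos h]
  exact MemLp.coeFn_toLp _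

theorem sixthPower_congr_ae {f : L2} {g : ℝ → ℂ} (h : f =ᵐ[volume] g) :
    sixthPower f = ∫⁻ x, ‖g x‖ₑ ^ 6 := by
  refine lintegral_congr_ae ?_
  filter_upwards [h] with x hx
  rw [hx]

theorem enorm_cube_sub_cube_sq_le {f g : L2} (hf : HasCube f) (hg : HasCube g) {R d : ℝ}
    (hR : 0 < R) (hd : 0 < d) :
    ‖cube f - cube g‖ₑ ^ 2 ≤ ENNReal.ofReal (9 * R ^ 4 * d ^ 2) *
      (sixthPower f * ENNReal.ofReal (R⁻¹ ^ 6) + sixthPower g * ENNReal.ofReal (R⁻¹ ^ 6) +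
        sixthPower (f - g) * ENNReal.ofReal (d⁻¹ ^ 6)) := by
  have hm : ∀ k : L2, AEMeasurable (fun x => ‖k x‖ₑ ^ 6) volume := fun k =>
    (Lp.aestronglyMeasurable k).enorm.pow_const 6
  rw [enorm_sq_eq_lintegral]
  unfold sixthPower
  rw [← lintegral_mul_const'' _ (hm f), ← lintegral_mul_const'' _ (hm g),
    ← lintegral_mul_const'' _ (hm (f - g)), ← lintegral_add_left' ((hm f).mul_const _),
    ← lintegral_add_right' _ ((hm (f - g)).mul_const _),
    ← lintegral_const_mul' _ _ ENNReal.ofReal_ne_top]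
  refine lintegral_mono_ae ?_
  filter_upwards [coeFn_cube hf, coeFn_cube hg, Lp.coeFn_sub (cube f) (cube g),
    Lp.coeFn_sub f g] with x h1 h2 h3 h4
  rw [h3, h4, Pi.sub_apply, Pi.sub_apply, h1, h2]
  simp only [← ofReal_norm]
  rw [← ENNReal.ofReal_pow (by positivity), ← ENNReal.ofReal_pow (by positivity),
    ← ENNReal.ofReal_pow (by positivity), ← ENNReal.ofReal_pow (by positivity),
    ← ENNReal.ofReal_mul (by positivity), ← ENNReal.ofReal_mul (by positivity),
    ← ENNReal.ofReal_mul (by positivity), ← ENNReal.ofReal_add (by positivity) (by positivity),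
    ← ENNReal.ofReal_add (by positivity) (by positivity), ← ENNReal.ofReal_mul (by positivity)]
  exact ENNReal.ofReal_le_ofReal (norm_cubeFun_sub_sq_le _ _ hR hd)

/-! ### Truncations -/

/-- The truncated cube `z ↦ min(|z|, n)² z`. -/
def truncCubeFun (n : ℕ) (z : ℂ) : ℂ := (((min ‖z‖ n) ^ 2 : ℝ) : ℂ) * z

theorem norm_truncCubeFun (n : ℕ) (z : ℂ) : ‖truncCubeFun n z‖ = (min ‖z‖ n) ^ 2 * ‖z‖ := by
  rw [truncCubeFun, norm_mul, Complex.norm_real, Real.norm_of_nonneg (by positivity)]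

theorem norm_truncCubeFun_le (n : ℕ) (z : ℂ) : ‖truncCubeFun n z‖ ≤ ‖cubeFun z‖ := by
  rw [norm_truncCubeFun, norm_cubeFun, pow_succ ‖z‖ 2]
  exact mul_le_mul_of_nonneg_right
    (pow_le_pow_left₀ (by positivity) (min_le_left _ _) 2) (norm_nonneg z)

theorem norm_truncCubeFun_sub_le_of_le (n : ℕ) {z w : ℂ} (h : ‖w‖ ≤ ‖z‖) :
    ‖truncCubeFun n z - truncCubeFun n w‖ ≤ 3 * n ^ 2 * ‖z - w‖ := by
  set a := min ‖z‖ (n : ℝ) with ha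
  set b := min ‖w‖ (n : ℝ) with hb
  have ha0 : 0 ≤ a := by positivity
  have hb0 : 0 ≤ b := by positivity
  have han : a ≤ n := min_le_right _ _
  have hba : b ≤ a := min_le_min_right _ h
  have hab : a - b ≤ ‖z - w‖ := by
    have h1 : ‖z‖ - ‖w‖ ≤ ‖z - w‖ := norm_sub_norm_le z w
    rcases le_total ‖w‖ (n : ℝ) with h2 | h2
    · rw [hb, min_eq_left h2]
      linarith [min_le_left ‖z‖ (n : ℝ)]
    · rw [hb, min_eq_right h2]
      linarith [norm_nonneg (z - w)]
  have h1 : truncCubeFun n z - truncCubeFun n w =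
      ((a ^ 2 : ℝ) : ℂ) * (z - w) + ((a ^ 2 - b ^ 2 : ℝ) : ℂ) * w := by
    simp only [truncCubeFun, ← ha, ← hb]
    push_cast
    ring
  have h2 : (a ^ 2 - b ^ 2) * ‖w‖ ≤ 2 * n ^ 2 * ‖z - w‖ := by
    rcases le_total ‖w‖ (n : ℝ) with h2 | h2
    · have : (a ^ 2 - b ^ 2) = (a - b) * (a + b) := by ring
      rw [this]
      calc (a - b) * (a + b) * ‖w‖ ≤ ‖z - w‖ * (n + n) * n := by
            gcongr
            exact hba.trans han
        _ = _ := by ring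
    -- Both moduli exceed the threshold here, so the two truncated weights coincide and the term
    -- vanishes.
    · have e1 : b = n := min_eq_right h2
      have e2 : a = n := min_eq_right (h2.trans h)
      rw [e1, e2, sub_self, zero_mul]
      positivity
  have h3 : 0 ≤ a ^ 2 - b ^ 2 := by nlinarith
  calc ‖truncCubeFun n z - truncCubeFun n w‖
      ≤ a ^ 2 * ‖z - w‖ + (a ^ 2 - b ^ 2) * ‖w‖ := by
        rw [h1]
        refine (norm_add_le _ _).trans ?_
        rw [norm_mul, norm_mul, Complex.norm_real, Complex.norm_real,
          Real.norm_of_nonneg (by positivity : (0 : ℝ) ≤ a ^ 2), Real.norm_of_nonneg h3]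
    _ ≤ n ^ 2 * ‖z - w‖ + 2 * n ^ 2 * ‖z - w‖ := by gcongr
    _ = _ := by ring

theorem lipschitzWith_truncCubeFun (n : ℕ) :
    LipschitzWith (3 * (n : NNReal) ^ 2) (truncCubeFun n) := by
  refine LipschitzWith.of_dist_le_mul fun z w => ?_
  rw [dist_eq_norm, dist_eq_norm]
  push_cast
  rcases le_total ‖w‖ ‖z‖ with h | h
  · exact norm_truncCubeFun_sub_le_of_le n h
  · rw [norm_sub_rev, norm_sub_rev z w]
    exact norm_truncCubeFun_sub_le_of_le n h

/-- The truncated cube on `L²`. -/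
def truncCube (n : ℕ) (f : L2) : L2 :=
  (lipschitzWith_truncCubeFun n).compLp (by simp [truncCubeFun]) f

theorem coeFn_truncCube (n : ℕ) (f : L2) :
    truncCube n f =ᵐ[volume] fun x => truncCubeFun n (f x) :=
  LipschitzWith.coeFn_compLp _ _ _

theorem continuous_truncCube (n : ℕ) : Continuous (truncCube n) :=
  (lipschitzWith_truncCubeFun n).continuous_compLp (by simp [truncCubeFun])

theorem tendsto_truncCubeFun (z : ℂ) :
    Tendsto (fun n : ℕ => truncCubeFun n z) atTop (𝓝 (cubeFun z)) := by
  refine tendsto_const_nhds.congr' ?_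
  filter_upwards [eventually_ge_atTop ⌈‖z‖⌉₊] with n hn
  rw [truncCubeFun, min_eq_left ((Nat.le_ceil _).trans (by exact_mod_cast hn)), cubeFun]

theorem tendsto_truncCube {f : L2} (hf : HasCube f) :
    Tendsto (fun n => truncCube n f) atTop (𝓝 (cube f)) := by
  refine tendsto_L2_of_dominated (g := fun x => ‖cubeFun (f x)‖)
    (G := fun n x => truncCubeFun n (f x)) (MemLp.norm hf) (fun n => coeFn_truncCube n f)
    (fun n => Eventually.of_forall fun x => norm_truncCubeFun_le n _) ?_
  filter_upwards [coeFn_cube hf] with x hx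
  rw [hx]
  exact tendsto_truncCubeFun _

/-- Monotone convergence. Each truncated cube is Lipschitz on L², so the supremum is lower
semicontinuous in f; this yields both measurability in σ and the passage of Strichartz to limits. -/
theorem sixthPower_eq_iSup (f : L2) : sixthPower f = ⨆ n, ‖truncCube n f‖ₑ ^ 2 := by
  have h1 : ∀ n, ‖truncCube n f‖ₑ ^ 2 = ∫⁻ x, ‖truncCubeFun n (f x)‖ₑ ^ 2 := by
    intro n
    rw [enorm_sq_eq_lintegral]
    refine lintegral_congr_ae ?_
    filter_upwards [coeFn_truncCube n f] with x hx
    rw [hx]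
  have hmono : ∀ x, Monotone fun n => ‖truncCubeFun n (f x)‖ₑ ^ 2 := by
    intro x m n hmn
    have : ‖truncCubeFun m (f x)‖ ≤ ‖truncCubeFun n (f x)‖ := by
      rw [norm_truncCubeFun, norm_truncCubeFun]
      gcongr
    simp only
    gcongr
    exact enorm_le_iff_norm_le.2 this
  simp_rw [h1]
  rw [← lintegral_iSup']
  · refine lintegral_congr fun x => ?_
    have h2 : Tendsto (fun n : ℕ => ‖truncCubeFun n (f x)‖ₑ ^ 2) atTop (𝓝 (‖f x‖ₑ ^ 6)) := by
      rw [← enorm_cubeFun_sq]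
      exact ((ENNReal.continuous_pow 2).tendsto _).comp (tendsto_truncCubeFun (f x)).enorm
    exact tendsto_nhds_unique h2 (tendsto_atTop_iSup (hmono x))
  · intro n
    exact (((lipschitzWith_truncCubeFun n).continuous.comp_aestronglyMeasurable
      (Lp.aestronglyMeasurable f)).enorm).pow_const 2
  · exact Eventually.of_forall hmono

theorem lowerSemicontinuous_sixthPower : LowerSemicontinuous sixthPower := by
  have : sixthPower = fun f => ⨆ n, ‖truncCube n f‖ₑ ^ 2 := funext sixthPower_eq_iSup
  rw [this]
  refine lowerSemicontinuous_iSup fun n => Continuous.lowerSemicontinuous ?_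
  exact (ENNReal.continuous_pow 2).comp (continuous_truncCube n).enorm

theorem measurable_sixthPower_schrodinger (f : L2) :
    Measurable fun σ => sixthPower (schrodinger σ f) :=
  (lowerSemicontinuous_sixthPower.comp (continuous_schrodinger_left f)).measurable

/-! ### The Strichartz estimate -/

/-! ### Gaussian averaging in time and level sets of quadratic forms -/

theorem integral_gaussian_mul_phase (c : ℝ) :
    ∫ σ : ℝ, (Real.exp (-Real.pi * σ ^ 2) : ℂ) *
      Complex.exp (((-(2 * Real.pi * σ * c) : ℝ) : ℂ) * Complex.I) =
      (Real.exp (-Real.pi * c ^ 2) : ℂ) := by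
  have hpi : (Real.pi : ℂ) ≠ 0 := by exact_mod_cast Real.pi_ne_zero
  have h := fourierIntegral_gaussian (b := (Real.pi : ℂ)) (by simpa using Real.pi_pos)
    (-(2 * Real.pi * c))
  rw [div_self hpi, Complex.one_cpow, one_mul] at h
  convert h using 1
  · refine integral_congr_ae (Eventually.of_forall fun σ => ?_)
    simp only
    rw [mul_comm]
    push_cast
    congr 2
    ring
  · push_cast
    congr 1
    field_simp
    norm_num

/-- A Schur test for oscillatory integrals with a Gaussian weight in the oscillation parameter. -/
theorem lintegral_gaussian_oscillatory_le {P : Type*} [MeasurableSpace P] {ν : Measure P}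
    [SFinite ν] {Q : P → ℝ} (hQ : Measurable Q) {F : P → ℂ} (hF : Integrable F ν) {K : ℝ≥0∞}
    (hK : ∀ c : ℝ, ∫⁻ p, ENNReal.ofReal (Real.exp (-Real.pi * (c - Q p) ^ 2)) ∂ν ≤ K) :
    ∫⁻ σ : ℝ, ENNReal.ofReal (Real.exp (-Real.pi * σ ^ 2)) *
      ‖∫ p, F p * Complex.exp (((-(2 * Real.pi * σ * Q p) : ℝ) : ℂ) * Complex.I) ∂ν‖ₑ ^ 2 ≤
      2 * K * ∫⁻ p, ‖F p‖ₑ ^ 2 ∂ν := by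
  set Φ : ℝ → ℂ := fun σ =>
    ∫ p, F p * Complex.exp (((-(2 * Real.pi * σ * Q p) : ℝ) : ℂ) * Complex.I) ∂ν with hΦ
  set H : ℝ × (P × P) → ℂ := fun y => (Real.exp (-Real.pi * y.1 ^ 2) : ℂ) *
    (F y.2.1 * (starRingEnd ℂ) (F y.2.2)) *
      Complex.exp (((-(2 * Real.pi * y.1 * (Q y.2.1 - Q y.2.2)) : ℝ) : ℂ) * Complex.I) with hH
  have hFF : Integrable (fun z : P × P => F z.1 * (starRingEnd ℂ) (F z.2)) (ν.prod ν) :=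
    hF.mul_prod ((Complex.conjCLE.toContinuousLinearMap.integrable_comp hF))
  have hg : Integrable (fun σ : ℝ => (Real.exp (-Real.pi * σ ^ 2) : ℂ)) volume :=
    (integrable_exp_neg_mul_sq Real.pi_pos).ofReal
  have hHi : Integrable H (volume.prod (ν.prod ν)) := by
    have h1 := hg.mul_prod hFF
    refine h1.mono (h1.aestronglyMeasurable.mul ?_) ?_
    · have : Measurable fun y : ℝ × (P × P) =>
          Complex.exp (((-(2 * Real.pi * y.1 * (Q y.2.1 - Q y.2.2)) : ℝ) : ℂ) * Complex.I) := by
        fun_prop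
      exact this.aestronglyMeasurable
    · refine Eventually.of_forall fun y => ?_
      simp only [hH]
      rw [norm_mul _ (Complex.exp _), Complex.norm_exp_ofReal_mul_I, mul_one]
  -- Expanding |Φ|² as a double integral allows the σ integral to be done first, where it produces
  -- the kernel exp(-π(Q - Q')²).
  have hJ : ∀ σ, ∫ z, H (σ, z) ∂(ν.prod ν) =
      ((Real.exp (-Real.pi * σ ^ 2) * ‖Φ σ‖ ^ 2 : ℝ) : ℂ) := by
    intro σ
    have h1 : (fun z : P × P => H (σ, z)) = fun z => (Real.exp (-Real.pi * σ ^ 2) : ℂ) *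
        ((F z.1 * Complex.exp (((-(2 * Real.pi * σ * Q z.1) : ℝ) : ℂ) * Complex.I)) *
        (starRingEnd ℂ) (F z.2 * Complex.exp (((-(2 * Real.pi * σ * Q z.2) : ℝ) : ℂ) *
          Complex.I))) := by
      funext z
      simp only [hH]
      rw [map_mul, ← Complex.exp_conj]
      have h2 : Complex.exp (((-(2 * Real.pi * σ * (Q z.1 - Q z.2)) : ℝ) : ℂ) * Complex.I) =
          Complex.exp (((-(2 * Real.pi * σ * Q z.1) : ℝ) : ℂ) * Complex.I) *
          Complex.exp ((starRingEnd ℂ) (((-(2 * Real.pi * σ * Q z.2) : ℝ) : ℂ) * Complex.I)) := by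
        rw [← Complex.exp_add, map_mul, Complex.conj_ofReal, Complex.conj_I]
        congr 1
        push_cast
        ring
      rw [h2]
      ring
    rw [h1, integral_const_mul, integral_prod_mul
      (fun p => F p * Complex.exp (((-(2 * Real.pi * σ * Q p) : ℝ) : ℂ) * Complex.I))
      (fun p => (starRingEnd ℂ)
        (F p * Complex.exp (((-(2 * Real.pi * σ * Q p) : ℝ) : ℂ) * Complex.I))),
      integral_conj, Complex.mul_conj, Complex.normSq_eq_norm_sq]
    rw [Complex.ofReal_mul, Complex.ofReal_pow]
  have hr : Integrable (fun σ => Real.exp (-Real.pi * σ ^ 2) * ‖Φ σ‖ ^ 2) volume := by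
    have h1 := hHi.integral_prod_left
    simp_rw [hJ] at h1
    refine h1.norm.congr (Eventually.of_forall fun σ => ?_)
    simp only
    rw [Complex.norm_real, Real.norm_of_nonneg (by positivity)]
  have hL : ∫⁻ σ : ℝ, ENNReal.ofReal (Real.exp (-Real.pi * σ ^ 2)) * ‖Φ σ‖ₑ ^ 2 =
      ‖∫ z, (∫ σ, H (σ, z)) ∂(ν.prod ν)‖ₑ := by
    have h1 : ∫ z, (∫ σ, H (σ, z)) ∂(ν.prod ν) = ∫ σ, (∫ z, H (σ, z) ∂(ν.prod ν)) :=
      (integral_integral_swap (f := fun σ z => H (σ, z)) hHi).symm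
    rw [h1]
    simp_rw [hJ]
    rw [integral_complex_ofReal, ← ofReal_norm, Complex.norm_real,
      Real.norm_of_nonneg (integral_nonneg fun σ => by positivity),
      ofReal_integral_eq_lintegral_ofReal hr (Eventually.of_forall fun σ => by positivity)]
    refine lintegral_congr fun σ => ?_
    rw [ENNReal.ofReal_mul (by positivity), ENNReal.ofReal_pow (by positivity), ofReal_norm]
  have hin : ∀ z : P × P, ∫ σ, H (σ, z) = F z.1 * (starRingEnd ℂ) (F z.2) *
      (Real.exp (-Real.pi * (Q z.1 - Q z.2) ^ 2) : ℂ) := by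
    intro z
    rw [← integral_gaussian_mul_phase, ← integral_const_mul]
    refine integral_congr_ae (Eventually.of_forall fun σ => ?_)
    simp only [hH]
    ring
  set G : P × P → ℝ≥0∞ := fun z => ENNReal.ofReal (Real.exp (-Real.pi * (Q z.1 - Q z.2) ^ 2))
    with hG
  have hGm : Measurable G := by fun_prop
  have hFm : AEMeasurable (fun p => ‖F p‖ₑ ^ 2) ν := hF.aestronglyMeasurable.enorm.pow_const 2
  have hF1 : AEMeasurable (fun z : P × P => ‖F z.1‖ₑ ^ 2 * G z) (ν.prod ν) :=
    hFm.comp_fst.mul hGm.aemeasurable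
  have hF2 : AEMeasurable (fun z : P × P => ‖F z.2‖ₑ ^ 2 * G z) (ν.prod ν) :=
    hFm.comp_snd.mul hGm.aemeasurable
  have hK' : ∀ c : ℝ, ∫⁻ p, ENNReal.ofReal (Real.exp (-Real.pi * (Q p - c) ^ 2)) ∂ν ≤ K := by
    intro c
    refine le_trans (le_of_eq ?_) (hK c)
    refine lintegral_congr fun p => ?_
    congr 3
    ring
  rw [hL]
  calc ‖∫ z, (∫ σ, H (σ, z)) ∂(ν.prod ν)‖ₑ ≤ ∫⁻ z, ‖∫ σ, H (σ, z)‖ₑ ∂(ν.prod ν) :=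
        enorm_integral_le_lintegral_enorm _
    -- The cruder |F||F'| ≤ |F|² + |F'|², without the factor 1/2, is the source of the 2 in the
    -- final bound.
    _ ≤ ∫⁻ z, (‖F z.1‖ₑ ^ 2 * G z + ‖F z.2‖ₑ ^ 2 * G z) ∂(ν.prod ν) := by
        refine lintegral_mono fun z => ?_
        rw [hin, enorm_mul, enorm_mul, ← add_mul]
        have h1 : ‖(Real.exp (-Real.pi * (Q z.1 - Q z.2) ^ 2) : ℂ)‖ₑ = G z := by
          rw [← ofReal_norm, Complex.norm_real, Real.norm_of_nonneg (Real.exp_nonneg _)]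
        have h2 : ‖(starRingEnd ℂ) (F z.2)‖ₑ = ‖F z.2‖ₑ := by
          rw [← ofReal_norm, RCLike.norm_conj, ofReal_norm]
        rw [h1, h2]
        gcongr
        rcases le_total ‖F z.1‖ₑ ‖F z.2‖ₑ with h | h
        · calc ‖F z.1‖ₑ * ‖F z.2‖ₑ ≤ ‖F z.2‖ₑ * ‖F z.2‖ₑ := by gcongr
            _ = ‖F z.2‖ₑ ^ 2 := (sq _).symm
            _ ≤ _ := le_add_self
        · calc ‖F z.1‖ₑ * ‖F z.2‖ₑ ≤ ‖F z.1‖ₑ * ‖F z.1‖ₑ := by gcongr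
            _ = ‖F z.1‖ₑ ^ 2 := (sq _).symm
            _ ≤ _ := le_self_add
    _ = (∫⁻ p, ‖F p‖ₑ ^ 2 * ∫⁻ q, G (p, q) ∂ν ∂ν) + ∫⁻ q, ‖F q‖ₑ ^ 2 * ∫⁻ p, G (p, q) ∂ν ∂ν := by
        rw [lintegral_add_left' hF1, lintegral_prod _ hF1, lintegral_prod_symm _ hF2]
        congr 1
        · refine lintegral_congr fun p => ?_
          exact lintegral_const_mul (‖F p‖ₑ ^ 2) (f := fun q => G (p, q))
            (hGm.comp measurable_prodMk_left)
        · refine lintegral_congr fun q => ?_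
          exact lintegral_const_mul (‖F q‖ₑ ^ 2) (f := fun p => G (p, q))
            (hGm.comp measurable_prodMk_right)
    _ ≤ (∫⁻ p, ‖F p‖ₑ ^ 2 * K ∂ν) + ∫⁻ q, ‖F q‖ₑ ^ 2 * K ∂ν := by
        gcongr with p q
        · exact hK (Q p)
        · exact hK' (Q q)
    _ = 2 * K * ∫⁻ p, ‖F p‖ₑ ^ 2 ∂ν := by
        rw [lintegral_mul_const'' _ hFm]
        ring

theorem lintegral_gaussian_sub (c : ℝ) :
    ∫⁻ v : ℝ, ENNReal.ofReal (Real.exp (-Real.pi * (c - v) ^ 2)) = 1 := by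
  have h1 := lintegral_sub_left_eq_self (μ := volume)
    (fun v : ℝ => ENNReal.ofReal (Real.exp (-Real.pi * v ^ 2))) c
  rw [h1, ← ofReal_integral_eq_lintegral_ofReal (integrable_exp_neg_mul_sq Real.pi_pos)
    (Eventually.of_forall fun σ => by positivity), integral_gaussian, div_self Real.pi_ne_zero]
  simp

/-- Substitute v = m r²: since m ≥ 1, r dr is at most dv, and the Gaussian in v has mass 1. The
planar area element is exactly what absorbs the derivative of the quadratic. -/
theorem lintegral_radial_gaussian_le (c : ℝ) {m : ℝ} (hm : 1 ≤ m) :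
    ∫⁻ r in Ioi (0 : ℝ), ENNReal.ofReal r * ENNReal.ofReal (Real.exp (-Real.pi * (c - m * r ^ 2) ^ 2))
      ≤ 1 := by
  have h1 := lintegral_image_eq_lintegral_abs_deriv_mul (s := Ioi (0 : ℝ))
    (f := fun r => m * r ^ 2) (f' := fun r => m * (2 * r)) measurableSet_Ioi
    (fun x _ => by
      have := ((hasDerivAt_pow 2 x).const_mul m).hasDerivWithinAt (s := Ioi 0)
      simpa using this)
    (fun x hx y hy hxy => by
      have hx : 0 < x := hx
      have hy : 0 < y := hy
      have h2 : x ^ 2 = y ^ 2 := mul_left_cancel₀ (by positivity : m ≠ 0) hxy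
      exact (pow_left_inj₀ hx.le hy.le two_ne_zero).1 h2)
    (fun v => ENNReal.ofReal (Real.exp (-Real.pi * (c - v) ^ 2)))
  calc _ ≤ ∫⁻ r in Ioi (0 : ℝ), ENNReal.ofReal |m * (2 * r)| *
        ENNReal.ofReal (Real.exp (-Real.pi * (c - m * r ^ 2) ^ 2)) := by
        refine setLIntegral_mono' measurableSet_Ioi fun r hr => ?_
        have hr : 0 < r := hr
        gcongr
        rw [abs_of_nonneg (by positivity)]
        nlinarith
    _ = _ := h1.symm
    _ ≤ ∫⁻ v : ℝ, ENNReal.ofReal (Real.exp (-Real.pi * (c - v) ^ 2)) := setLIntegral_le_lintegral _ _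
    _ = 1 := lintegral_gaussian_sub c

/-- Gaussian neighbourhoods of the level sets of a positive definite quadratic form in the plane have
uniformly bounded area. -/
theorem lintegral_gaussian_quadratic_le (c : ℝ) :
    ∫⁻ p : ℝ × ℝ, ENNReal.ofReal
      (Real.exp (-Real.pi * (c - (4 * Real.pi * p.1 ^ 2 + 3 * Real.pi * p.2 ^ 2)) ^ 2)) ≤
      ENNReal.ofReal (2 * Real.pi) := by
  rw [← lintegral_comp_polarCoord_symm, polarCoord_target]
  have hmeas : Measurable fun p : ℝ × ℝ => ENNReal.ofReal p.1 • ENNReal.ofReal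
      (Real.exp (-Real.pi * (c - (4 * Real.pi * (polarCoord.symm p).1 ^ 2 +
        3 * Real.pi * (polarCoord.symm p).2 ^ 2)) ^ 2)) := by
    simp only [polarCoord_symm_apply]
    fun_prop
  rw [Measure.volume_eq_prod, ← Measure.prod_restrict, lintegral_prod_symm _ hmeas.aemeasurable]
  calc _ ≤ ∫⁻ _ in Ioo (-Real.pi) Real.pi, 1 := by
        refine lintegral_mono fun θ => ?_
        have hm : 1 ≤ 4 * Real.pi * Real.cos θ ^ 2 + 3 * Real.pi * Real.sin θ ^ 2 := by
          nlinarith [Real.pi_gt_three, Real.sin_sq_add_cos_sq θ, sq_nonneg (Real.cos θ),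
            mul_nonneg Real.pi_pos.le (sq_nonneg (Real.cos θ))]
        refine le_trans (le_of_eq ?_) (lintegral_radial_gaussian_le c hm)
        refine lintegral_congr fun r => ?_
        simp only [polarCoord_symm_apply, smul_eq_mul]
        congr 4
        ring
    _ = _ := by
        simp only [lintegral_const, Measure.restrict_apply, MeasurableSet.univ, univ_inter,
          Real.volume_Ioo, one_mul]
        congr 1
        ring

/-- Centring at η/3 and completing the square, p₂ = y + η/3 and p₁ = x + η/3 - y/2, turns the sum of
squares into η²/3 + 2x² + (3/2)y². The constant is absorbed in c. -/
theorem lintegral_gaussian_phase_le (c η : ℝ) :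
    ∫⁻ p : ℝ × ℝ, ENNReal.ofReal (Real.exp (-Real.pi *
      (c - 2 * Real.pi * (p.1 ^ 2 + p.2 ^ 2 + (η - p.1 - p.2) ^ 2)) ^ 2)) ≤
      ENNReal.ofReal (2 * Real.pi) := by
  set c' := c - 2 * Real.pi * (η ^ 2 / 3) with hc'
  refine le_trans (le_of_eq ?_) (lintegral_gaussian_quadratic_le c')
  rw [Measure.volume_eq_prod, lintegral_prod_symm _ (by fun_prop),
    lintegral_prod_symm _ (by fun_prop)]
  rw [← lintegral_add_right_eq_self (μ := volume) _ (η / 3)]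
  refine lintegral_congr fun y => ?_
  rw [← lintegral_add_right_eq_self (μ := volume) _ (η / 3 - y / 2)]
  refine lintegral_congr fun x => ?_
  congr 4
  rw [hc']
  ring

/-- The product of two Schwartz functions. -/
def schwartzMul (A B : 𝓢(ℝ, ℂ)) : 𝓢(ℝ, ℂ) :=
  SchwartzMap.pairing (ContinuousLinearMap.mul ℂ ℂ) A B

@[simp]
theorem schwartzMul_apply (A B : 𝓢(ℝ, ℂ)) (x : ℝ) : schwartzMul A B x = A x * B x := by
  simp [schwartzMul]

theorem schwartz_fourierInv_apply (A : 𝓢(ℝ, ℂ)) (x : ℝ) :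
    (𝓕⁻ A : 𝓢(ℝ, ℂ)) x = (𝓕 A : 𝓢(ℝ, ℂ)) (-x) := by
  rw [SchwartzMap.fourierInv_coe, SchwartzMap.fourier_coe, Real.fourierInv_eq_fourier_neg]

/-- The Fourier transform of a product is the convolution of the Fourier transforms. -/
theorem fourier_schwartzMul (A B : 𝓢(ℝ, ℂ)) (η : ℝ) :
    (𝓕 (schwartzMul A B) : 𝓢(ℝ, ℂ)) η =
      ∫ ζ, (𝓕 A : 𝓢(ℝ, ℂ)) ζ * (𝓕 B : 𝓢(ℝ, ℂ)) (η - ζ) := by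
  set D := SchwartzMap.convolution (ContinuousLinearMap.mul ℂ ℂ) (𝓕 A) (𝓕 B) with hD
  have h1 : (𝓕⁻ D : 𝓢(ℝ, ℂ)) = schwartzMul A B := by
    ext x
    rw [schwartz_fourierInv_apply, hD, SchwartzMap.fourier_convolution,
      SchwartzMap.pairing_apply_apply, ← schwartz_fourierInv_apply, ← schwartz_fourierInv_apply,
      FourierTransform.fourierInv_fourier_eq, FourierTransform.fourierInv_fourier_eq,
      schwartzMul_apply]
    rfl
  rw [← h1, FourierTransform.fourier_fourierInv_eq, hD, SchwartzMap.convolution_apply]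
  rfl

theorem enorm_toLp_sq (A : 𝓢(ℝ, ℂ)) : ‖A.toLp 2‖ₑ ^ 2 = ∫⁻ x, ‖A x‖ₑ ^ 2 := by
  rw [enorm_sq_eq_lintegral]
  refine lintegral_congr_ae ?_
  filter_upwards [SchwartzMap.coeFn_toLp A 2 volume] with x hx
  rw [hx]

theorem lintegral_fourier_sq (A : 𝓢(ℝ, ℂ)) :
    ∫⁻ x, ‖(𝓕 A : 𝓢(ℝ, ℂ)) x‖ₑ ^ 2 = ∫⁻ x, ‖A x‖ₑ ^ 2 := by
  rw [← enorm_toLp_sq, ← enorm_toLp_sq, ← ofReal_norm, SchwartzMap.norm_fourier_toL2_eq,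
    ofReal_norm]

theorem schrodingerSymbol_eq_exp_phase (σ ζ : ℝ) :
    schrodingerSymbol σ ζ =
      Complex.exp (((-(2 * Real.pi * σ * (2 * Real.pi * ζ ^ 2)) : ℝ) : ℂ) * Complex.I) := by
  rw [schrodingerSymbol_eq]
  congr 3
  ring

/-! ### The cube of a free wave on the Fourier side -/

section TripleProduct

variable (φ : 𝓢(ℝ, ℂ))

/-- The amplitude of the Fourier transform of a triple product. -/
def tripleAmplitude (η : ℝ) (p : ℝ × ℝ) : ℂ :=
  (𝓕 φ : 𝓢(ℝ, ℂ)) p.1 * ((𝓕 φ : 𝓢(ℝ, ℂ)) p.2 * (𝓕 φ : 𝓢(ℝ, ℂ)) (η - p.1 - p.2))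

/-- The phase of the Fourier transform of a triple product. -/
def triplePhase (η : ℝ) (p : ℝ × ℝ) : ℝ :=
  2 * Real.pi * (p.1 ^ 2 + p.2 ^ 2 + (η - p.1 - p.2) ^ 2)

theorem continuous_tripleAmplitude {X : Type*} [TopologicalSpace X] {η : X → ℝ} {p : X → ℝ × ℝ}
    (hη : Continuous η) (hp : Continuous p) :
    Continuous fun x => tripleAmplitude φ (η x) (p x) := by
  unfold tripleAmplitude
  have h := (𝓕 φ : 𝓢(ℝ, ℂ)).continuous
  exact (h.comp hp.fst).mul ((h.comp hp.snd).mul (h.comp ((hη.sub hp.fst).sub hp.snd)))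

theorem integrable_tripleAmplitude (η : ℝ) : Integrable (tripleAmplitude φ η) := by
  have hi := (𝓕 φ : 𝓢(ℝ, ℂ)).integrable (μ := volume)
  have h1 := (hi.mul_prod hi).norm.mul_const (SchwartzMap.seminorm ℝ 0 0 (𝓕 φ : 𝓢(ℝ, ℂ)))
  refine h1.mono' ?_ (Eventually.of_forall fun p => ?_)
  · exact (continuous_tripleAmplitude φ continuous_const continuous_id).aestronglyMeasurable
  · simp only [tripleAmplitude]
    rw [← mul_assoc, norm_mul]
    gcongr
    exact SchwartzMap.norm_le_seminorm ℝ _ _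

theorem fourier_triple (σ η : ℝ) :
    (𝓕 (schwartzMul (freeEvolution σ φ) (schwartzMul (freeEvolution σ φ) (freeEvolution σ φ))) :
      𝓢(ℝ, ℂ)) η = ∫ p : ℝ × ℝ, tripleAmplitude φ η p *
        Complex.exp (((-(2 * Real.pi * σ * triplePhase η p) : ℝ) : ℂ) * Complex.I) := by
  rw [fourier_schwartzMul, Measure.volume_eq_prod, integral_prod]
  · refine integral_congr_ae (Eventually.of_forall fun p₁ => ?_)
    simp only
    rw [fourier_schwartzMul, ← integral_const_mul]
    refine integral_congr_ae (Eventually.of_forall fun p₂ => ?_)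
    simp only [fourier_freeEvolution, tripleAmplitude, triplePhase, schrodingerSymbol_eq_exp_phase]
    have : Complex.exp (((-(2 * Real.pi * σ * (2 * Real.pi *
        (p₁ ^ 2 + p₂ ^ 2 + (η - p₁ - p₂) ^ 2))) : ℝ) : ℂ) * Complex.I) =
        Complex.exp (((-(2 * Real.pi * σ * (2 * Real.pi * p₁ ^ 2)) : ℝ) : ℂ) * Complex.I) *
        (Complex.exp (((-(2 * Real.pi * σ * (2 * Real.pi * p₂ ^ 2)) : ℝ) : ℂ) * Complex.I) *
        Complex.exp (((-(2 * Real.pi * σ * (2 * Real.pi * (η - p₁ - p₂) ^ 2)) : ℝ) : ℂ) *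
          Complex.I)) := by
      rw [← Complex.exp_add, ← Complex.exp_add]
      congr 1
      push_cast
      ring
    rw [this]
    ring
  · have h1 := integrable_tripleAmplitude φ η
    rw [← Measure.volume_eq_prod]
    refine h1.mono (h1.aestronglyMeasurable.mul ?_) (Eventually.of_forall fun p => ?_)
    · unfold triplePhase
      exact (by fun_prop : Continuous _).aestronglyMeasurable
    · rw [norm_mul, Complex.norm_exp_ofReal_mul_I, mul_one]

/-- Plancherel applied to |v|⁶ = |v³|². Using v³ rather than |v|²v puts no conjugate in the product,
so the phase is a positive definite quadratic form. -/
theorem sixthPower_schrodinger_toLp (σ : ℝ) :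
    sixthPower (schrodinger σ (φ.toLp 2)) = ∫⁻ η, ‖∫ p : ℝ × ℝ, tripleAmplitude φ η p *
        Complex.exp (((-(2 * Real.pi * σ * triplePhase η p) : ℝ) : ℂ) * Complex.I)‖ₑ ^ 2 := by
  simp_rw [← fourier_triple]
  rw [lintegral_fourier_sq, schrodinger_toLp,
    sixthPower_congr_ae (SchwartzMap.coeFn_toLp (freeEvolution σ φ) 2 volume)]
  refine lintegral_congr fun x => ?_
  simp only [schwartzMul_apply, enorm_mul]
  ring

theorem lintegral_tripleAmplitude_sq :
    ∫⁻ η, ∫⁻ p, ‖tripleAmplitude φ η p‖ₑ ^ 2 = ‖φ.toLp 2‖ₑ ^ 6 := by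
  have hc := (𝓕 φ : 𝓢(ℝ, ℂ)).continuous
  have hm : Measurable fun y : ℝ × (ℝ × ℝ) => ‖tripleAmplitude φ y.1 y.2‖ₑ ^ 2 :=
    (continuous_tripleAmplitude φ continuous_fst continuous_snd).enorm.measurable.pow_const 2
  set m := ∫⁻ x, ‖(𝓕 φ : 𝓢(ℝ, ℂ)) x‖ₑ ^ 2 with hmdef
  have hmeas : Measurable fun x => ‖(𝓕 φ : 𝓢(ℝ, ℂ)) x‖ₑ ^ 2 := hc.enorm.measurable.pow_const 2
  have h6 : ‖φ.toLp 2‖ₑ ^ 6 = m ^ 3 := by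
    rw [hmdef, lintegral_fourier_sq, ← enorm_toLp_sq]
    ring
  rw [h6, lintegral_lintegral_swap hm.aemeasurable]
  have h1 : ∀ p : ℝ × ℝ, ∫⁻ η, ‖tripleAmplitude φ η p‖ₑ ^ 2 =
      ‖(𝓕 φ : 𝓢(ℝ, ℂ)) p.1‖ₑ ^ 2 * ‖(𝓕 φ : 𝓢(ℝ, ℂ)) p.2‖ₑ ^ 2 * m := by
    intro p
    have h2 : ∀ η, ‖tripleAmplitude φ η p‖ₑ ^ 2 =
        ‖(𝓕 φ : 𝓢(ℝ, ℂ)) p.1‖ₑ ^ 2 * ‖(𝓕 φ : 𝓢(ℝ, ℂ)) p.2‖ₑ ^ 2 *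
          ‖(𝓕 φ : 𝓢(ℝ, ℂ)) (η - (p.1 + p.2))‖ₑ ^ 2 := by
      intro η
      rw [tripleAmplitude, enorm_mul, enorm_mul, sub_sub]
      ring
    simp_rw [h2]
    rw [lintegral_const_mul _ (f := fun η => ‖(𝓕 φ : 𝓢(ℝ, ℂ)) (η - (p.1 + p.2))‖ₑ ^ 2)
      (hmeas.comp (measurable_id.sub_const _)), lintegral_sub_right_eq_self (fun η => ‖(𝓕 φ : 𝓢(ℝ, ℂ)) η‖ₑ ^ 2)]
  simp_rw [h1]
  rw [lintegral_mul_const _ (by fun_prop), Measure.volume_eq_prod,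
    lintegral_prod_mul hmeas.aemeasurable hmeas.aemeasurable]
  ring

/-- The Strichartz estimate for Schwartz functions, with a Gaussian weight in time. -/
theorem lintegral_gaussian_mul_sixthPower_toLp_le :
    ∫⁻ σ : ℝ, ENNReal.ofReal (Real.exp (-Real.pi * σ ^ 2)) *
      sixthPower (schrodinger σ (φ.toLp 2)) ≤
      2 * ENNReal.ofReal (2 * Real.pi) * ‖φ.toLp 2‖ₑ ^ 6 := by
  have hsm : StronglyMeasurable fun y : ℝ × ℝ => ∫ p : ℝ × ℝ, tripleAmplitude φ y.2 p *
        Complex.exp (((-(2 * Real.pi * y.1 * triplePhase y.2 p) : ℝ) : ℂ) * Complex.I) := by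
    have h1 : Continuous fun z : (ℝ × ℝ) × (ℝ × ℝ) => tripleAmplitude φ z.1.2 z.2 :=
      continuous_tripleAmplitude φ (by fun_prop) (by fun_prop)
    have h2 : Continuous fun z : (ℝ × ℝ) × (ℝ × ℝ) =>
        Complex.exp (((-(2 * Real.pi * z.1.1 * triplePhase z.1.2 z.2) : ℝ) : ℂ) * Complex.I) := by
      unfold triplePhase
      fun_prop
    exact (h1.mul h2).stronglyMeasurable.integral_prod_right'
  have hm : Measurable fun y : ℝ × ℝ => ENNReal.ofReal (Real.exp (-Real.pi * y.1 ^ 2)) *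
      ‖∫ p : ℝ × ℝ, tripleAmplitude φ y.2 p *
        Complex.exp (((-(2 * Real.pi * y.1 * triplePhase y.2 p) : ℝ) : ℂ) * Complex.I)‖ₑ ^ 2 :=
    Measurable.mul (by fun_prop) (hsm.enorm.pow_const 2)
  calc _ = ∫⁻ σ : ℝ, ∫⁻ η : ℝ, ENNReal.ofReal (Real.exp (-Real.pi * σ ^ 2)) *
        ‖∫ p : ℝ × ℝ, tripleAmplitude φ η p *
        Complex.exp (((-(2 * Real.pi * σ * triplePhase η p) : ℝ) : ℂ) * Complex.I)‖ₑ ^ 2 := by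
        refine lintegral_congr fun σ => ?_
        rw [sixthPower_schrodinger_toLp, lintegral_const_mul' _ _ ENNReal.ofReal_ne_top]
    _ = ∫⁻ η : ℝ, ∫⁻ σ : ℝ, ENNReal.ofReal (Real.exp (-Real.pi * σ ^ 2)) *
        ‖∫ p : ℝ × ℝ, tripleAmplitude φ η p *
        Complex.exp (((-(2 * Real.pi * σ * triplePhase η p) : ℝ) : ℂ) * Complex.I)‖ₑ ^ 2 :=
        lintegral_lintegral_swap hm.aemeasurable
    _ ≤ ∫⁻ η : ℝ, 2 * ENNReal.ofReal (2 * Real.pi) * ∫⁻ p, ‖tripleAmplitude φ η p‖ₑ ^ 2 := by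
        refine lintegral_mono fun η => ?_
        refine lintegral_gaussian_oscillatory_le (by unfold triplePhase; fun_prop)
          (integrable_tripleAmplitude φ η) fun c => lintegral_gaussian_phase_le c η
    _ = _ := by
        rw [lintegral_const_mul' _ _ (by finiteness), lintegral_tripleAmplitude_sq]

end TripleProduct

/-! ### From the Gaussian weight to the unit interval, and from Schwartz functions to L² -/

/-- The constant in the Strichartz estimate. -/
def strichartzConst : ℝ := Real.exp Real.pi * (4 * Real.pi)

theorem strichartzConst_pos : 0 < strichartzConst := by
  unfold strichartzConst
  positivity

/-- The Gaussian weight is at least e^{-π} on [0,1]. -/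
theorem lintegral_Icc_le_exp_mul {g : ℝ → ℝ≥0∞} :
    ∫⁻ σ in Icc (0 : ℝ) 1, g σ ≤ ENNReal.ofReal (Real.exp Real.pi) *
      ∫⁻ σ, ENNReal.ofReal (Real.exp (-Real.pi * σ ^ 2)) * g σ := by
  rw [← lintegral_const_mul' _ _ ENNReal.ofReal_ne_top]
  refine le_trans ?_ (setLIntegral_le_lintegral (Icc (0 : ℝ) 1) _)
  refine setLIntegral_mono' measurableSet_Icc fun σ hσ => ?_
  rw [← mul_assoc, ← ENNReal.ofReal_mul (by positivity), ← Real.exp_add]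
  refine le_mul_of_one_le_left zero_le ?_
  rw [ENNReal.one_le_ofReal]
  refine Real.one_le_exp ?_
  have : σ ^ 2 ≤ 1 := pow_le_one₀ hσ.1 hσ.2
  nlinarith [Real.pi_pos]

theorem lintegral_sixthPower_toLp_le (φ : 𝓢(ℝ, ℂ)) :
    ∫⁻ σ in Icc (0 : ℝ) 1, sixthPower (schrodinger σ (φ.toLp 2)) ≤
      ENNReal.ofReal strichartzConst * ‖φ.toLp 2‖ₑ ^ 6 := by
  have h1 := lintegral_gaussian_mul_sixthPower_toLp_le φ
  generalize ‖φ.toLp 2‖ₑ ^ 6 = a at h1 ⊢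
  refine lintegral_Icc_le_exp_mul.trans ?_
  refine (mul_le_mul_right h1 _).trans (le_of_eq ?_)
  have h2 : (2 : ℝ≥0∞) * ENNReal.ofReal (2 * Real.pi) = ENNReal.ofReal (4 * Real.pi) := by
    have h3 : (2 : ℝ≥0∞) = ENNReal.ofReal 2 := by simp
    rw [h3, ← ENNReal.ofReal_mul (by norm_num)]
    congr 1
    ring
  rw [h2, strichartzConst, ENNReal.ofReal_mul (p := Real.exp Real.pi) (by positivity), mul_assoc]

theorem exists_schwartz_seq_tendsto (f : L2) :
    ∃ g : ℕ → L2, (∀ n, ∃ φ : 𝓢(ℝ, ℂ), g n = φ.toLp 2) ∧ Tendsto g atTop (𝓝 f) := by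
  have hd : DenseRange (SchwartzMap.toLpCLM ℝ (E := ℝ) ℂ 2 volume) :=
    SchwartzMap.denseRange_toLpCLM (by norm_num)
  obtain ⟨v, hv, hlim⟩ := mem_closure_iff_seq_limit.1 (hd f)
  refine ⟨v, fun n => ?_, hlim⟩
  obtain ⟨φ, hφ⟩ := hv n
  exact ⟨φ, by rw [← hφ, SchwartzMap.toLpCLM_apply]⟩

/-- Lower semicontinuity at each σ followed by Fatou in σ; no continuity of the sixth power on L² is
needed. -/
theorem lintegral_sixthPower_le_liminf {g : ℕ → L2} {f : L2} (hg : Tendsto g atTop (𝓝 f)) :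
    ∫⁻ σ in Icc (0 : ℝ) 1, sixthPower (schrodinger σ f) ≤
      liminf (fun n => ∫⁻ σ in Icc (0 : ℝ) 1, sixthPower (schrodinger σ (g n))) atTop := by
  have h1 : ∀ σ, sixthPower (schrodinger σ f) ≤
      liminf (fun n => sixthPower (schrodinger σ (g n))) atTop := by
    intro σ
    have h2 : Tendsto (fun n => schrodinger σ (g n)) atTop (𝓝 (schrodinger σ f)) :=
      ((propagator σ).continuous.tendsto f).comp hg
    refine (lowerSemicontinuousAt_iff_le_liminf.1
      (lowerSemicontinuous_sixthPower (schrodinger σ f))).trans ?_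
    have h3 := liminf_le_liminf_of_le (u := sixthPower) h2
    exact h3
  exact (lintegral_mono h1).trans
    (lintegral_liminf_le fun n => measurable_sixthPower_schrodinger (g n))

/-- The `L⁶` Strichartz estimate on a unit time interval. -/
theorem lintegral_sixthPower_le (f : L2) :
    ∫⁻ σ in Icc (0 : ℝ) 1, sixthPower (schrodinger σ f) ≤
      ENNReal.ofReal strichartzConst * ‖f‖ₑ ^ 6 := by
  obtain ⟨g, hg, hlim⟩ := exists_schwartz_seq_tendsto f
  have h1 : ∀ n, ∫⁻ σ in Icc (0 : ℝ) 1, sixthPower (schrodinger σ (g n)) ≤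
      ENNReal.ofReal strichartzConst * ‖g n‖ₑ ^ 6 := by
    intro n
    obtain ⟨φ, hφ⟩ := hg n
    rw [hφ]
    exact lintegral_sixthPower_toLp_le φ
  refine (lintegral_sixthPower_le_liminf hlim).trans ?_
  refine (liminf_le_liminf (Eventually.of_forall h1)).trans (le_of_eq (Tendsto.liminf_eq ?_))
  refine ENNReal.Tendsto.const_mul ?_ (Or.inr ENNReal.ofReal_ne_top)
  exact ((ENNReal.continuous_pow 6).tendsto _).comp hlim.enorm

/-! ### The nonlinearity -/

theorem ae_hasCube (f : L2) :
    ∀ᵐ σ ∂(volume.restrict (Icc (0 : ℝ) 1)), HasCube (schrodinger σ f) := by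
  have h := ae_lt_top (measurable_sixthPower_schrodinger f)
    ((lintegral_sixthPower_le f).trans_lt (by finiteness)).ne
  filter_upwards [h] with σ hσ
  exact (hasCube_iff _).2 hσ

theorem hasCube_zero : HasCube 0 := by
  rw [hasCube_iff, sixthPower_congr_ae (Lp.coeFn_zero ℂ 2 volume)]
  simp

@[simp]
theorem cube_zero : cube 0 = 0 := by
  apply Lp.ext
  filter_upwards [coeFn_cube hasCube_zero, Lp.coeFn_zero ℂ 2 volume] with x h1 h2
  rw [h1, h2]
  simp [cubeFun]

@[simp]
theorem nonlinearityIntegrand_zero (σ : ℝ) : nonlinearityIntegrand 0 σ = 0 := by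
  simp [nonlinearityIntegrand]

@[simp]
theorem nonlinearity_zero : nonlinearity 0 = 0 := by
  simp [nonlinearity]

/-- The cube itself is not continuous on L², but its truncations are, and they converge at almost
every σ. -/
theorem aestronglyMeasurable_nonlinearityIntegrand (f : L2) :
    AEStronglyMeasurable (nonlinearityIntegrand f) (volume.restrict (Icc (0 : ℝ) 1)) := by
  refine aestronglyMeasurable_of_tendsto_ae (u := atTop)
    (f := fun (n : ℕ) σ => schrodinger (-σ) (truncCube n (schrodinger σ f))) (fun n => ?_) ?_
  · have h1 : Continuous fun σ : ℝ => truncCube n (schrodinger σ f) :=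
      (continuous_truncCube n).comp (continuous_schrodinger_left f)
    have h2 : Continuous fun σ : ℝ => (-σ, truncCube n (schrodinger σ f)) :=
      continuous_neg.prodMk h1
    exact (continuous_schrodinger.comp h2).aestronglyMeasurable
  · filter_upwards [ae_hasCube f] with σ hσ
    exact ((propagator (-σ)).continuous.tendsto _).comp (tendsto_truncCube hσ)

/-- The constant in the Lipschitz estimate for the nonlinearity. -/
def nonlinearityConst : ℝ := 1 + 27 * strichartzConst

theorem nonlinearityConst_pos : 0 < nonlinearityConst := by
  have := strichartzConst_pos
  unfold nonlinearityConst
  positivity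

theorem lintegral_sixthPower_mul_le {f : L2} {R : ℝ} (hR : 0 < R) (hf : ‖f‖ ≤ R) :
    ∫⁻ σ in Icc (0 : ℝ) 1, sixthPower (schrodinger σ f) * ENNReal.ofReal (R⁻¹ ^ 6) ≤
      ENNReal.ofReal strichartzConst := by
  rw [lintegral_mul_const _ (measurable_sixthPower_schrodinger f)]
  have h1 : ‖f‖ₑ ^ 6 ≤ ENNReal.ofReal (R ^ 6) := by
    rw [ENNReal.ofReal_pow hR.le, ← ofReal_norm]
    gcongr
  calc _ ≤ ENNReal.ofReal strichartzConst * ENNReal.ofReal (R ^ 6) * ENNReal.ofReal (R⁻¹ ^ 6) := by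
        gcongr
        exact (lintegral_sixthPower_le f).trans (by gcongr)
    _ = _ := by
        rw [mul_assoc, ← ENNReal.ofReal_mul (by positivity), ← mul_pow, mul_inv_cancel₀ hR.ne']
        simp

/-- Replaces Cauchy–Schwarz in σ on the unit interval: a bound on the mean square becomes a bound on
the mean, with l chosen as the expected size. -/
theorem enorm_le_add_inv_mul_sq (x : ℝ≥0∞) {l : ℝ} (hl : 0 < l) :
    x ≤ ENNReal.ofReal l + ENNReal.ofReal l⁻¹ * x ^ 2 := by
  rcases le_total x (ENNReal.ofReal l) with h | h
  · exact h.trans le_self_add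
  · refine le_trans ?_ le_add_self
    calc x = ENNReal.ofReal l⁻¹ * ENNReal.ofReal l * x := by
          rw [← ENNReal.ofReal_mul (by positivity), inv_mul_cancel₀ hl.ne']
          simp
      _ ≤ ENNReal.ofReal l⁻¹ * x * x := by gcongr
      _ = _ := by ring

theorem lintegral_nonlinearityIntegrand_sub_le {f g : L2} {R d : ℝ} (hR : 0 < R) (hd : 0 < d)
    (hf : ‖f‖ ≤ R) (hg : ‖g‖ ≤ R) (hfg : ‖f - g‖ ≤ d) :
    ∫⁻ σ in Icc (0 : ℝ) 1, ‖nonlinearityIntegrand f σ - nonlinearityIntegrand g σ‖ₑ ≤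
      ENNReal.ofReal (nonlinearityConst * R ^ 2 * d) := by
  -- The size expected of a cubic difference. With it the two parts contribute l and
  -- 27·`strichartzConst`·l, hence `nonlinearityConst`.
  set l := R ^ 2 * d with hl
  have hl0 : 0 < l := by positivity
  have hS := strichartzConst_pos
  calc _ ≤ ∫⁻ σ in Icc (0 : ℝ) 1, (ENNReal.ofReal l + ENNReal.ofReal l⁻¹ *
        (ENNReal.ofReal (9 * R ^ 4 * d ^ 2) *
      (sixthPower (schrodinger σ f) * ENNReal.ofReal (R⁻¹ ^ 6) +
        sixthPower (schrodinger σ g) * ENNReal.ofReal (R⁻¹ ^ 6) +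
        sixthPower (schrodinger σ (f - g)) * ENNReal.ofReal (d⁻¹ ^ 6)))) := by
        refine lintegral_mono_ae ?_
        filter_upwards [ae_hasCube f, ae_hasCube g] with σ h1 h2
        refine (enorm_le_add_inv_mul_sq _ hl0).trans ?_
        have h3 := enorm_cube_sub_cube_sq_le h1 h2 hR hd
        rw [← schrodinger_sub] at h3
        have h4 : ‖nonlinearityIntegrand f σ - nonlinearityIntegrand g σ‖ₑ =
            ‖cube (schrodinger σ f) - cube (schrodinger σ g)‖ₑ := by
          rw [nonlinearityIntegrand, nonlinearityIntegrand, ← schrodinger_sub, ← ofReal_norm,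
            norm_schrodinger, ofReal_norm]
        rw [h4]
        gcongr
    _ ≤ ENNReal.ofReal l + ENNReal.ofReal l⁻¹ * (ENNReal.ofReal (9 * R ^ 4 * d ^ 2) *
        (ENNReal.ofReal strichartzConst + ENNReal.ofReal strichartzConst +
          ENNReal.ofReal strichartzConst)) := by
        rw [lintegral_add_left measurable_const, lintegral_const_mul' _ _ ENNReal.ofReal_ne_top,
          lintegral_const_mul' _ _ ENNReal.ofReal_ne_top,
          lintegral_add_right _ ((measurable_sixthPower_schrodinger _).mul_const _),
          lintegral_add_right _ ((measurable_sixthPower_schrodinger _).mul_const _)]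
        have h1 : ∫⁻ _ in Icc (0 : ℝ) 1, ENNReal.ofReal l = ENNReal.ofReal l := by simp
        rw [h1]
        gcongr
        · exact lintegral_sixthPower_mul_le hR hf
        · exact lintegral_sixthPower_mul_le hR hg
        · exact lintegral_sixthPower_mul_le hd hfg
    _ = _ := by
        rw [← ENNReal.ofReal_add hS.le hS.le, ← ENNReal.ofReal_add (by positivity) hS.le,
          ← ENNReal.ofReal_mul (by positivity), ← ENNReal.ofReal_mul (by positivity),
          ← ENNReal.ofReal_add (by positivity) (by positivity), nonlinearityConst, hl]
        congr 1
        field_simp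
        ring

theorem intervalIntegrable_iff_Icc {f : ℝ → L2} :
    IntervalIntegrable f volume 0 1 ↔ Integrable f (volume.restrict (Icc (0 : ℝ) 1)) := by
  rw [intervalIntegrable_iff_integrableOn_Icc_of_le zero_le_one]
  rfl

theorem intervalIntegrable_nonlinearityIntegrand (f : L2) :
    IntervalIntegrable (nonlinearityIntegrand f) volume 0 1 := by
  rw [intervalIntegrable_iff_Icc]
  refine ⟨aestronglyMeasurable_nonlinearityIntegrand f, ?_⟩
  have h := lintegral_nonlinearityIntegrand_sub_le (f := f) (g := 0) (R := ‖f‖ + 1) (d := ‖f‖ + 1)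
    (by positivity) (by positivity) (by simp) (by simpa using by positivity) (by simp)
  simp only [nonlinearityIntegrand_zero, sub_zero] at h
  exact h.trans_lt ENNReal.ofReal_lt_top

/-- The estimate behind the whole L² theory: in the interaction picture the equation becomes an ODE
with a locally Lipschitz field, so no contraction in space-time norms is needed. -/
theorem norm_nonlinearity_sub_le {f g : L2} {R : ℝ} (hR : 0 < R) (hf : ‖f‖ ≤ R) (hg : ‖g‖ ≤ R) :
    ‖nonlinearity f - nonlinearity g‖ ≤ nonlinearityConst * R ^ 2 * ‖f - g‖ := by
  rcases eq_or_ne f g with rfl | hne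
  · simp
  have hd : 0 < ‖f - g‖ := norm_pos_iff.2 (sub_ne_zero.2 hne)
  have hC := nonlinearityConst_pos
  rw [nonlinearity, nonlinearity, ← intervalIntegral.integral_sub
    (intervalIntegrable_nonlinearityIntegrand f) (intervalIntegrable_nonlinearityIntegrand g),
    intervalIntegral.integral_of_le zero_le_one, ← integral_Icc_eq_integral_Ioc]
  have h := (enorm_integral_le_lintegral_enorm _).trans
    (lintegral_nonlinearityIntegrand_sub_le hR hd hf hg le_rfl)
  rw [← ofReal_norm] at h
  exact (ENNReal.ofReal_le_ofReal_iff (by positivity)).1 h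

theorem continuous_nonlinearity : Continuous nonlinearity := by
  rw [continuous_iff_continuousAt]
  intro f
  have hR : 0 < ‖f‖ + 1 := by positivity
  have h : LipschitzOnWith (nonlinearityConst * (‖f‖ + 1) ^ 2).toNNReal nonlinearity
      (Metric.ball 0 (‖f‖ + 1)) := by
    refine LipschitzOnWith.of_dist_le_mul fun x hx y hy => ?_
    rw [dist_eq_norm, dist_eq_norm, Real.coe_toNNReal _
      (mul_nonneg nonlinearityConst_pos.le (sq_nonneg _))]
    rw [mem_ball_zero_iff] at hx hy
    exact norm_nonlinearity_sub_le hR hx.le hy.le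
  exact h.continuousOn.continuousAt (Metric.isOpen_ball.mem_nhds (by simp))

/-! ### Homogeneity and reality of the nonlinearity -/

theorem hasCube_smul {f : L2} (hf : HasCube f) (c : ℂ) : HasCube (c • f) := by
  rw [hasCube_iff] at hf ⊢
  rw [sixthPower_congr_ae (Lp.coeFn_smul c f)]
  simp only [Pi.smul_apply, enorm_smul, mul_pow]
  rw [lintegral_const_mul' _ _ (by finiteness)]
  exact ENNReal.mul_lt_top (by finiteness) hf

theorem cube_real_smul {f : L2} (hf : HasCube f) (c : ℝ) :
    cube ((c : ℂ) • f) = ((c ^ 3 : ℝ) : ℂ) • cube f := by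
  apply Lp.ext
  filter_upwards [coeFn_cube hf, coeFn_cube (hasCube_smul hf (c : ℂ)), Lp.coeFn_smul (c : ℂ) f,
    Lp.coeFn_smul (((c ^ 3 : ℝ) : ℂ)) (cube f)] with x h1 h2 h3 h4
  rw [h2, h4, h3, Pi.smul_apply, Pi.smul_apply, h1]
  simp only [cubeFun, smul_eq_mul, norm_mul, Complex.norm_real, Real.norm_eq_abs, mul_pow, sq_abs]
  push_cast
  ring

/-- Used for the truncated equation: a field evaluated at a real multiple of w is a real multiple of
the field at w, so mass conservation survives truncation. -/
theorem nonlinearity_real_smul (c : ℝ) (f : L2) :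
    nonlinearity ((c : ℂ) • f) = ((c ^ 3 : ℝ) : ℂ) • nonlinearity f := by
  rw [nonlinearity, nonlinearity, ← intervalIntegral.integral_smul,
    intervalIntegral.integral_of_le zero_le_one, ← integral_Icc_eq_integral_Ioc,
    intervalIntegral.integral_of_le zero_le_one, ← integral_Icc_eq_integral_Ioc]
  refine integral_congr_ae ?_
  filter_upwards [ae_hasCube f] with σ hσ
  rw [nonlinearityIntegrand, schrodinger_smul, cube_real_smul hσ, schrodinger_smul,
    nonlinearityIntegrand]

theorem im_inner_cube {f : L2} (hf : HasCube f) : (inner ℂ f (cube f)).im = 0 := by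
  have h : inner ℂ f (cube f) = ∫ x, ((‖f x‖ ^ 4 : ℝ) : ℂ) := by
    rw [L2.inner_def]
    refine integral_congr_ae ?_
    filter_upwards [coeFn_cube hf] with x hx
    rw [hx, RCLike.inner_apply, cubeFun, mul_assoc, Complex.mul_conj, Complex.normSq_eq_norm_sq,
      ← Complex.ofReal_mul]
    congr 1
    ring
  rw [h, integral_complex_ofReal, Complex.ofReal_im]

theorem inner_nonlinearity (g f : L2) :
    inner ℂ g (nonlinearity f) =
      ∫ σ in (0 : ℝ)..1, inner ℂ (schrodinger σ g) (cube (schrodinger σ f)) := by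
  have h := (innerSL ℂ g).intervalIntegral_comp_comm (intervalIntegrable_nonlinearityIntegrand f)
  simp only [innerSL_apply_apply] at h
  rw [nonlinearity, ← h]
  refine intervalIntegral.integral_congr fun σ _ => ?_
  simp only [nonlinearityIntegrand]
  rw [inner_schrodinger_right, neg_neg]

/-- After moving the propagator to the other side, the pairing is the average in σ of ∫|e^{iσΔ}f|⁴.
This is the infinitesimal form of mass conservation. -/
theorem im_inner_nonlinearity (f : L2) : (inner ℂ f (nonlinearity f)).im = 0 := by
  have h : (inner ℂ f (nonlinearity f)) =
      ∫ σ in (0 : ℝ)..1, (((inner ℂ (schrodinger σ f) (cube (schrodinger σ f)) : ℂ).re : ℝ) : ℂ) := by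
    rw [inner_nonlinearity, intervalIntegral.integral_of_le zero_le_one,
      ← integral_Icc_eq_integral_Ioc, intervalIntegral.integral_of_le zero_le_one,
      ← integral_Icc_eq_integral_Ioc]
    refine integral_congr_ae ?_
    filter_upwards [ae_hasCube f] with σ hσ
    apply Complex.ext
    · simp
    · rw [im_inner_cube hσ, Complex.ofReal_im]
  rw [h, intervalIntegral.integral_ofReal, Complex.ofReal_im]

/-! ### The equation in the interaction picture -/

/-- The nonlinearity conjugated by the free flow: with `w(t) = e^{-iγtΔ} u(t)`, the equation reads
`w' = i • interactionField γ t w`. -/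
def interactionField (γ t : ℝ) (w : L2) : L2 :=
  schrodinger (-(γ * t)) (nonlinearity (schrodinger (γ * t) w))

theorem continuousOn_interactionField (γ : ℝ) {X : Type*} [TopologicalSpace X] {a : X → ℝ}
    {w : X → L2} {s : Set X} (ha : ContinuousOn a s) (hw : ContinuousOn w s) :
    ContinuousOn (fun x => interactionField γ (a x) (w x)) s :=
  continuousOn_schrodinger (continuousOn_const.mul ha).neg
    (continuous_nonlinearity.comp_continuousOn
      (continuousOn_schrodinger (continuousOn_const.mul ha) hw))

theorem norm_interactionField_sub_le (γ t : ℝ) {f g : L2} {R : ℝ} (hR : 0 < R) (hf : ‖f‖ ≤ R)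
    (hg : ‖g‖ ≤ R) :
    ‖interactionField γ t f - interactionField γ t g‖ ≤ nonlinearityConst * R ^ 2 * ‖f - g‖ := by
  rw [interactionField, interactionField, ← schrodinger_sub, norm_schrodinger]
  have h := norm_nonlinearity_sub_le (f := schrodinger (γ * t) f) (g := schrodinger (γ * t) g) hR
    (by rwa [norm_schrodinger]) (by rwa [norm_schrodinger])
  rwa [← schrodinger_sub, norm_schrodinger] at h

theorem interactionField_zero (γ t : ℝ) : interactionField γ t 0 = 0 := by
  simp [interactionField]

theorem norm_interactionField_le (γ t : ℝ) {f : L2} {R : ℝ} (hR : 0 < R) (hf : ‖f‖ ≤ R) :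
    ‖interactionField γ t f‖ ≤ nonlinearityConst * R ^ 3 := by
  have h := norm_interactionField_sub_le γ t (g := 0) hR hf (by simpa using hR.le)
  rw [interactionField_zero, sub_zero, sub_zero] at h
  have hC := nonlinearityConst_pos
  calc _ ≤ nonlinearityConst * R ^ 2 * ‖f‖ := h
    _ ≤ nonlinearityConst * R ^ 2 * R := by gcongr
    _ = _ := by ring

theorem interactionField_real_smul (γ t c : ℝ) (f : L2) :
    interactionField γ t ((c : ℂ) • f) = ((c ^ 3 : ℝ) : ℂ) • interactionField γ t f := by
  rw [interactionField, schrodinger_smul, nonlinearity_real_smul, schrodinger_smul,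
    interactionField]

theorem im_inner_interactionField (γ t : ℝ) (f : L2) :
    (inner ℂ f (interactionField γ t f)).im = 0 := by
  rw [interactionField, inner_schrodinger_right, neg_neg, im_inner_nonlinearity]

theorem zero_mem_Ioo_of_mem {T t : ℝ} (ht : t ∈ Ioo (-T) T) : (0 : ℝ) ∈ Ioo (-T) T := by
  have := ht.1.trans ht.2
  constructor <;> linarith

theorem uIcc_zero_subset_Ioo {T t : ℝ} (ht : t ∈ Ioo (-T) T) : uIcc 0 t ⊆ Ioo (-T) T := by
  intro x hx
  have h0 := zero_mem_Ioo_of_mem ht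
  rcases le_total 0 t with h | h
  · rw [uIcc_of_le h] at hx
    exact ⟨h0.1.trans_le hx.1, hx.2.trans_lt ht.2⟩
  · rw [uIcc_of_ge h] at hx
    exact ⟨ht.1.trans_le hx.1, hx.2.trans_lt h0.2⟩

theorem intervalIntegrable_interactionField {γ T : ℝ} {w : ℝ → L2}
    (hw : ContinuousOn w (Ioo (-T) T)) {t : ℝ} (ht : t ∈ Ioo (-T) T) :
    IntervalIntegrable (fun τ => interactionField γ τ (w τ)) volume 0 t :=
  ((continuousOn_interactionField γ continuousOn_id hw).mono (uIcc_zero_subset_Ioo ht)).intervalIntegrable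

theorem schrodinger_intervalIntegral (a : ℝ) {f : ℝ → L2} {b c : ℝ}
    (hf : IntervalIntegrable f volume b c) :
    schrodinger a (∫ τ in b..c, f τ) = ∫ τ in b..c, schrodinger a (f τ) :=
  ((propagator a).toContinuousLinearMap.intervalIntegral_comp_comm hf).symm

theorem schrodinger_interactionField (γ t τ : ℝ) (w : L2) :
    schrodinger (γ * t) (interactionField γ τ w) =
      schrodinger (γ * (t - τ)) (nonlinearity (schrodinger (γ * τ) w)) := by
  rw [interactionField, schrodinger_schrodinger]
  congr 1
  ring

/-- The free propagator commutes with the time integral, so the Duhamel formula is the integrated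
ODE for w; `IsSolution.interaction_eq` is the reverse passage. -/
theorem isSolution_of_interaction {γ T : ℝ} {u₀ : L2} {w : ℝ → L2}
    (hw : ContinuousOn w (Ioo (-T) T))
    (h : ∀ t ∈ Ioo (-T) T, w t = u₀ + Complex.I • ∫ τ in (0 : ℝ)..t, interactionField γ τ (w τ)) :
    IsSolution γ T u₀ fun t => schrodinger (γ * t) (w t) where
  continuousOn := continuousOn_schrodinger (by fun_prop) hw
  hasCube t _ := ae_hasCube _
  integrable_nonlinearity t _ := intervalIntegrable_nonlinearityIntegrand _
  integrable_duhamel t ht := by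
    simp_rw [← schrodinger_interactionField]
    exact (((propagator (γ * t)).continuous.comp_continuousOn
      (continuousOn_interactionField γ continuousOn_id hw)).mono (uIcc_zero_subset_Ioo ht)).intervalIntegrable
  duhamel t ht := by
    simp_rw [← schrodinger_interactionField]
    rw [← schrodinger_intervalIntegral _ (intervalIntegrable_interactionField hw ht),
      ← schrodinger_smul, ← schrodinger_add, ← h t ht]

theorem IsSolution.continuousOn_interaction {γ T : ℝ} {u₀ : L2} {u : ℝ → L2}
    (hu : IsSolution γ T u₀ u) :
    ContinuousOn (fun t => schrodinger (-(γ * t)) (u t)) (Ioo (-T) T) :=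
  continuousOn_schrodinger (by fun_prop) hu.continuousOn

theorem IsSolution.interaction_eq {γ T : ℝ} {u₀ : L2} {u : ℝ → L2} (hu : IsSolution γ T u₀ u)
    {t : ℝ} (ht : t ∈ Ioo (-T) T) :
    schrodinger (-(γ * t)) (u t) = u₀ + Complex.I • ∫ τ in (0 : ℝ)..t,
      interactionField γ τ (schrodinger (-(γ * τ)) (u τ)) := by
  rw [hu.duhamel t ht, schrodinger_add, schrodinger_smul, schrodinger_schrodinger,
    schrodinger_intervalIntegral _ (hu.integrable_duhamel t ht)]
  congr 1
  · simp
  · congr 1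
    refine intervalIntegral.integral_congr fun τ _ => ?_
    simp only [interactionField]
    rw [schrodinger_schrodinger, schrodinger_schrodinger]
    simp only [add_neg_cancel, schrodinger_zero_left]
    congr 1
    ring

theorem hasDerivAt_of_interaction {γ T : ℝ} {u₀ : L2} {w : ℝ → L2}
    (hw : ContinuousOn w (Ioo (-T) T))
    (h : ∀ t ∈ Ioo (-T) T, w t = u₀ + Complex.I • ∫ τ in (0 : ℝ)..t, interactionField γ τ (w τ))
    {t : ℝ} (ht : t ∈ Ioo (-T) T) :
    HasDerivAt w (Complex.I • interactionField γ t (w t)) t := by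
  have hc := continuousOn_interactionField γ continuousOn_id hw
  have h1 : HasDerivAt (fun t => ∫ τ in (0 : ℝ)..t, interactionField γ τ (w τ))
      (interactionField γ t (w t)) t :=
    intervalIntegral.integral_hasDerivAt_right (intervalIntegrable_interactionField hw ht)
      (hc.stronglyMeasurableAtFilter isOpen_Ioo t ht) (hc.continuousAt (isOpen_Ioo.mem_nhds ht))
  refine ((h1.const_smul Complex.I).const_add u₀).congr_of_eventuallyEq ?_
  filter_upwards [isOpen_Ioo.mem_nhds ht] with τ hτ
  exact h τ hτ

theorem IsSolution.hasDerivAt_interaction {γ T : ℝ} {u₀ : L2} {u : ℝ → L2}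
    (hu : IsSolution γ T u₀ u) {t : ℝ} (ht : t ∈ Ioo (-T) T) :
    HasDerivAt (fun t => schrodinger (-(γ * t)) (u t))
      (Complex.I • interactionField γ t (schrodinger (-(γ * t)) (u t))) t :=
  hasDerivAt_of_interaction hu.continuousOn_interaction (fun _ ht => hu.interaction_eq ht) ht

theorem IsSolution.apply_zero {γ T : ℝ} {u₀ : L2} {u : ℝ → L2} (hu : IsSolution γ T u₀ u)
    (hT : 0 < T) : u 0 = u₀ := by
  have := hu.duhamel 0 ⟨by linarith, hT⟩
  simpa using this

/-! ### Uniqueness -/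

theorem lipschitzOnWith_interactionField (γ t : ℝ) {R : ℝ} (hR : 0 < R) :
    LipschitzOnWith (nonlinearityConst * R ^ 2).toNNReal
      (fun w => Complex.I • interactionField γ t w) (Metric.closedBall 0 R) := by
  refine LipschitzOnWith.of_dist_le_mul fun x hx y hy => ?_
  rw [dist_eq_norm, dist_eq_norm, Real.coe_toNNReal _
    (mul_nonneg nonlinearityConst_pos.le (sq_nonneg _)), ← smul_sub, norm_smul, Complex.norm_I,
    one_mul]
  rw [mem_closedBall_zero_iff] at hx hy
  exact norm_interactionField_sub_le γ t hR hx hy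

/-- Continuity bounds both solutions on a compact subinterval containing t, where the field has one
Lipschitz constant on the common ball; ODE uniqueness then applies in the interaction picture. -/
theorem IsSolution.eqOn {γ T : ℝ} {u₀ : L2} {u v : ℝ → L2} (hu : IsSolution γ T u₀ u)
    (hv : IsSolution γ T u₀ v) : EqOn u v (Ioo (-T) T) := by
  intro t ht
  have h0 := zero_mem_Ioo_of_mem ht
  obtain ⟨T', hT', hT'T⟩ : ∃ T', |t| < T' ∧ T' < T := exists_between (abs_lt.2 ht)
  have hT'0 : 0 < T' := (abs_nonneg t).trans_lt hT'
  have hsub : Icc (-T') T' ⊆ Ioo (-T) T := fun x hx => ⟨by linarith [hx.1], by linarith [hx.2]⟩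
  have hbdd : ∀ {x : ℝ → L2}, IsSolution γ T u₀ x → ∃ R, ∀ t ∈ Icc (-T') T', ‖x t‖ ≤ R :=
    fun hx => isCompact_Icc.exists_bound_of_continuousOn (hx.continuousOn.mono hsub)
  obtain ⟨R₁, hR₁⟩ := hbdd hu
  obtain ⟨R₂, hR₂⟩ := hbdd hv
  set R := max R₁ R₂ + 1 with hR
  have hRpos : 0 < R := by
    have := (norm_nonneg _).trans (hR₁ 0 ⟨by linarith, hT'0.le⟩)
    have := le_max_left R₁ R₂
    linarith
  have key := ODE_solution_unique_of_mem_Ioo (K := (nonlinearityConst * R ^ 2).toNNReal)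
    (v := fun t w => Complex.I • interactionField γ t w) (s := fun _ => Metric.closedBall 0 R)
    (a := -T') (b := T') (t₀ := 0)
    (f := fun t => schrodinger (-(γ * t)) (u t)) (g := fun t => schrodinger (-(γ * t)) (v t))
    (fun t _ => lipschitzOnWith_interactionField γ t hRpos) ⟨by linarith, hT'0⟩
    (fun t ht => ⟨hu.hasDerivAt_interaction (hsub (Ioo_subset_Icc_self ht)), by
      rw [mem_closedBall_zero_iff, norm_schrodinger]
      linarith [hR₁ t (Ioo_subset_Icc_self ht), le_max_left R₁ R₂]⟩)
    (fun t ht => ⟨hv.hasDerivAt_interaction (hsub (Ioo_subset_Icc_self ht)), by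
      rw [mem_closedBall_zero_iff, norm_schrodinger]
      linarith [hR₂ t (Ioo_subset_Icc_self ht), le_max_right R₁ R₂]⟩)
    (by
      have hT : 0 < T := h0.2
      rw [hu.apply_zero hT, hv.apply_zero hT])
  have h1 := key (abs_lt.1 hT' : t ∈ Ioo (-T') T')
  exact (propagator (-(γ * t))).injective h1

/-! ### Global existence -/

/-- The radial retraction onto the ball of radius `R`. -/
def radialRetraction (R : ℝ) (w : L2) : L2 := ((R / max R ‖w‖ : ℝ) : ℂ) • w

theorem norm_radialRetraction_le {R : ℝ} (hR : 0 < R) (w : L2) : ‖radialRetraction R w‖ ≤ R := by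
  have h : 0 < max R ‖w‖ := lt_max_of_lt_left hR
  rw [radialRetraction, norm_smul, Complex.norm_real, Real.norm_of_nonneg (by positivity),
    div_mul_eq_mul_div, div_le_iff₀ h]
  gcongr
  exact le_max_right _ _

theorem radialRetraction_of_norm_le {R : ℝ} (hR : 0 < R) {w : L2} (hw : ‖w‖ ≤ R) :
    radialRetraction R w = w := by
  rw [radialRetraction, max_eq_left hw, div_self hR.ne', Complex.ofReal_one, one_smul]

/-- One ‖x - y‖ comes from the vectors and one from the scalar factors; the sharp constant is
irrelevant here. -/
theorem norm_radialRetraction_sub_le {R : ℝ} (hR : 0 < R) (x y : L2) :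
    ‖radialRetraction R x - radialRetraction R y‖ ≤ 2 * ‖x - y‖ := by
  set a := max R ‖x‖ with ha
  set b := max R ‖y‖ with hb
  have ha0 : 0 < a := lt_max_of_lt_left hR
  have hb0 : 0 < b := lt_max_of_lt_left hR
  have hab : |b - a| ≤ ‖x - y‖ := by
    rw [ha, hb, max_comm R, max_comm R, norm_sub_rev]
    exact (abs_max_sub_max_le_abs _ _ _).trans (abs_norm_sub_norm_le y x)
  have h1 : radialRetraction R x - radialRetraction R y =
      ((R / a : ℝ) : ℂ) • (x - y) + ((R / a - R / b : ℝ) : ℂ) • y := by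
    rw [radialRetraction, radialRetraction, ← ha, ← hb, Complex.ofReal_sub, sub_smul, smul_sub]
    abel
  have h2 : R / a ≤ 1 := (div_le_one ha0).2 (le_max_left _ _)
  have h3 : ‖y‖ / b ≤ 1 := (div_le_one hb0).2 (le_max_right _ _)
  have h4 : |R / a - R / b| * ‖y‖ ≤ ‖x - y‖ := by
    have h5 : R / a - R / b = R / a * ((b - a) / b) := by
      field_simp
    rw [h5, abs_mul, abs_div (b - a), abs_of_pos hb0, abs_of_nonneg (by positivity : 0 ≤ R / a)]
    calc R / a * (|b - a| / b) * ‖y‖ = R / a * (‖y‖ / b) * |b - a| := by ring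
      _ ≤ 1 * 1 * ‖x - y‖ := by gcongr
      _ = _ := by ring
  rw [h1]
  refine (norm_add_le _ _).trans ?_
  rw [norm_smul, norm_smul, Complex.norm_real, Complex.norm_real, Real.norm_eq_abs, Real.norm_eq_abs,
    abs_of_nonneg (by positivity : 0 ≤ R / a)]
  have h6 : R / a * ‖x - y‖ ≤ 1 * ‖x - y‖ := by gcongr
  linarith

/-- The derivative of ⟨w,w⟩ is twice the real part of i⟨w,v⟩, which vanishes when ⟨w,v⟩ is real. -/
theorem norm_eq_of_hasDerivAt_I_smul {T : ℝ} {w v : ℝ → L2}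
    (hw : ∀ t ∈ Ioo (-T) T, HasDerivAt w (Complex.I • v t) t)
    (hv : ∀ t ∈ Ioo (-T) T, (inner ℂ (w t) (v t)).im = 0) {t : ℝ} (ht : t ∈ Ioo (-T) T) :
    ‖w t‖ = ‖w 0‖ := by
  have hd : ∀ t ∈ Ioo (-T) T, HasDerivAt (fun t => inner ℂ (w t) (w t)) 0 t := by
    intro t ht
    have h1 := (hw t ht).inner ℂ (hw t ht)
    have h2 : inner ℂ (w t) (Complex.I • v t) + inner ℂ (Complex.I • v t) (w t) = 0 := by
      have h3 : inner ℂ (v t) (w t) = inner ℂ (w t) (v t) := by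
        rw [← inner_conj_symm (v t) (w t)]
        exact Complex.conj_eq_iff_im.2 (hv t ht)
      rw [inner_smul_left, inner_smul_right, h3, Complex.conj_I]
      ring
    rwa [h2] at h1
  have h2 := isOpen_Ioo.is_const_of_deriv_eq_zero (isPreconnected_Ioo)
    (fun t ht => (hd t ht).differentiableAt.differentiableWithinAt)
    (fun t ht => (hd t ht).deriv) ht (zero_mem_Ioo_of_mem ht)
  simp only [inner_self_eq_norm_sq_to_K] at h2
  have h3 : ‖w t‖ ^ 2 = ‖w 0‖ ^ 2 := by exact_mod_cast h2
  exact (pow_left_inj₀ (norm_nonneg _) (norm_nonneg _) two_ne_zero).1 h3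

theorem IsSolution.norm_eq {γ T : ℝ} {u₀ : L2} {u : ℝ → L2} (hu : IsSolution γ T u₀ u) {t : ℝ}
    (ht : t ∈ Ioo (-T) T) : ‖u t‖ = ‖u₀‖ := by
  have h := norm_eq_of_hasDerivAt_I_smul (fun t ht => hu.hasDerivAt_interaction ht)
    (fun t _ => im_inner_interactionField γ t _) ht
  simp only [norm_schrodinger] at h
  rw [h, hu.apply_zero (zero_mem_Ioo_of_mem ht).2]

/-- After retraction to the ball the field is globally bounded and Lipschitz, so taking the Picard
radius equal to the bound times T covers the whole interval at once. -/
theorem isPicardLindelof_truncated (γ : ℝ) {T : ℝ} (hT : 0 < T) (u₀ : L2) {R : ℝ} (hR : 0 < R) :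
    IsPicardLindelof (fun t w => Complex.I • interactionField γ t (radialRetraction R w))
      (tmin := -T) (tmax := T) ⟨0, by linarith, hT.le⟩ u₀ (nonlinearityConst * R ^ 3 * T).toNNReal 0
      (nonlinearityConst * R ^ 3).toNNReal (nonlinearityConst * R ^ 2 * 2).toNNReal := by
  have hC := nonlinearityConst_pos
  have hlip : ∀ t, LipschitzWith (nonlinearityConst * R ^ 2 * 2).toNNReal
      (fun w => Complex.I • interactionField γ t (radialRetraction R w)) := by
    intro t
    refine LipschitzWith.of_dist_le_mul fun x y => ?_
    rw [dist_eq_norm, dist_eq_norm, Real.coe_toNNReal _ (by positivity), ← smul_sub, norm_smul,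
      Complex.norm_I, one_mul]
    refine (norm_interactionField_sub_le γ t hR (norm_radialRetraction_le hR x)
      (norm_radialRetraction_le hR y)).trans ?_
    rw [mul_assoc _ 2]
    gcongr
    exact norm_radialRetraction_sub_le hR x y
  refine ⟨fun t _ => (hlip t).lipschitzOnWith, fun x _ => ?_, fun t _ x _ => ?_, ?_⟩
  · exact (continuousOn_interactionField γ continuousOn_id continuousOn_const).const_smul Complex.I
  · rw [norm_smul, Complex.norm_I, one_mul, Real.coe_toNNReal _ (by positivity)]
    exact norm_interactionField_le γ t hR (norm_radialRetraction_le hR x)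
  · rw [Real.coe_toNNReal _ (by positivity), Real.coe_toNNReal _ (by positivity)]
    simp

/-- The truncated flow conserves mass as well, since the retraction multiplies by a real scalar. Its
norm therefore stays at ‖u₀‖, below R = ‖u₀‖ + 1, and the truncation is never active. -/
theorem exists_isSolution (γ : ℝ) {T : ℝ} (hT : 0 < T) (u₀ : L2) : ∃ u, IsSolution γ T u₀ u := by
  set R := ‖u₀‖ + 1 with hRdef
  have hR : 0 < R := by positivity
  obtain ⟨w, hw0, hwd⟩ :=
    (isPicardLindelof_truncated γ hT u₀ hR).exists_eq_forall_mem_Icc_hasDerivWithinAt₀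
  have hd : ∀ t ∈ Ioo (-T) T,
      HasDerivAt w (Complex.I • interactionField γ t (radialRetraction R (w t))) t :=
    fun t ht => (hwd t (Ioo_subset_Icc_self ht)).hasDerivAt (Icc_mem_nhds ht.1 ht.2)
  have hnorm : ∀ t ∈ Ioo (-T) T, ‖w t‖ = ‖u₀‖ := by
    intro t ht
    rw [← hw0]
    refine norm_eq_of_hasDerivAt_I_smul hd (fun t _ => ?_) ht
    rw [radialRetraction, interactionField_real_smul, inner_smul_right, Complex.im_ofReal_mul,
      im_inner_interactionField, mul_zero]
  have hd' : ∀ t ∈ Ioo (-T) T, HasDerivAt w (Complex.I • interactionField γ t (w t)) t := by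
    intro t ht
    have h := hd t ht
    rwa [radialRetraction_of_norm_le hR (by rw [hnorm t ht, hRdef]; linarith)] at h
  have hc : ContinuousOn w (Ioo (-T) T) := fun t ht => (hd t ht).continuousAt.continuousWithinAt
  refine ⟨_, isSolution_of_interaction hc fun t ht => ?_⟩
  have h1 := intervalIntegral.integral_eq_sub_of_hasDerivAt
    (fun τ hτ => hd' τ (uIcc_zero_subset_Ioo ht hτ))
    ((intervalIntegrable_interactionField (γ := γ) hc ht).smul Complex.I)
  rw [intervalIntegral.integral_smul] at h1
  have hw0' : w 0 = u₀ := hw0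
  rw [h1, hw0']
  abel

theorem isDataToSolutionMap_choose (γ : ℝ) {T : ℝ} (hT : 0 < T) :
    IsDataToSolutionMap γ T fun u₀ => (exists_isSolution γ hT u₀).choose := fun u₀ =>
  ⟨(exists_isSolution γ hT u₀).choose_spec,
    fun _ hu => hu.eqOn (exists_isSolution γ hT u₀).choose_spec⟩

theorem isSolution_zero (γ T : ℝ) : IsSolution γ T 0 0 := by
  have h := isSolution_of_interaction (γ := γ) (T := T) (u₀ := 0) (w := 0) continuousOn_const
    (fun t _ => by simp [interactionField_zero])
  simpa [Pi.zero_def] using h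

/-! ### The dispersive estimate -/

theorem schwartz_fourierInv_eq_integral (A : 𝓢(ℝ, ℂ)) (x : ℝ) :
    (𝓕⁻ A : 𝓢(ℝ, ℂ)) x =
      ∫ ζ, Complex.exp (((2 * Real.pi * (x * ζ) : ℝ) : ℂ) * Complex.I) * A ζ := by
  rw [SchwartzMap.fourierInv_coe, Real.fourierInv_eq']
  simp only [smul_eq_mul, RCLike.inner_apply, conj_trivial]

theorem schwartz_fourier_eq_integral (A : 𝓢(ℝ, ℂ)) (ζ : ℝ) :
    (𝓕 A : 𝓢(ℝ, ℂ)) ζ =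
      ∫ y, Complex.exp (((-(2 * Real.pi * (ζ * y)) : ℝ) : ℂ) * Complex.I) * A y := by
  rw [SchwartzMap.fourier_coe, Real.fourier_eq']
  simp only [smul_eq_mul, RCLike.inner_apply, conj_trivial, neg_mul]

theorem freeEvolution_apply (σ : ℝ) (φ : 𝓢(ℝ, ℂ)) (x : ℝ) :
    freeEvolution σ φ x = ∫ ζ, Complex.exp (((2 * Real.pi * (x * ζ) : ℝ) : ℂ) * Complex.I) *
      (schrodingerSymbol σ ζ * (𝓕 φ : 𝓢(ℝ, ℂ)) ζ) := by
  have h := schwartz_fourierInv_eq_integral (𝓕 (freeEvolution σ φ)) x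
  rw [FourierTransform.fourierInv_fourier_eq] at h
  simpa only [fourier_freeEvolution] using h

theorem norm_freeEvolution_le_integral_fourier (σ : ℝ) (φ : 𝓢(ℝ, ℂ)) (x : ℝ) :
    ‖freeEvolution σ φ x‖ ≤ ∫ ζ, ‖(𝓕 φ : 𝓢(ℝ, ℂ)) ζ‖ := by
  rw [freeEvolution_apply]
  refine (norm_integral_le_integral_norm _).trans (le_of_eq ?_)
  refine integral_congr_ae (Eventually.of_forall fun ζ => ?_)
  simp only [norm_mul, Complex.norm_exp_ofReal_mul_I, norm_schrodingerSymbol, one_mul]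

/-- The Gaussian factor exp(-c²/(4b)) has modulus at most 1 because 1/b has positive real part; only
|b| enters the bound, so the real part of b may tend to 0. -/
theorem norm_integral_gaussian_fourier_le {b : ℂ} (hb : 0 < b.re) (c : ℝ) :
    ‖∫ ζ : ℝ, Complex.exp (Complex.I * c * ζ) * Complex.exp (-b * ζ ^ 2)‖ ≤
      (Real.pi / ‖b‖) ^ (1 / 2 : ℝ) := by
  rw [fourierIntegral_gaussian hb]
  have h1 : ((1 : ℂ) / 2) = ((1 / 2 : ℝ) : ℂ) := by push_cast; ring
  rw [norm_mul, h1, Complex.norm_cpow_real, norm_div, Complex.norm_real,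
    Real.norm_of_nonneg Real.pi_pos.le]
  refine mul_le_of_le_one_right (by positivity) ?_
  rw [Complex.norm_exp]
  refine Real.exp_le_one_iff.2 ?_
  have h2 : (-(c : ℂ) ^ 2 / (4 * b)) = ((-(c ^ 2) / 4 : ℝ) : ℂ) * b⁻¹ := by
    have : b ≠ 0 := by
      rintro rfl
      simp at hb
    push_cast
    field_simp
  rw [h2, Complex.re_ofReal_mul, Complex.inv_re]
  have h3 : 0 ≤ b.re / Complex.normSq b := div_nonneg hb.le (Complex.normSq_nonneg _)
  nlinarith [sq_nonneg c]

theorem integral_gaussian_mul_fourier {b : ℂ} (hb : 0 < b.re) (φ : 𝓢(ℝ, ℂ)) (x : ℝ) :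
    ∫ ζ : ℝ, Complex.exp (((2 * Real.pi * (x * ζ) : ℝ) : ℂ) * Complex.I) *
      (Complex.exp (-b * ζ ^ 2) * (𝓕 φ : 𝓢(ℝ, ℂ)) ζ) =
    ∫ y : ℝ, φ y * ∫ ζ : ℝ, Complex.exp (Complex.I * ((2 * Real.pi * (x - y) : ℝ) : ℂ) * ζ) *
      Complex.exp (-b * ζ ^ 2) := by
  have hg := integrable_cexp_neg_mul_sq hb
  have hint : Integrable (Function.uncurry fun (ζ y : ℝ) =>
      φ y * (Complex.exp (Complex.I * ((2 * Real.pi * (x - y) : ℝ) : ℂ) * ζ) *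
      Complex.exp (-b * ζ ^ 2))) (volume.prod volume) := by
    have h1 := hg.mul_prod (φ.integrable (μ := volume))
    refine h1.mono ?_ (Eventually.of_forall fun p => ?_)
    · refine Continuous.aestronglyMeasurable ?_
      have := φ.continuous
      unfold Function.uncurry
      fun_prop
    · simp only [Function.uncurry]
      have h2 : Complex.I * ((2 * Real.pi * (x - p.2) : ℝ) : ℂ) * (p.1 : ℂ) =
          ((2 * Real.pi * (x - p.2) * p.1 : ℝ) : ℂ) * Complex.I := by
        push_cast
        ring
      rw [h2, norm_mul, norm_mul, Complex.norm_exp_ofReal_mul_I, norm_mul]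
      apply le_of_eq
      ring
  have h3 := integral_integral_swap hint
  simp only [integral_const_mul] at h3
  rw [← h3]
  refine integral_congr_ae (Eventually.of_forall fun ζ => ?_)
  simp only
  rw [schwartz_fourier_eq_integral, ← integral_const_mul, ← integral_const_mul]
  refine integral_congr_ae (Eventually.of_forall fun y => ?_)
  simp only
  have h4 : Complex.exp (Complex.I * ((2 * Real.pi * (x - y) : ℝ) : ℂ) * ζ) =
      Complex.exp (((2 * Real.pi * (x * ζ) : ℝ) : ℂ) * Complex.I) *
      Complex.exp (((-(2 * Real.pi * (ζ * y)) : ℝ) : ℂ) * Complex.I) := by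
    rw [← Complex.exp_add]
    congr 1
    push_cast
    ring
  rw [h4]
  ring

/-- The dispersive estimate. -/
theorem norm_freeEvolution_le_rpow (σ : ℝ) (hσ : σ ≠ 0) (φ : 𝓢(ℝ, ℂ)) (x : ℝ) :
    ‖freeEvolution σ φ x‖ ≤ |σ| ^ (-(1 / 2) : ℝ) * ∫ y, ‖φ y‖ := by
  -- Damping by δ makes the kernel absolutely integrable. The bound uses only the imaginary part of
  -- b, hence is uniform in δ and survives δ → 0.
  set b : ℝ → ℂ := fun δ => (δ : ℂ) + ((σ * (2 * Real.pi) ^ 2 : ℝ) : ℂ) * Complex.I with hb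
  have hbre : ∀ δ, (b δ).re = δ := fun δ => by
    rw [hb]
    simp only [Complex.add_re, Complex.ofReal_re, Complex.re_ofReal_mul, Complex.I_re, mul_zero,
      add_zero]
  have hbim : ∀ δ, (b δ).im = σ * (2 * Real.pi) ^ 2 := fun δ => by
    rw [hb]
    simp only [Complex.add_im, Complex.ofReal_im, Complex.im_ofReal_mul, Complex.I_im, mul_one,
      zero_add]
  have hbound : ∀ δ > 0, ‖∫ ζ : ℝ, Complex.exp (((2 * Real.pi * (x * ζ) : ℝ) : ℂ) * Complex.I) *
      (Complex.exp (-b δ * ζ ^ 2) * (𝓕 φ : 𝓢(ℝ, ℂ)) ζ)‖ ≤ |σ| ^ (-(1 / 2) : ℝ) * ∫ y, ‖φ y‖ := by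
    intro δ hδ
    rw [integral_gaussian_mul_fourier (by rw [hbre]; exact hδ), ← integral_const_mul]
    refine norm_integral_le_of_norm_le (φ.integrable.norm.const_mul _)
      (Eventually.of_forall fun y => ?_)
    rw [norm_mul, mul_comm]
    gcongr
    refine (norm_integral_gaussian_fourier_le (by rw [hbre]; exact hδ) _).trans ?_
    have hσ0 : 0 < |σ| := abs_pos.2 hσ
    have h1 : |σ| * (2 * Real.pi) ^ 2 ≤ ‖b δ‖ := by
      have := Complex.abs_im_le_norm (b δ)
      rwa [hbim, abs_mul, abs_of_pos (by positivity : (0 : ℝ) < (2 * Real.pi) ^ 2)] at this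
    have h2 : Real.pi / ‖b δ‖ ≤ |σ|⁻¹ := by
      have h3 : 0 < ‖b δ‖ := lt_of_lt_of_le (by positivity) h1
      rw [div_le_iff₀ h3, inv_mul_eq_div, le_div_iff₀ hσ0]
      nlinarith [Real.pi_gt_three, mul_pos hσ0 Real.pi_pos]
    rw [Real.rpow_neg hσ0.le, ← Real.inv_rpow hσ0.le]
    exact Real.rpow_le_rpow (by positivity) h2 (by norm_num)
  have hlim : Tendsto (fun δ : ℝ =>
      ∫ ζ : ℝ, Complex.exp (((2 * Real.pi * (x * ζ) : ℝ) : ℂ) * Complex.I) *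
      (Complex.exp (-b δ * ζ ^ 2) * (𝓕 φ : 𝓢(ℝ, ℂ)) ζ)) (𝓝[>] 0) (𝓝 (freeEvolution σ φ x)) := by
    rw [freeEvolution_apply]
    refine tendsto_integral_filter_of_dominated_convergence (fun ζ => ‖(𝓕 φ : 𝓢(ℝ, ℂ)) ζ‖)
      ?_ ?_ (𝓕 φ : 𝓢(ℝ, ℂ)).integrable.norm ?_
    · refine Eventually.of_forall fun δ => Continuous.aestronglyMeasurable ?_
      have := (𝓕 φ : 𝓢(ℝ, ℂ)).continuous
      fun_prop
    · filter_upwards [self_mem_nhdsWithin] with δ hδ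
      refine Eventually.of_forall fun ζ => ?_
      rw [norm_mul, norm_mul, Complex.norm_exp_ofReal_mul_I, one_mul]
      refine mul_le_of_le_one_left (norm_nonneg _) ?_
      rw [Complex.norm_exp]
      refine Real.exp_le_one_iff.2 ?_
      have h1 : -b δ * (ζ : ℂ) ^ 2 = ((-(ζ ^ 2) : ℝ) : ℂ) * b δ := by
        push_cast
        ring
      rw [h1, Complex.re_ofReal_mul, hbre]
      have : (0 : ℝ) < δ := hδ
      nlinarith [sq_nonneg ζ]
    · refine Eventually.of_forall fun ζ => ?_
      have h1 : schrodingerSymbol σ ζ = Complex.exp (-b 0 * ζ ^ 2) := by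
        rw [schrodingerSymbol, hb]
        congr 1
        push_cast
        ring
      rw [h1]
      have h2 : Continuous fun δ : ℝ =>
          Complex.exp (((2 * Real.pi * (x * ζ) : ℝ) : ℂ) * Complex.I) *
          (Complex.exp (-b δ * ζ ^ 2) * (𝓕 φ : 𝓢(ℝ, ℂ)) ζ) := by
        rw [hb]
        fun_prop
      exact (h2.tendsto 0).mono_left nhdsWithin_le_nhds
  refine le_of_tendsto hlim.norm ?_
  filter_upwards [self_mem_nhdsWithin] with δ hδ
  exact hbound δ hδ

/-! ### The resonant quartic form -/

theorem hasCube_toLp (φ : 𝓢(ℝ, ℂ)) : HasCube (φ.toLp 2) := by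
  rw [hasCube_iff, sixthPower_congr_ae (SchwartzMap.coeFn_toLp φ 2 volume)]
  have h := lintegral_rpow_enorm_lt_top_of_eLpNorm_lt_top (p := 6) (by norm_num) (by norm_num)
    (φ.memLp 6 volume).eLpNorm_lt_top
  simpa only [ENNReal.toReal_ofNat, ENNReal.rpow_ofNat] using h

theorem coeFn_cube_toLp (φ : 𝓢(ℝ, ℂ)) :
    cube (φ.toLp 2) =ᵐ[volume] fun x => cubeFun (φ x) := by
  filter_upwards [coeFn_cube (hasCube_toLp φ), SchwartzMap.coeFn_toLp φ 2 volume] with x h1 h2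
  rw [h1, h2]

/-- Regroup the pairing of Ψ with A·conj(A)·A as the pairing of ΨA with AA. Plancherel then
expresses it through two plain convolutions at a common output frequency η. -/
theorem inner_toLp_cube_toLp (Ψ A : 𝓢(ℝ, ℂ)) :
    inner ℂ (Ψ.toLp 2) (cube (A.toLp 2)) =
      ∫ η, (starRingEnd ℂ) ((𝓕 (schwartzMul Ψ A) : 𝓢(ℝ, ℂ)) η) *
        (𝓕 (schwartzMul A A) : 𝓢(ℝ, ℂ)) η := by
  have h := SchwartzMap.integral_inner_fourier_fourier (schwartzMul Ψ A) (schwartzMul A A)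
  simp only [RCLike.inner_apply, mul_comm _ ((starRingEnd ℂ) _)] at h
  rw [h, L2.inner_def]
  refine integral_congr_ae ?_
  filter_upwards [coeFn_cube_toLp A, SchwartzMap.coeFn_toLp Ψ 2 volume] with x h1 h2
  rw [h1, h2, RCLike.inner_apply, schwartzMul_apply, schwartzMul_apply, cubeFun, map_mul]
  have h3 : ((‖A x‖ ^ 2 : ℝ) : ℂ) = A x * (starRingEnd ℂ) (A x) := by
    rw [Complex.mul_conj, Complex.normSq_eq_norm_sq]
  rw [h3]
  ring

section Quartic

variable (κ a : ℝ → ℝ)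

/-- The amplitude of the quartic form, at the point `(η, (ζ, ζ₁))`. -/
def quarticAmplitude (p : ℝ × (ℝ × ℝ)) : ℝ :=
  κ p.2.1 * a (p.1 - p.2.1) * (a p.2.2 * a (p.1 - p.2.2))

/-- The phase of the quartic form, at the point `(η, (ζ, ζ₁))`. -/
def quarticPhase (p : ℝ × (ℝ × ℝ)) : ℝ :=
  8 * Real.pi ^ 2 * (p.2.2 - p.2.1) * (p.1 - p.2.2 - p.2.1)

theorem continuous_quarticPhase : Continuous quarticPhase := by
  unfold quarticPhase
  fun_prop

variable {κ a}

theorem integrable_quarticAmplitude (hκ : Continuous κ) (ha : Continuous a) {L : ℝ}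
    (hκs : ∀ x, x ∉ Icc (-1 : ℝ) 1 → κ x = 0) (has : ∀ x, x ∉ Icc 0 L → a x = 0) :
    Integrable (quarticAmplitude κ a) := by
  refine Continuous.integrable_of_hasCompactSupport (by unfold quarticAmplitude; fun_prop) ?_
  refine HasCompactSupport.intro (K := Icc 0 (2 * L) ×ˢ (Icc (-1 : ℝ) 1 ×ˢ Icc 0 L))
    (isCompact_Icc.prod (isCompact_Icc.prod isCompact_Icc)) ?_
  rintro ⟨η, ζ, ζ₁⟩ hp
  unfold quarticAmplitude
  by_contra hne
  simp only [mul_eq_zero, not_or] at hne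
  obtain ⟨⟨h1, -⟩, h2, h3⟩ := hne
  have h1' : ζ ∈ Icc (-1 : ℝ) 1 := by_contra fun h => h1 (hκs _ h)
  have h2' : ζ₁ ∈ Icc 0 L := by_contra fun h => h2 (has _ h)
  have h3' : η - ζ₁ ∈ Icc 0 L := by_contra fun h => h3 (has _ h)
  exact hp ⟨⟨by linarith [h2'.1, h3'.1], by linarith [h2'.2, h3'.2]⟩, h1', h2'⟩

theorem inner_schrodinger_cube_eq_integral (hκ : Continuous κ) (ha : Continuous a) {L : ℝ}
    (hκs : ∀ x, x ∉ Icc (-1 : ℝ) 1 → κ x = 0) (has : ∀ x, x ∉ Icc 0 L → a x = 0)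
    {ψ u : 𝓢(ℝ, ℂ)} (hψ : ∀ x, (𝓕 ψ : 𝓢(ℝ, ℂ)) x = κ x) (hu : ∀ x, (𝓕 u : 𝓢(ℝ, ℂ)) x = a x)
    (σ : ℝ) :
    inner ℂ (schrodinger σ (ψ.toLp 2)) (cube (schrodinger σ (u.toLp 2))) =
      ∫ p, (quarticAmplitude κ a p : ℂ) *
        Complex.exp (((σ * quarticPhase p : ℝ) : ℂ) * Complex.I) := by
  have hint : Integrable (fun p => (quarticAmplitude κ a p : ℂ) *
        Complex.exp (((σ * quarticPhase p : ℝ) : ℂ) * Complex.I)) := by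
    have h1 := (integrable_quarticAmplitude hκ ha hκs has).ofReal (𝕜 := ℂ)
    refine h1.mono (h1.aestronglyMeasurable.mul ?_) (Eventually.of_forall fun p => ?_)
    · have := continuous_quarticPhase
      exact (by fun_prop : Continuous _).aestronglyMeasurable
    · rw [norm_mul, Complex.norm_exp_ofReal_mul_I, mul_one]
      rfl
  rw [schrodinger_toLp, schrodinger_toLp, inner_toLp_cube_toLp, Measure.volume_eq_prod,
    integral_prod _ hint]
  refine integral_congr_ae (Eventually.of_forall fun η => ?_)
  simp only
  rw [fourier_schwartzMul, fourier_schwartzMul, ← integral_conj, ← integral_prod_mul,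
    ← Measure.volume_eq_prod]
  refine integral_congr_ae (Eventually.of_forall fun q => ?_)
  simp only [fourier_freeEvolution, hψ, hu, schrodingerSymbol_eq, map_mul, Complex.conj_ofReal,
    ← Complex.exp_conj, Complex.conj_I, quarticAmplitude, quarticPhase]
  -- The resonance identity ζ² + (η-ζ)² - ζ₁² - (η-ζ₁)² = 2(ζ₁-ζ)(η-ζ₁-ζ), multiplied by (2π)².
  have h1 : Complex.exp (((σ * (8 * Real.pi ^ 2 * (q.2 - q.1) * (η - q.2 - q.1)) : ℝ) : ℂ) *
      Complex.I) =
      Complex.exp (((-(σ * (2 * Real.pi * q.1) ^ 2) : ℝ) : ℂ) * -Complex.I) *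
      Complex.exp (((-(σ * (2 * Real.pi * (η - q.1)) ^ 2) : ℝ) : ℂ) * -Complex.I) *
      (Complex.exp (((-(σ * (2 * Real.pi * q.2) ^ 2) : ℝ) : ℂ) * Complex.I) *
      Complex.exp (((-(σ * (2 * Real.pi * (η - q.2)) ^ 2) : ℝ) : ℂ) * Complex.I)) := by
    rw [← Complex.exp_add, ← Complex.exp_add, ← Complex.exp_add]
    congr 1
    push_cast
    ring
  rw [h1]
  push_cast
  ring

theorem im_inner_schrodinger_cube (hκ : Continuous κ) (ha : Continuous a) {L : ℝ}
    (hκs : ∀ x, x ∉ Icc (-1 : ℝ) 1 → κ x = 0) (has : ∀ x, x ∉ Icc 0 L → a x = 0)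
    {ψ u : 𝓢(ℝ, ℂ)} (hψ : ∀ x, (𝓕 ψ : 𝓢(ℝ, ℂ)) x = κ x) (hu : ∀ x, (𝓕 u : 𝓢(ℝ, ℂ)) x = a x)
    (σ : ℝ) :
    (inner ℂ (schrodinger σ (ψ.toLp 2)) (cube (schrodinger σ (u.toLp 2)))).im =
      ∫ p, quarticAmplitude κ a p * Real.sin (σ * quarticPhase p) := by
  have hint : Integrable (fun p => (quarticAmplitude κ a p : ℂ) *
        Complex.exp (((σ * quarticPhase p : ℝ) : ℂ) * Complex.I)) := by
    have h1 := (integrable_quarticAmplitude hκ ha hκs has).ofReal (𝕜 := ℂ)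
    refine h1.mono (h1.aestronglyMeasurable.mul ?_) (Eventually.of_forall fun p => ?_)
    · have := continuous_quarticPhase
      exact (by fun_prop : Continuous _).aestronglyMeasurable
    · rw [norm_mul, Complex.norm_exp_ofReal_mul_I, mul_one]
      rfl
  rw [inner_schrodinger_cube_eq_integral hκ ha hκs has hψ hu]
  have h1 := Complex.imCLM.integral_comp_comm hint
  simp only [Complex.imCLM_apply] at h1
  rw [← h1]
  refine integral_congr_ae (Eventually.of_forall fun p => ?_)
  simp only [Complex.im_ofReal_mul, Complex.exp_ofReal_mul_I_im]

theorem intervalIntegral_sin_mul {c : ℝ} (hc : c ≠ 0) :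
    ∫ σ in (0 : ℝ)..1, Real.sin (σ * c) = (1 - Real.cos c) / c := by
  rw [intervalIntegral.integral_comp_mul_right (fun x => Real.sin x) hc, integral_sin]
  simp only [zero_mul, Real.cos_zero, one_mul, smul_eq_mul]
  field_simp

/-- Fubini. With the σ average innermost, the oscillating sine becomes (1 - cos θ)/θ, where θ is the
phase, and this has the sign of θ. -/
theorem intervalIntegral_im_inner_schrodinger_cube (hκ : Continuous κ) (ha : Continuous a) {L : ℝ}
    (hκs : ∀ x, x ∉ Icc (-1 : ℝ) 1 → κ x = 0) (has : ∀ x, x ∉ Icc 0 L → a x = 0)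
    {ψ u : 𝓢(ℝ, ℂ)} (hψ : ∀ x, (𝓕 ψ : 𝓢(ℝ, ℂ)) x = κ x) (hu : ∀ x, (𝓕 u : 𝓢(ℝ, ℂ)) x = a x) :
    Integrable (fun p => quarticAmplitude κ a p *
        ∫ σ in (0 : ℝ)..1, Real.sin (σ * quarticPhase p)) ∧
    ∫ σ in (0 : ℝ)..1,
      (inner ℂ (schrodinger σ (ψ.toLp 2)) (cube (schrodinger σ (u.toLp 2)))).im =
      ∫ p, quarticAmplitude κ a p * ∫ σ in (0 : ℝ)..1, Real.sin (σ * quarticPhase p) := by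
  have hA := integrable_quarticAmplitude hκ ha hκs has
  have hint : Integrable (Function.uncurry fun (σ : ℝ) p =>
      quarticAmplitude κ a p * Real.sin (σ * quarticPhase p))
      ((volume.restrict (Ioc (0 : ℝ) 1)).prod volume) := by
    have h1 : Integrable (fun z : ℝ × (ℝ × (ℝ × ℝ)) => (1 : ℝ) * quarticAmplitude κ a z.2)
        ((volume.restrict (Ioc (0 : ℝ) 1)).prod volume) := (integrable_const 1).mul_prod hA
    refine h1.mono ?_ (Eventually.of_forall fun z => ?_)
    · have h2 := h1.aestronglyMeasurable
      simp only [one_mul] at h2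
      refine h2.mul ?_
      have := continuous_quarticPhase
      exact (by fun_prop : Continuous fun z : ℝ × (ℝ × (ℝ × ℝ)) =>
        Real.sin (z.1 * quarticPhase z.2)).aestronglyMeasurable
    · simp only [Function.uncurry, one_mul, norm_mul, Real.norm_eq_abs]
      exact mul_le_of_le_one_right (abs_nonneg _) (Real.abs_sin_le_one _)
  simp_rw [im_inner_schrodinger_cube hκ ha hκs has hψ hu,
    intervalIntegral.integral_of_le zero_le_one]
  constructor
  · have := hint.integral_prod_right
    simpa only [Function.uncurry, integral_const_mul] using this
  · have := integral_integral_swap hint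
    simpa only [integral_const_mul] using this

/-- In η the phase is affine with slope m ≥ 16/N, so the cosine integrates to at most 2/m ≤ N/8 over
an interval of length N/4. -/
theorem setLIntegral_one_sub_cos_ge {N ζ ζ₁ : ℝ} (hN : 4 ≤ N) (hζ : ζ ∈ Icc (-(1 / 2) : ℝ) (1 / 2))
    (hζ₁ : ζ₁ ∈ Icc N (5 / 4 * N)) :
    ENNReal.ofReal (N / 8) ≤ ∫⁻ η in Icc (ζ₁ + N) (ζ₁ + 5 / 4 * N),
      ENNReal.ofReal (1 - Real.cos (quarticPhase (η, (ζ, ζ₁)))) := by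
  set m := 8 * Real.pi ^ 2 * (ζ₁ - ζ) with hm
  have hpi := Real.pi_gt_three
  have hm1 : 16 / N ≤ m := by
    have h1 : (1 : ℝ) ≤ ζ₁ - ζ := by linarith [hζ.2, hζ₁.1]
    have h2 : (16 : ℝ) / N ≤ 4 := by
      rw [div_le_iff₀ (by linarith)]
      linarith
    nlinarith [sq_nonneg (Real.pi - 3)]
  have hm0 : 0 < m := lt_of_lt_of_le (by positivity) hm1
  have hcont : Continuous fun η => 1 - Real.cos (quarticPhase (η, (ζ, ζ₁))) := by
    unfold quarticPhase
    fun_prop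
  rw [← ofReal_integral_eq_lintegral_ofReal
    (hcont.continuousOn.integrableOn_compact isCompact_Icc)
    (Eventually.of_forall fun η => by simpa using Real.cos_le_one _)]
  refine ENNReal.ofReal_le_ofReal ?_
  rw [integral_Icc_eq_integral_Ioc, ← intervalIntegral.integral_of_le (by linarith)]
  have h1 : ∀ η : ℝ, 1 - Real.cos (quarticPhase (η, (ζ, ζ₁))) =
      1 - Real.cos (m * η - m * (ζ₁ + ζ)) := by
    intro η
    simp only [quarticPhase, hm]
    congr 2
    ring
  simp_rw [h1]
  rw [intervalIntegral.integral_sub (by simp)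
    (Continuous.intervalIntegrable (by fun_prop) _ _), intervalIntegral.integral_const,
    intervalIntegral.integral_comp_mul_sub (fun x => Real.cos x) hm0.ne', integral_cos]
  set x := Real.sin (m * (ζ₁ + 5 / 4 * N) - m * (ζ₁ + ζ))
  set y := Real.sin (m * (ζ₁ + N) - m * (ζ₁ + ζ))
  have hx : x ≤ 1 := Real.sin_le_one _
  have hy : -1 ≤ y := Real.neg_one_le_sin _
  have h2 : m⁻¹ * (x - y) ≤ N / 16 * 2 := by
    have h3 : m⁻¹ ≤ N / 16 := by
      rw [inv_le_comm₀ hm0 (by positivity)]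
      simpa using hm1
    calc m⁻¹ * (x - y) ≤ m⁻¹ * 2 := by gcongr; linarith
      _ ≤ _ := by gcongr
  simp only [smul_eq_mul, mul_one]
  linarith

/-- The lower bound for the resonant quartic form. -/
theorem intervalIntegral_im_inner_ge (hκ : Continuous κ) (ha : Continuous a) {N l : ℝ}
    (hN : 4 ≤ N) (hl : 0 < l) (hκ0 : ∀ x, 0 ≤ κ x) (ha0 : ∀ x, 0 ≤ a x)
    (hκs : ∀ x, x ∉ Icc (-1 : ℝ) 1 → κ x = 0) (has : ∀ x, x ∉ Icc (N / 2) (4 * N) → a x = 0)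
    (hκ1 : ∀ x ∈ Icc (-(1 / 2) : ℝ) (1 / 2), κ x = 1) (ha1 : ∀ x ∈ Icc N (7 / 2 * N), a x = l)
    {ψ u : 𝓢(ℝ, ℂ)} (hψ : ∀ x, (𝓕 ψ : 𝓢(ℝ, ℂ)) x = κ x) (hu : ∀ x, (𝓕 u : 𝓢(ℝ, ℂ)) x = a x) :
    l ^ 3 / (1024 * Real.pi ^ 2) ≤ ∫ σ in (0 : ℝ)..1,
      (inner ℂ (schrodinger σ (ψ.toLp 2)) (cube (schrodinger σ (u.toLp 2)))).im := by
  have has' : ∀ x, x ∉ Icc 0 (4 * N) → a x = 0 := fun x hx =>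
    has x fun h => hx ⟨by linarith [h.1], h.2⟩
  obtain ⟨hG, hGeq⟩ := intervalIntegral_im_inner_schrodinger_cube hκ ha hκs has' hψ hu
  rw [hGeq]
  set G : ℝ × (ℝ × ℝ) → ℝ := fun p => quarticAmplitude κ a p *
        ∫ σ in (0 : ℝ)..1, Real.sin (σ * quarticPhase p) with hGdef
  have hpi := Real.pi_pos
  -- On the support ζ ≤ 1 while ζ₁ and η - ζ₁ are at least N/2 ≥ 2, so both factors of the phase are
  -- positive. Without this sign the contributions could cancel.
  have hG0 : ∀ p, 0 ≤ G p := by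
    rintro ⟨η, ζ, ζ₁⟩
    rcases eq_or_ne (quarticAmplitude κ a (η, (ζ, ζ₁))) 0 with h0 | h0
    · simp only [hGdef, h0, zero_mul, le_refl]
    simp only [quarticAmplitude, mul_ne_zero_iff] at h0
    obtain ⟨⟨h1, -⟩, h2, h3⟩ := h0
    have h1' : ζ ∈ Icc (-1 : ℝ) 1 := by_contra fun h => h1 (hκs _ h)
    have h2' : ζ₁ ∈ Icc (N / 2) (4 * N) := by_contra fun h => h2 (has _ h)
    have h3' : η - ζ₁ ∈ Icc (N / 2) (4 * N) := by_contra fun h => h3 (has _ h)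
    have hph : 0 < quarticPhase (η, (ζ, ζ₁)) := by
      have h4 : 0 < ζ₁ - ζ := by linarith [h1'.2, h2'.1]
      have h5 : 0 < η - ζ₁ - ζ := by linarith [h1'.2, h3'.1]
      unfold quarticPhase
      positivity
    simp only [hGdef]
    rw [intervalIntegral_sin_mul hph.ne']
    refine mul_nonneg ?_ (div_nonneg (by linarith [Real.cos_le_one (quarticPhase (η, (ζ, ζ₁)))])
      hph.le)
    unfold quarticAmplitude
    have := hκ0 ζ
    exact mul_nonneg (mul_nonneg (hκ0 _) (ha0 _)) (mul_nonneg (ha0 _) (ha0 _))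
  -- On this box all three high frequencies lie in the plateau [N, 7N/2], and the phase is at most
  -- 8π²(2N)².
  have hGlow : ∀ η ζ ζ₁ : ℝ, ζ ∈ Icc (-(1 / 2) : ℝ) (1 / 2) → ζ₁ ∈ Icc N (5 / 4 * N) →
      η ∈ Icc (ζ₁ + N) (ζ₁ + 5 / 4 * N) →
      l ^ 3 / (32 * Real.pi ^ 2 * N ^ 2) * (1 - Real.cos (quarticPhase (η, (ζ, ζ₁)))) ≤
        G (η, (ζ, ζ₁)) := by
    intro η ζ ζ₁ hζ hζ₁ hη
    have h4 : 0 < ζ₁ - ζ := by linarith [hζ.2, hζ₁.1]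
    have h5 : 0 < η - ζ₁ - ζ := by linarith [hζ.2, hη.1]
    have hph : 0 < quarticPhase (η, (ζ, ζ₁)) := by
      unfold quarticPhase
      positivity
    have hph2 : quarticPhase (η, (ζ, ζ₁)) ≤ 32 * Real.pi ^ 2 * N ^ 2 := by
      have h6 : ζ₁ - ζ ≤ 2 * N := by linarith [hζ.1, hζ₁.2]
      have h7 : η - ζ₁ - ζ ≤ 2 * N := by linarith [hζ.1, hη.2]
      unfold quarticPhase
      calc 8 * Real.pi ^ 2 * (ζ₁ - ζ) * (η - ζ₁ - ζ) ≤ 8 * Real.pi ^ 2 * (2 * N) * (2 * N) := by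
            gcongr
        _ = _ := by ring
    have hcos := Real.cos_le_one (quarticPhase (η, (ζ, ζ₁)))
    simp only [hGdef]
    rw [intervalIntegral_sin_mul hph.ne']
    have hA : quarticAmplitude κ a (η, (ζ, ζ₁)) = l ^ 3 := by
      simp only [quarticAmplitude]
      rw [hκ1 ζ hζ, ha1 (η - ζ) ⟨by linarith [hζ.2, hη.1, hζ₁.1], by linarith [hζ.1, hη.2, hζ₁.2]⟩,
        ha1 ζ₁ ⟨hζ₁.1, by linarith [hζ₁.2]⟩, ha1 (η - ζ₁) ⟨by linarith [hη.1], by linarith [hη.2]⟩]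
      ring
    rw [hA, div_mul_eq_mul_div, mul_div_assoc]
    gcongr
  have hN0 : 0 < N := by linarith
  have key : ENNReal.ofReal (l ^ 3 / (1024 * Real.pi ^ 2)) ≤ ENNReal.ofReal (∫ p, G p) := by
    rw [ofReal_integral_eq_lintegral_ofReal hG (Eventually.of_forall hG0), Measure.volume_eq_prod,
      lintegral_prod_symm _ hG.aestronglyMeasurable.aemeasurable.ennreal_ofReal]
    set c := l ^ 3 / (32 * Real.pi ^ 2 * N ^ 2) with hc
    have hc0 : 0 < c := by positivity
    -- The (ζ, ζ₁) box has area N/4 and the η integral gives N/8, so the powers of N cancel against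
    -- the N² in c.
    calc ENNReal.ofReal (l ^ 3 / (1024 * Real.pi ^ 2))
        = ∫⁻ _ in Icc (-(1 / 2) : ℝ) (1 / 2) ×ˢ Icc N (5 / 4 * N),
          ENNReal.ofReal c * ENNReal.ofReal (N / 8) := by
          rw [setLIntegral_const, Measure.volume_eq_prod, Measure.prod_prod, Real.volume_Icc,
            Real.volume_Icc, ← ENNReal.ofReal_mul (by positivity),
            ← ENNReal.ofReal_mul (by norm_num), ← ENNReal.ofReal_mul (by positivity), hc]
          congr 1
          field_simp
          ring
      _ ≤ ∫⁻ q in Icc (-(1 / 2) : ℝ) (1 / 2) ×ˢ Icc N (5 / 4 * N),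
          ∫⁻ η, ENNReal.ofReal (G (η, q)) := by
          refine setLIntegral_mono' (measurableSet_Icc.prod measurableSet_Icc) ?_
          rintro ⟨ζ, ζ₁⟩ ⟨hζ, hζ₁⟩
          refine (mul_le_mul_right (setLIntegral_one_sub_cos_ge hN hζ hζ₁) _).trans ?_
          rw [← lintegral_const_mul' _ _ ENNReal.ofReal_ne_top]
          refine le_trans ?_ (setLIntegral_le_lintegral (Icc (ζ₁ + N) (ζ₁ + 5 / 4 * N)) _)
          refine setLIntegral_mono' measurableSet_Icc fun η hη => ?_
          rw [← ENNReal.ofReal_mul hc0.le]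
          exact ENNReal.ofReal_le_ofReal (hGlow η ζ ζ₁ hζ hζ₁ hη)
      _ ≤ _ := setLIntegral_le_lintegral _ _
  exact (ENNReal.ofReal_le_ofReal_iff (integral_nonneg hG0)).1 key

end Quartic

/-! ### The initial data and the test function -/

theorem exists_fourier_eq_ofReal {f : ℝ → ℝ} (hf : ContDiff ℝ (⊤ : ℕ∞) f) (hs : HasCompactSupport f) :
    ∃ φ : 𝓢(ℝ, ℂ), ∀ ζ, (𝓕 φ : 𝓢(ℝ, ℂ)) ζ = (f ζ : ℂ) := by
  have h1 : HasCompactSupport fun ζ => (f ζ : ℂ) := hs.comp_left (g := fun x : ℝ => (x : ℂ)) (by simp)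
  have h2 : ContDiff ℝ (⊤ : ℕ∞) fun ζ => (f ζ : ℂ) := Complex.ofRealCLM.contDiff.comp hf
  refine ⟨𝓕⁻ (h1.toSchwartzMap h2), fun ζ => ?_⟩
  rw [FourierTransform.fourier_fourierInv_eq]
  rfl

/-- A bump function for the frequencies of the test function. -/
def lowBump : ContDiffBump (0 : ℝ) := ⟨1 / 2, 1, by norm_num, by norm_num⟩

/-- A bump function for the rescaled frequencies of the initial data. -/
def highBump : ContDiffBump (9 / 4 : ℝ) := ⟨5 / 4, 7 / 4, by norm_num, by norm_num⟩

theorem lowBump_eq_zero {x : ℝ} (hx : x ∉ Icc (-1 : ℝ) 1) : lowBump x = 0 := by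
  refine lowBump.zero_of_le_dist ?_
  rw [Real.dist_eq, sub_zero]
  change (1 : ℝ) ≤ |x|
  by_contra! h
  exact hx ⟨(abs_lt.1 h).1.le, (abs_lt.1 h).2.le⟩

theorem lowBump_eq_one {x : ℝ} (hx : x ∈ Icc (-(1 / 2) : ℝ) (1 / 2)) : lowBump x = 1 := by
  refine lowBump.one_of_mem_closedBall ?_
  rw [Metric.mem_closedBall, Real.dist_eq, sub_zero]
  exact abs_le.2 hx

theorem highBump_eq_zero {x : ℝ} (hx : x ∉ Icc (1 / 2 : ℝ) 4) : highBump x = 0 := by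
  refine highBump.zero_of_le_dist ?_
  rw [Real.dist_eq]
  change (7 / 4 : ℝ) ≤ |x - 9 / 4|
  by_contra! h
  rw [abs_lt] at h
  exact hx ⟨by linarith, by linarith⟩

theorem highBump_eq_one {x : ℝ} (hx : x ∈ Icc (1 : ℝ) (7 / 2)) : highBump x = 1 := by
  refine highBump.one_of_mem_closedBall ?_
  rw [Metric.mem_closedBall, Real.dist_eq]
  change |x - 9 / 4| ≤ 5 / 4
  rw [abs_le]
  constructor <;> linarith [hx.1, hx.2]

/-- `φ` has the Fourier transform `l χ(ζ / N)`, where `χ` is `highBump`. -/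
def IsDatum (N l : ℝ) (φ : 𝓢(ℝ, ℂ)) : Prop :=
  ∀ ζ, (𝓕 φ : 𝓢(ℝ, ℂ)) ζ = ((l * highBump (ζ / N) : ℝ) : ℂ)

/-- `ψ` has the Fourier transform `lowBump`. -/
def IsTestFunction (ψ : 𝓢(ℝ, ℂ)) : Prop :=
  ∀ ζ, (𝓕 ψ : 𝓢(ℝ, ℂ)) ζ = (lowBump ζ : ℂ)

theorem exists_isTestFunction : ∃ ψ, IsTestFunction ψ :=
  exists_fourier_eq_ofReal lowBump.contDiff lowBump.hasCompactSupport

theorem datumSymbol_eq_zero {N l : ℝ} (hN : 0 < N) {x : ℝ} (hx : x ∉ Icc (N / 2) (4 * N)) :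
    l * highBump (x / N) = 0 := by
  rw [highBump_eq_zero, mul_zero]
  refine fun h2 => hx ⟨?_, ?_⟩
  · have := (le_div_iff₀ hN).1 h2.1
    linarith
  · exact (div_le_iff₀ hN).1 h2.2

theorem exists_isDatum {N : ℝ} (hN : 0 < N) (l : ℝ) : ∃ φ, IsDatum N l φ := by
  refine exists_fourier_eq_ofReal
    (contDiff_const.mul (highBump.contDiff.comp (contDiff_id.div_const N))) ?_
  refine HasCompactSupport.of_support_subset_isCompact
    (isCompact_Icc (a := N / 2) (b := 4 * N)) fun x hx => ?_
  by_contra h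
  exact hx (datumSymbol_eq_zero hN h)

/-! ### Size and dispersion of the data -/

section Datum

variable {N l : ℝ} {φ : 𝓢(ℝ, ℂ)}

theorem IsDatum.norm_fourier_le (hφ : IsDatum N l φ) (hN : 0 < N) (hl : 0 ≤ l) (ζ : ℝ) :
    ‖(𝓕 φ : 𝓢(ℝ, ℂ)) ζ‖ ≤ (Icc (N / 2) (4 * N)).indicator (fun _ => l) ζ := by
  rw [hφ ζ]
  by_cases h : ζ ∈ Icc (N / 2) (4 * N)
  · rw [indicator_of_mem h, Complex.norm_real,
      Real.norm_of_nonneg (mul_nonneg hl highBump.nonneg)]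
    exact mul_le_of_le_one_right hl highBump.le_one
  · rw [indicator_of_notMem h, datumSymbol_eq_zero hN h]
    simp

theorem IsDatum.integral_norm_fourier_le (hφ : IsDatum N l φ) (hN : 0 < N) (hl : 0 ≤ l) :
    ∫ ζ, ‖(𝓕 φ : 𝓢(ℝ, ℂ)) ζ‖ ≤ 4 * N * l := by
  calc ∫ ζ, ‖(𝓕 φ : 𝓢(ℝ, ℂ)) ζ‖ ≤ ∫ ζ, (Icc (N / 2) (4 * N)).indicator (fun _ => l) ζ :=
        integral_mono (𝓕 φ : 𝓢(ℝ, ℂ)).integrable.norm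
          ((integrable_indicator_iff measurableSet_Icc).2 (integrableOn_const (by simp))) (hφ.norm_fourier_le hN hl)
    _ = (4 * N - N / 2) * l := by
        rw [integral_indicator measurableSet_Icc, setIntegral_const, smul_eq_mul,
          Measure.real, Real.volume_Icc, ENNReal.toReal_ofReal (by linarith)]
    _ ≤ _ := by
        gcongr
        linarith

theorem IsDatum.lintegral_mul_fourier_sq_le (hφ : IsDatum N l φ) (hN : 0 < N) (hl : 0 ≤ l)
    {g : ℝ → ℝ≥0∞} {c : ℝ} (hc : 0 ≤ c) (hg : ∀ ζ, N / 2 ≤ ζ → g ζ ≤ ENNReal.ofReal c) :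
    ∫⁻ ζ, g ζ * ‖(𝓕 φ : 𝓢(ℝ, ℂ)) ζ‖ₑ ^ 2 ≤ ENNReal.ofReal (c * (4 * N * l ^ 2)) := by
  calc ∫⁻ ζ, g ζ * ‖(𝓕 φ : 𝓢(ℝ, ℂ)) ζ‖ₑ ^ 2
      ≤ ∫⁻ ζ, (Icc (N / 2) (4 * N)).indicator (fun _ => ENNReal.ofReal (c * l ^ 2)) ζ := by
        refine lintegral_mono fun ζ => ?_
        have h1 := hφ.norm_fourier_le hN hl ζ
        by_cases h : ζ ∈ Icc (N / 2) (4 * N)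
        · rw [indicator_of_mem h] at h1 ⊢
          rw [ENNReal.ofReal_mul hc, ENNReal.ofReal_pow hl, ← ofReal_norm]
          gcongr
          exact hg ζ h.1
        · rw [indicator_of_notMem h] at h1 ⊢
          rw [norm_le_zero_iff.1 h1]
          simp
    _ = ENNReal.ofReal (c * l ^ 2) * ENNReal.ofReal (4 * N - N / 2) := by
        rw [lintegral_indicator measurableSet_Icc, setLIntegral_const, Real.volume_Icc]
    _ ≤ _ := by
        rw [← ENNReal.ofReal_mul (by positivity)]
        refine ENNReal.ofReal_le_ofReal ?_
        have : 0 ≤ c * l ^ 2 := by positivity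
        nlinarith

theorem IsDatum.norm_toLp_le (hφ : IsDatum N l φ) (hN : 0 < N) (hl : 0 ≤ l) :
    ‖φ.toLp 2‖ ≤ 2 * l * N ^ (1 / 2 : ℝ) := by
  have h := hφ.lintegral_mul_fourier_sq_le hN hl (g := fun _ => 1) (c := 1) zero_le_one (by simp)
  simp only [one_mul] at h
  rw [lintegral_fourier_sq, ← enorm_toLp_sq, ← ofReal_norm, ← ENNReal.ofReal_pow (norm_nonneg _),
    ENNReal.ofReal_le_ofReal_iff (by positivity)] at h
  refine (sq_le_sq₀ (norm_nonneg _) (by positivity)).1 ?_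
  rw [mul_pow, ← Real.rpow_natCast (N ^ (1 / 2 : ℝ)), ← Real.rpow_mul hN.le]
  norm_num
  linarith

theorem sobolevNorm_toLp (s : ℝ) (φ : 𝓢(ℝ, ℂ)) :
    sobolevNorm s (φ.toLp 2) = (∫⁻ ζ : ℝ, ENNReal.ofReal ((1 + (2 * Real.pi * ζ) ^ 2) ^ s) *
      ‖(𝓕 φ : 𝓢(ℝ, ℂ)) ζ‖ₑ ^ 2) ^ (1 / 2 : ℝ) := by
  rw [sobolevNorm, SchwartzMap.toLp_fourier_eq]
  congr 1
  refine lintegral_congr_ae ?_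
  filter_upwards [SchwartzMap.coeFn_toLp (𝓕 φ) 2 volume] with x h
  rw [h, ENNReal.ofReal_pow (norm_nonneg _), ofReal_norm]

/-- On the support 1 + (2πζ)² ≥ N², so for s ≤ 0 the weight is at most N^{2s} over a set of length
below 4N. -/
theorem IsDatum.sobolevNorm_le (hφ : IsDatum N l φ) (hN : 0 < N) (hl : 0 ≤ l) {s : ℝ} (hs : s ≤ 0) :
    sobolevNorm s (φ.toLp 2) ≤ ENNReal.ofReal (2 * l * N ^ (s + 1 / 2)) := by
  have h := hφ.lintegral_mul_fourier_sq_le hN hl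
    (g := fun ζ => ENNReal.ofReal ((1 + (2 * Real.pi * ζ) ^ 2) ^ s)) (c := N ^ (2 * s))
    (by positivity) fun ζ hζ => by
      refine ENNReal.ofReal_le_ofReal ?_
      rw [Real.rpow_mul hN.le]
      refine Real.rpow_le_rpow_of_nonpos (by positivity) ?_ hs
      rw [Real.rpow_two]
      have h1 : N ≤ 2 * Real.pi * ζ := by nlinarith [Real.pi_gt_three]
      nlinarith
  rw [sobolevNorm_toLp]
  refine (ENNReal.rpow_le_rpow h (by norm_num)).trans (le_of_eq ?_)
  rw [ENNReal.ofReal_rpow_of_nonneg (by positivity) (by norm_num)]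
  congr 1
  have h2 : N ^ (2 * s) * (4 * N * l ^ 2) = (2 * l * N ^ (s + 1 / 2)) ^ 2 := by
    rw [mul_pow, ← Real.rpow_natCast (N ^ (s + 1 / 2)), ← Real.rpow_mul hN.le]
    have h3 : (s + 1 / 2) * ((2 : ℕ) : ℝ) = 2 * s + 1 := by push_cast; ring
    rw [h3, Real.rpow_add_one hN.ne']
    ring
  rw [h2, ← Real.sqrt_eq_rpow, Real.sqrt_sq (by positivity)]

/-- The datum is l N X(Nx) for a fixed X, and this scaling preserves the L¹ norm up to l.
Independence of N is what makes the dispersive estimate effective. -/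
theorem exists_integral_norm_datum_eq :
    ∃ L : ℝ, 0 ≤ L ∧ ∀ {N l : ℝ} {φ : 𝓢(ℝ, ℂ)}, 0 < N → 0 ≤ l → IsDatum N l φ →
      ∫ x, ‖φ x‖ = l * L := by
  obtain ⟨X, hX⟩ := exists_isDatum one_pos 1
  refine ⟨∫ x, ‖X x‖, integral_nonneg fun _ => norm_nonneg _, fun {N l φ} hN hl hφ => ?_⟩
  have h1 : ∀ x, φ x = ((l * N : ℝ) : ℂ) * X (N * x) := by
    intro x
    have h2 := schwartz_fourierInv_eq_integral (𝓕 φ) x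
    have h3 := schwartz_fourierInv_eq_integral (𝓕 X) (N * x)
    rw [FourierTransform.fourierInv_fourier_eq] at h2 h3
    rw [h2, h3]
    have h4 := Measure.integral_comp_div (fun ζ => ((l : ℝ) : ℂ) *
      (Complex.exp (((2 * Real.pi * (N * x * ζ) : ℝ) : ℂ) * Complex.I) * (𝓕 X : 𝓢(ℝ, ℂ)) ζ)) N
    rw [integral_const_mul, integral_const_mul, abs_of_pos hN] at h4
    rw [Complex.ofReal_mul, mul_comm (l : ℂ), mul_assoc]
    rw [Complex.real_smul] at h4
    rw [← h4, ← integral_const_mul]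
    refine integral_congr_ae (Eventually.of_forall fun ζ => ?_)
    simp only [hφ ζ, hX (ζ / N), div_one, one_mul]
    have h5 : N * x * (ζ / N) = x * ζ := by field_simp
    rw [h5]
    push_cast
    ring
  simp_rw [h1, norm_mul, Complex.norm_real, Real.norm_of_nonneg (mul_nonneg hl hN.le)]
  rw [integral_const_mul, Measure.integral_comp_mul_left (fun x => ‖X x‖) N, abs_of_pos (by positivity),
    smul_eq_mul]
  field_simp

/-- Geometric interpolation between the bound by the L¹ norm of the Fourier transform, of order lN,
and dispersive decay, of order l|σ|^{-1/2}. The loss N^k buys integrability: the square decays like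
|σ|^{-(1-k)} instead of the borderline |σ|^{-1}. -/
theorem exists_norm_freeEvolution_datum_le :
    ∃ C : ℝ, 0 < C ∧ ∀ {N l k : ℝ} {φ : 𝓢(ℝ, ℂ)}, 0 < N → 0 ≤ l → 0 ≤ k → k ≤ 1 → IsDatum N l φ →
      ∀ σ : ℝ, σ ≠ 0 → ∀ x, ‖freeEvolution σ φ x‖ ≤ C * l * N ^ k * |σ| ^ (-((1 - k) / 2)) := by
  obtain ⟨L, hL0, hL⟩ := exists_integral_norm_datum_eq
  refine ⟨4 + L, by positivity, fun {N l k φ} hN hl hk0 hk1 hφ σ hσ x => ?_⟩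
  set y := ‖freeEvolution σ φ x‖ with hy
  have hy0 : 0 ≤ y := norm_nonneg _
  have hσ' : 0 < |σ| := abs_pos.2 hσ
  have h1 : y ≤ (4 + L) * l * N := by
    refine ((norm_freeEvolution_le_integral_fourier σ φ x).trans
      (hφ.integral_norm_fourier_le hN hl)).trans ?_
    have : 0 ≤ L * l * N := by positivity
    linarith
  have h2 : y ≤ (4 + L) * l * |σ| ^ (-(1 / 2) : ℝ) := by
    refine (norm_freeEvolution_le_rpow σ hσ φ x).trans ?_
    rw [hL hN hl hφ]
    have : 0 ≤ 4 * l * |σ| ^ (-(1 / 2) : ℝ) := by positivity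
    linarith
  have hD : 0 ≤ (4 + L) * l := by positivity
  calc y = y ^ k * y ^ (1 - k) := by
        rw [← Real.rpow_add_of_nonneg hy0 hk0 (by linarith)]
        simp
    _ ≤ ((4 + L) * l * N) ^ k * ((4 + L) * l * |σ| ^ (-(1 / 2) : ℝ)) ^ (1 - k) := by
        gcongr
    _ = ((4 + L) * l) ^ k * ((4 + L) * l) ^ (1 - k) * N ^ k *
          (|σ| ^ (-(1 / 2) : ℝ)) ^ (1 - k) := by
        rw [Real.mul_rpow hD hN.le, Real.mul_rpow hD (by positivity)]
        ring
    _ = _ := by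
        rw [← Real.rpow_add_of_nonneg hD hk0 (by linarith), ← Real.rpow_mul hσ'.le]
        simp only [add_sub_cancel, Real.rpow_one]
        congr 2
        ring

end Datum

/-! ### The low-frequency test function -/

section TestFunction

variable {ψ : 𝓢(ℝ, ℂ)}

theorem IsTestFunction.norm_fourier_le (hψ : IsTestFunction ψ) (ζ : ℝ) :
    ‖(𝓕 ψ : 𝓢(ℝ, ℂ)) ζ‖ ≤ (Icc (-1 : ℝ) 1).indicator (fun _ => 1) ζ := by
  rw [hψ ζ, Complex.norm_real, Real.norm_of_nonneg lowBump.nonneg]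
  by_cases h : ζ ∈ Icc (-1 : ℝ) 1
  · rw [indicator_of_mem h]
    exact lowBump.le_one
  · rw [indicator_of_notMem h, lowBump_eq_zero h]

theorem IsTestFunction.integral_norm_fourier_le (hψ : IsTestFunction ψ) :
    ∫ ζ, ‖(𝓕 ψ : 𝓢(ℝ, ℂ)) ζ‖ ≤ 2 := by
  calc ∫ ζ, ‖(𝓕 ψ : 𝓢(ℝ, ℂ)) ζ‖ ≤ ∫ ζ, (Icc (-1 : ℝ) 1).indicator (fun _ => 1) ζ :=
        integral_mono (𝓕 ψ : 𝓢(ℝ, ℂ)).integrable.norm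
          ((integrable_indicator_iff measurableSet_Icc).2 (integrableOn_const (by simp)))
          hψ.norm_fourier_le
    _ = 2 := by
        rw [integral_indicator measurableSet_Icc, setIntegral_const, smul_eq_mul,
          Measure.real, Real.volume_Icc, ENNReal.toReal_ofReal (by norm_num)]
        norm_num

theorem norm_schrodingerSymbol_sub_one_le (r ζ : ℝ) :
    ‖schrodingerSymbol r ζ - 1‖ ≤ |r| * (2 * Real.pi * ζ) ^ 2 := by
  have h : schrodingerSymbol r ζ =
      Complex.exp (Complex.I * ((-(r * (2 * Real.pi * ζ) ^ 2) : ℝ) : ℂ)) := by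
    rw [schrodingerSymbol]
    push_cast
    ring_nf
  rw [h]
  refine (Real.norm_exp_I_mul_ofReal_sub_one_le).trans ?_
  rw [norm_neg, Real.norm_eq_abs, abs_mul, abs_of_nonneg (sq_nonneg (2 * Real.pi * ζ))]

/-- Frequencies at most 1 rotate with bounded speed, so the free flow moves ψ only by O(|r|). -/
theorem IsTestFunction.norm_schrodinger_sub_le (hψ : IsTestFunction ψ) (r : ℝ) :
    ‖schrodinger r (ψ.toLp 2) - ψ.toLp 2 volume‖ ≤ 4 * Real.pi ^ 2 * |r| * ‖ψ.toLp 2 volume‖ := by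
  rw [← Lp.norm_fourier_eq (schrodinger r (ψ.toLp 2 volume) - ψ.toLp 2 volume),
    ← Lp.norm_fourier_eq (ψ.toLp 2 volume)]
  refine Lp.norm_le_mul_norm_of_ae_le_mul ?_
  have hsub : ∀ f g : L2, (𝓕 (f - g) : L2) = 𝓕 f - 𝓕 g := fun f g =>
    (Lp.fourierTransformₗᵢ ℝ ℂ).map_sub f g
  rw [hsub]
  have h0 := SchwartzMap.coeFn_toLp (𝓕 ψ) 2 volume
  rw [← SchwartzMap.toLp_fourier_eq] at h0
  filter_upwards [Lp.coeFn_sub (𝓕 (schrodinger r (ψ.toLp 2 volume))) (𝓕 (ψ.toLp 2 volume)),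
    fourier_schrodinger r (ψ.toLp 2), h0] with ζ h1 h2 h3
  rw [h1, Pi.sub_apply, h2, ← sub_one_mul, norm_mul]
  rw [h3, hψ ζ]
  by_cases h : ζ ∈ Icc (-1 : ℝ) 1
  · gcongr
    refine (norm_schrodingerSymbol_sub_one_le r ζ).trans ?_
    have : ζ ^ 2 ≤ 1 := by nlinarith [h.1, h.2]
    have h4 : 0 ≤ 4 * Real.pi ^ 2 * |r| := by positivity
    nlinarith
  · rw [lowBump_eq_zero h]
    simp

/-- Disjoint frequency supports, [-1,1] against [N/2,4N]: the linear evolution is invisible to the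
test function. -/
theorem IsTestFunction.inner_schrodinger_datum (hψ : IsTestFunction ψ) {N l : ℝ} {φ : 𝓢(ℝ, ℂ)}
    (hN : 4 ≤ N) (hφ : IsDatum N l φ) (r : ℝ) :
    inner ℂ (schrodinger r (ψ.toLp 2)) (φ.toLp 2) = 0 := by
  rw [schrodinger_toLp, ← SchwartzMap.inner_fourier_toL2_eq, L2.inner_def]
  refine integral_eq_zero_of_ae ?_
  filter_upwards [SchwartzMap.coeFn_toLp (𝓕 (freeEvolution r ψ)) 2 volume,
    SchwartzMap.coeFn_toLp (𝓕 φ) 2 volume] with ζ h1 h2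
  rw [h1, h2, fourier_freeEvolution, hψ ζ, hφ ζ]
  by_cases h : ζ ∈ Icc (-1 : ℝ) 1
  · rw [datumSymbol_eq_zero (by linarith) fun h' => by linarith [h'.1, h.2]]
    simp
  · rw [lowBump_eq_zero h]
    simp

theorem IsTestFunction.enorm_inner_le_lintegral (hψ : IsTestFunction ψ) (f : L2) :
    ‖inner ℂ (ψ.toLp 2) f‖ₑ ≤ ∫⁻ ζ in Icc (-1 : ℝ) 1, ‖(𝓕 f : L2) ζ‖ₑ := by
  rw [← Lp.inner_fourier_eq, L2.inner_def, ← lintegral_indicator measurableSet_Icc]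
  refine (enorm_integral_le_lintegral_enorm _).trans (lintegral_mono_ae ?_)
  have h0 := SchwartzMap.coeFn_toLp (𝓕 ψ) 2 volume
  rw [← SchwartzMap.toLp_fourier_eq] at h0
  filter_upwards [h0] with ζ h1
  have h2 := hψ.norm_fourier_le ζ
  rw [← ofReal_norm]
  by_cases h : ζ ∈ Icc (-1 : ℝ) 1
  · rw [indicator_of_mem h] at h2 ⊢
    rw [← ofReal_norm]
    refine ENNReal.ofReal_le_ofReal ((norm_inner_le_norm _ _).trans ?_)
    rw [h1]
    exact mul_le_of_le_one_left (norm_nonneg _) h2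
  · rw [indicator_of_notMem h] at h2 ⊢
    rw [h1, norm_le_zero_iff.1 h2]
    simp

theorem setLIntegral_fourier_sq_le {s : ℝ} (hs : s ≤ 0) (f : L2) :
    ∫⁻ ζ in Icc (-1 : ℝ) 1, ‖(𝓕 f : L2) ζ‖ₑ ^ 2 ≤ ENNReal.ofReal ((1 + 4 * Real.pi ^ 2) ^ (-s)) *
      ∫⁻ ζ : ℝ, ENNReal.ofReal ((1 + (2 * Real.pi * ζ) ^ 2) ^ s) *
        ENNReal.ofReal (‖(𝓕 f : L2) ζ‖ ^ 2) := by
  set c := (1 + 4 * Real.pi ^ 2) ^ (-s) with hc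
  have hc0 : 0 < c := by positivity
  rw [← lintegral_const_mul' _ _ ENNReal.ofReal_ne_top]
  refine le_trans ?_ (setLIntegral_le_lintegral (Icc (-1 : ℝ) 1) _)
  refine setLIntegral_mono' measurableSet_Icc fun ζ hζ => ?_
  rw [ENNReal.ofReal_pow (norm_nonneg _), ofReal_norm, ← mul_assoc, ← ENNReal.ofReal_mul hc0.le]
  refine le_mul_of_one_le_left zero_le ?_
  rw [ENNReal.one_le_ofReal]
  have h1 : (1 + 4 * Real.pi ^ 2) ^ s ≤ (1 + (2 * Real.pi * ζ) ^ 2) ^ s := by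
    refine Real.rpow_le_rpow_of_nonpos (by positivity) ?_ hs
    have : ζ ^ 2 ≤ 1 := by nlinarith [hζ.1, hζ.2]
    nlinarith [sq_nonneg Real.pi]
  calc (1 : ℝ) = c * (1 + 4 * Real.pi ^ 2) ^ s := by
        rw [hc, ← Real.rpow_add (by positivity)]
        simp
    _ ≤ _ := by gcongr

/-- Cauchy–Schwarz on [-1,1], where the Sobolev weight is bounded below. This converts growth of one
pairing into growth of the H^s norm. -/
theorem IsTestFunction.enorm_inner_le (hψ : IsTestFunction ψ) {s : ℝ} (hs : s ≤ 0) (f : L2) :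
    ‖inner ℂ (ψ.toLp 2) f‖ₑ ≤
      ENNReal.ofReal ((2 * (1 + 4 * Real.pi ^ 2) ^ (-s)) ^ (1 / 2 : ℝ)) * sobolevNorm s f := by
  set c := (1 + 4 * Real.pi ^ 2) ^ (-s) with hc
  have hc0 : 0 < c := by positivity
  have h1 := ENNReal.lintegral_mul_le_Lp_mul_Lq (volume.restrict (Icc (-1 : ℝ) 1))
    Real.HolderConjugate.two_two (f := fun _ => 1) (g := fun ζ => ‖(𝓕 f : L2) ζ‖ₑ)
    aemeasurable_const (Lp.aestronglyMeasurable _).enorm.restrict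
  have h2 : (∫⁻ _ in Icc (-1 : ℝ) 1, (1 : ℝ≥0∞) ^ 2) = ENNReal.ofReal 2 := by
    simp only [one_pow, setLIntegral_const, Real.volume_Icc, one_mul]
    norm_num
  simp only [Pi.mul_apply, one_mul, ENNReal.rpow_two] at h1
  rw [h2] at h1
  refine ((hψ.enorm_inner_le_lintegral f).trans h1).trans ?_
  have h3 := ENNReal.rpow_le_rpow (setLIntegral_fourier_sq_le hs f) (z := 1 / 2) (by norm_num)
  rw [ENNReal.mul_rpow_of_nonneg _ _ (by norm_num)] at h3
  refine (mul_le_mul_right h3 _).trans (le_of_eq ?_)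
  rw [sobolevNorm, ← mul_assoc, ← ENNReal.mul_rpow_of_nonneg _ _ (by norm_num),
    ← ENNReal.ofReal_mul (by norm_num), ENNReal.ofReal_rpow_of_pos (by positivity)]

end TestFunction

/-! ### Estimates on the interaction picture -/

/-- For |α| ≤ 1 the shifted window stays in [-2,2], so one integral bounds all of them. -/
theorem exists_setLIntegral_abs_rpow_le {p : ℝ} (hp : p < 1) :
    ∃ K : ℝ, 0 < K ∧ ∀ α : ℝ, |α| ≤ 1 →
      ∫⁻ σ in Icc (0 : ℝ) 1, ENNReal.ofReal (|σ + α| ^ (-p)) ≤ ENNReal.ofReal K := by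
  set I := ∫⁻ σ in Icc (-2 : ℝ) 2, ENNReal.ofReal (|σ| ^ (-p)) with hI
  have h0 : ∫⁻ σ in Icc (0 : ℝ) 2, ENNReal.ofReal (|σ| ^ (-p)) < ∞ := by
    have h1 : IntegrableOn (fun σ : ℝ => σ ^ (-p)) (Icc 0 2) :=
      (intervalIntegrable_iff_integrableOn_Icc_of_le (by norm_num)).1
        (intervalIntegral.intervalIntegrable_rpow' (by linarith))
    refine lt_of_le_of_lt (le_of_eq (setLIntegral_congr_fun measurableSet_Icc fun σ hσ => ?_))
      h1.lintegral_lt_top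
    simp only [abs_of_nonneg hσ.1]
  have h1 : ∫⁻ σ in Icc (-2 : ℝ) 0, ENNReal.ofReal (|σ| ^ (-p)) =
      ∫⁻ σ in Icc (0 : ℝ) 2, ENNReal.ofReal (|σ| ^ (-p)) := by
    have h2 := (Measure.measurePreserving_neg (volume : Measure ℝ)).setLIntegral_comp_preimage_emb
      (Homeomorph.neg ℝ).measurableEmbedding
      (fun σ => ENNReal.ofReal (|σ| ^ (-p))) (Icc (0 : ℝ) 2)
    rw [← h2]
    simp [abs_neg]
  have hI' : I < ∞ := by
    have h3 : Icc (-2 : ℝ) 2 ⊆ Icc (-2) 0 ∪ Icc 0 2 := fun x hx => by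
      rcases le_total x 0 with h | h
      · exact Or.inl ⟨hx.1, h⟩
      · exact Or.inr ⟨h, hx.2⟩
    refine (lintegral_mono_set h3).trans_lt ((lintegral_union_le _ _ _).trans_lt ?_)
    rw [h1]
    exact ENNReal.add_lt_top.2 ⟨h0, h0⟩
  refine ⟨I.toReal + 1, by positivity, fun α hα => ?_⟩
  have h4 := (measurePreserving_add_right (volume : Measure ℝ) α).setLIntegral_comp_preimage_emb
    (Homeomorph.addRight α).measurableEmbedding
    (fun σ => ENNReal.ofReal (|σ| ^ (-p))) (Icc α (α + 1))
  have h5 : (fun σ => σ + α) ⁻¹' Icc α (α + 1) = Icc (0 : ℝ) 1 := by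
    ext x
    simp only [mem_preimage, mem_Icc]
    constructor <;> rintro ⟨h, h'⟩ <;> constructor <;> linarith
  rw [h5] at h4
  rw [h4]
  rw [abs_le] at hα
  calc _ ≤ I := lintegral_mono_set (Icc_subset_Icc (by linarith) (by linarith))
    _ = ENNReal.ofReal I.toReal := (ENNReal.ofReal_toReal hI'.ne).symm
    _ ≤ _ := ENNReal.ofReal_le_ofReal (by linarith)

theorem norm_cube_toLp_le {φ : 𝓢(ℝ, ℂ)} {B : ℝ} (hB : ∀ x, ‖φ x‖ ≤ B) :
    ‖cube (φ.toLp 2)‖ ≤ B ^ 2 * ‖φ.toLp 2 volume‖ := by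
  refine Lp.norm_le_mul_norm_of_ae_le_mul ?_
  filter_upwards [coeFn_cube_toLp φ, SchwartzMap.coeFn_toLp φ 2 volume] with x h1 h2
  rw [h1, h2, norm_cubeFun]
  have := hB x
  have h0 := norm_nonneg (φ x)
  calc ‖φ x‖ ^ 3 = ‖φ x‖ ^ 2 * ‖φ x‖ := by ring
    _ ≤ _ := by gcongr

/-- Expanding around w leaves a term linear in the difference h, with one factor |w| placed in L^∞,
and a cubic term. Since h³ is dominated by h² plus h⁶ with weights in D, the cubic term needs only
the L² norm and the sixth power. -/
theorem norm_cubeFun_sub_le_of_le {z w : ℂ} {B D : ℝ} (hw : ‖w‖ ≤ B) (hD : 0 < D) :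
    ‖cubeFun z - cubeFun w‖ ≤ 9 / 2 * B * (‖w‖ * ‖z - w‖) +
      (3 * D * ‖z - w‖ ^ 2 + 3 * D⁻¹ ^ 3 * ‖z - w‖ ^ 6) := by
  have h1 := norm_cubeFun_sub_le z w
  set h := ‖z - w‖ with hh
  have hh0 : 0 ≤ h := norm_nonneg _
  have hw0 : 0 ≤ ‖w‖ := norm_nonneg _
  have h2 : ‖z‖ ≤ ‖w‖ + h := by
    have := norm_add_le w (z - w)
    rwa [add_sub_cancel] at this
  have h3 : ‖z‖ ^ 2 ≤ 2 * ‖w‖ ^ 2 + 2 * h ^ 2 := by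
    have : ‖z‖ ^ 2 ≤ (‖w‖ + h) ^ 2 := by gcongr
    nlinarith [sq_nonneg (‖w‖ - h)]
  have h4 : h ^ 3 ≤ D * h ^ 2 + D⁻¹ ^ 3 * h ^ 6 := by
    rcases le_total h D with hle | hle
    · have : h ^ 3 ≤ D * h ^ 2 := by
        calc h ^ 3 = h * h ^ 2 := by ring
          _ ≤ _ := by gcongr
      have : 0 ≤ D⁻¹ ^ 3 * h ^ 6 := by positivity
      linarith
    · have h5 : 1 ≤ D⁻¹ * h := by
        rw [inv_mul_eq_div, le_div_iff₀ hD]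
        linarith
      have h6 : h ^ 3 ≤ D⁻¹ ^ 3 * h ^ 6 := by
        calc h ^ 3 = 1 ^ 3 * h ^ 3 := by ring
          _ ≤ (D⁻¹ * h) ^ 3 * h ^ 3 := by gcongr
          _ = _ := by ring
      have : 0 ≤ D * h ^ 2 := by positivity
      linarith
  have h7 : ‖w‖ ^ 2 * h ≤ B * (‖w‖ * h) := by
    calc ‖w‖ ^ 2 * h = ‖w‖ * (‖w‖ * h) := by ring
      _ ≤ _ := by gcongr
  calc _ ≤ 3 / 2 * (‖z‖ ^ 2 + ‖w‖ ^ 2) * h := h1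
    _ ≤ 3 / 2 * (2 * ‖w‖ ^ 2 + 2 * h ^ 2 + ‖w‖ ^ 2) * h := by gcongr
    _ = 9 / 2 * (‖w‖ ^ 2 * h) + 3 * h ^ 3 := by ring
    _ ≤ _ := by linarith

theorem lintegral_enorm_mul_le (f g : L2) : ∫⁻ x, ‖f x‖ₑ * ‖g x‖ₑ ≤ ‖f‖ₑ * ‖g‖ₑ := by
  have h := ENNReal.lintegral_mul_le_Lp_mul_Lq volume Real.HolderConjugate.two_two
    (Lp.aestronglyMeasurable f).enorm (Lp.aestronglyMeasurable g).enorm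
  simp only [Pi.mul_apply, ENNReal.rpow_two, ← enorm_sq_eq_lintegral] at h
  have h2 : ∀ a : ℝ≥0∞, (a ^ 2) ^ (1 / 2 : ℝ) = a := fun a => by
    rw [← ENNReal.rpow_two, ← ENNReal.rpow_mul]
    norm_num
  rwa [h2, h2] at h

theorem enorm_inner_cube_sub_le {Ψ Φ : 𝓢(ℝ, ℂ)} {f : L2} (hf : HasCube f) {G B D : ℝ}
    (hG : ∀ x, ‖Ψ x‖ ≤ G) (hB : ∀ x, ‖Φ x‖ ≤ B) (hD : 0 < D) :
    ‖inner ℂ (Ψ.toLp 2) (cube f - cube (Φ.toLp 2))‖ₑ ≤ ENNReal.ofReal G *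
      (ENNReal.ofReal (9 / 2 * B) * (‖Φ.toLp 2 volume‖ₑ * ‖f - Φ.toLp 2 volume‖ₑ) +
        (ENNReal.ofReal (3 * D) * ‖f - Φ.toLp 2 volume‖ₑ ^ 2 +
          ENNReal.ofReal (3 * D⁻¹ ^ 3) * sixthPower (f - Φ.toLp 2 volume))) := by
  have hG0 : 0 ≤ G := (norm_nonneg _).trans (hG 0)
  have hB0 : 0 ≤ B := (norm_nonneg _).trans (hB 0)
  set h : L2 := f - Φ.toLp 2 volume with hh
  set Φ' : L2 := Φ.toLp 2 with hΦ'
  have hm : AEMeasurable (fun x => ‖h x‖ₑ) volume := (Lp.aestronglyMeasurable h).enorm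
  have hm' : AEMeasurable (fun x => ‖Φ' x‖ₑ) volume := (Lp.aestronglyMeasurable Φ').enorm
  rw [L2.inner_def]
  refine (enorm_integral_le_lintegral_enorm _).trans ?_
  calc _ ≤ ∫⁻ x, ENNReal.ofReal G * (ENNReal.ofReal (9 / 2 * B) * (‖Φ' x‖ₑ * ‖h x‖ₑ) +
        (ENNReal.ofReal (3 * D) * ‖h x‖ₑ ^ 2 + ENNReal.ofReal (3 * D⁻¹ ^ 3) * ‖h x‖ₑ ^ 6)) := by
        refine lintegral_mono_ae ?_
        filter_upwards [Lp.coeFn_sub (cube f) (cube Φ'), coeFn_cube hf, coeFn_cube_toLp Φ,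
          SchwartzMap.coeFn_toLp Φ 2 volume, SchwartzMap.coeFn_toLp Ψ 2 volume,
          Lp.coeFn_sub f Φ'] with x h1 h2 h3 h4 h5 h6
        have h7 := norm_cubeFun_sub_le_of_le (z := f x) (hB x) hD
        rw [← hΦ'] at h3 h4
        rw [h1, Pi.sub_apply, h2, h3, h5, h6, Pi.sub_apply, h4]
        simp only [← ofReal_norm]
        rw [← ENNReal.ofReal_mul (norm_nonneg _), ← ENNReal.ofReal_pow (norm_nonneg _),
          ← ENNReal.ofReal_pow (norm_nonneg _), ← ENNReal.ofReal_mul (by positivity),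
          ← ENNReal.ofReal_mul (by positivity), ← ENNReal.ofReal_mul (by positivity),
          ← ENNReal.ofReal_add (by positivity) (by positivity),
          ← ENNReal.ofReal_add (by positivity) (by positivity), ← ENNReal.ofReal_mul hG0]
        refine ENNReal.ofReal_le_ofReal ((norm_inner_le_norm _ _).trans ?_)
        gcongr
        exact hG x
    _ = ENNReal.ofReal G * (ENNReal.ofReal (9 / 2 * B) * (∫⁻ x, ‖Φ' x‖ₑ * ‖h x‖ₑ) +
        (ENNReal.ofReal (3 * D) * ‖h‖ₑ ^ 2 + ENNReal.ofReal (3 * D⁻¹ ^ 3) * sixthPower h)) := by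
        rw [lintegral_const_mul' _ _ ENNReal.ofReal_ne_top,
          lintegral_add_left' (by fun_prop), lintegral_add_left' (by fun_prop),
          lintegral_const_mul' _ _ ENNReal.ofReal_ne_top,
          lintegral_const_mul' _ _ ENNReal.ofReal_ne_top,
          lintegral_const_mul' _ _ ENNReal.ofReal_ne_top, ← enorm_sq_eq_lintegral, sixthPower]
    _ ≤ _ := by
        gcongr
        exact lintegral_enorm_mul_le Φ' h

theorem ae_restrict_add_ne_zero (α : ℝ) :
    ∀ᵐ σ ∂(volume.restrict (Icc (0 : ℝ) 1)), σ + α ≠ 0 := by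
  refine ae_restrict_of_ae ?_
  filter_upwards [(measure_singleton (-α) : volume {-α} = 0) |> compl_mem_ae_iff.2] with σ hσ h
  exact hσ (by rw [mem_singleton_iff]; linarith)

/-- Dispersive decay of `φ`: its free evolution at time `σ` is at most `M |σ|^{-p}`. -/
def HasDecay (φ : 𝓢(ℝ, ℂ)) (M p : ℝ) : Prop :=
  ∀ σ : ℝ, σ ≠ 0 → ∀ x, ‖freeEvolution σ φ x‖ ≤ M * |σ| ^ (-p)

/-- `K` bounds the integrals of `|σ|^{-p}` over unit intervals near the origin. -/
def IsDecayBound (p K : ℝ) : Prop :=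
  ∀ α : ℝ, |α| ≤ 1 → ∫⁻ σ in Icc (0 : ℝ) 1, ENNReal.ofReal (|σ + α| ^ (-p)) ≤ ENNReal.ofReal K

section Interaction

variable {φ : 𝓢(ℝ, ℂ)} {M p K A : ℝ}

/-- Two factors of the cube are placed in L^∞, costing M²|σ|^{-2p}, and the third in L². This is
much smaller than the Strichartz bound of order A³ for spread-out high-frequency data. -/
theorem norm_interactionField_toLp_le (hφ : HasDecay φ M p) (hK0 : 0 ≤ K)
    (hK : IsDecayBound (2 * p) K) (hA : ‖φ.toLp 2 volume‖ ≤ A) {γ τ : ℝ} (hτ : |γ * τ| ≤ 1) :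
    ‖interactionField γ τ (φ.toLp 2)‖ ≤ M ^ 2 * A * K := by
  have hA0 : 0 ≤ A := (norm_nonneg _).trans hA
  rw [interactionField, norm_schrodinger, nonlinearity,
    intervalIntegral.integral_of_le zero_le_one, ← integral_Icc_eq_integral_Ioc]
  have h := enorm_integral_le_lintegral_enorm (μ := volume.restrict (Icc (0 : ℝ) 1))
    (nonlinearityIntegrand (schrodinger (γ * τ) (φ.toLp 2)))
  have h2 : ∫⁻ σ in Icc (0 : ℝ) 1,
      ‖nonlinearityIntegrand (schrodinger (γ * τ) (φ.toLp 2)) σ‖ₑ ≤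
      ENNReal.ofReal (M ^ 2 * A * K) := by
    calc _ ≤ ∫⁻ σ in Icc (0 : ℝ) 1, ENNReal.ofReal (M ^ 2 * A) *
          ENNReal.ofReal (|σ + γ * τ| ^ (-(2 * p))) := by
          refine lintegral_mono_ae ?_
          filter_upwards [ae_restrict_add_ne_zero (γ * τ)] with σ hσ
          rw [nonlinearityIntegrand, ← ofReal_norm, norm_schrodinger, schrodinger_schrodinger,
            schrodinger_toLp, ← ENNReal.ofReal_mul (by positivity)]
          refine ENNReal.ofReal_le_ofReal ((norm_cube_toLp_le (hφ _ hσ)).trans ?_)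
          rw [← schrodinger_toLp, norm_schrodinger, mul_pow, ← Real.rpow_natCast (_ ^ (-p)),
            ← Real.rpow_mul (abs_nonneg _)]
          have h3 : -p * ((2 : ℕ) : ℝ) = -(2 * p) := by push_cast; ring
          rw [h3]
          calc _ ≤ M ^ 2 * |σ + γ * τ| ^ (-(2 * p)) * A := by gcongr
            _ = _ := by ring
      _ ≤ ENNReal.ofReal (M ^ 2 * A) * ENNReal.ofReal K := by
          rw [lintegral_const_mul' _ _ ENNReal.ofReal_ne_top]
          gcongr
          exact hK _ hτ
      _ = _ := (ENNReal.ofReal_mul (by positivity)).symm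
  have h3 := h.trans h2
  rw [← ofReal_norm] at h3
  exact (ENNReal.ofReal_le_ofReal_iff (by positivity)).1 h3

/-- Conjugation by the free flow merely shifts the σ window from [0,1] to [γτ, 1+γτ]. -/
theorem inner_interactionField (γ τ : ℝ) (g f : L2) :
    inner ℂ g (interactionField γ τ f) = ∫ σ in (0 : ℝ)..1,
      inner ℂ (schrodinger (σ + γ * τ) g) (cube (schrodinger (σ + γ * τ) f)) := by
  rw [interactionField, inner_schrodinger_right, neg_neg, inner_nonlinearity]
  simp only [schrodinger_schrodinger]

theorem intervalIntegrable_inner_cube_add (g f : L2) (α : ℝ) :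
    IntervalIntegrable (fun σ => inner ℂ (schrodinger (σ + α) g) (cube (schrodinger (σ + α) f)))
      volume 0 1 := by
  have h0 := intervalIntegrable_nonlinearityIntegrand (schrodinger α f)
  have h : IntervalIntegrable (fun σ => innerSL ℂ (schrodinger α g)
      (nonlinearityIntegrand (schrodinger α f) σ)) volume 0 1 :=
    ⟨(innerSL ℂ (schrodinger α g)).integrable_comp h0.1,
      (innerSL ℂ (schrodinger α g)).integrable_comp h0.2⟩
  refine h.congr fun σ _ => ?_
  simp only [innerSL_apply_apply, nonlinearityIntegrand]
  rw [inner_schrodinger_right, neg_neg, schrodinger_schrodinger, schrodinger_schrodinger]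

theorem norm_inner_interactionField_sub_le {ψ : 𝓢(ℝ, ℂ)} {G : ℝ}
    (hψ : ∀ σ x, ‖freeEvolution σ ψ x‖ ≤ G) (hφ : HasDecay φ M p) (hM : 0 ≤ M) (hK0 : 0 ≤ K)
    (hK : IsDecayBound p K) (hA : ‖φ.toLp 2 volume‖ ≤ A) {f : L2} {H : ℝ} (hH : 0 < H)
    (hf : ‖f - φ.toLp 2 volume‖ ≤ H) {γ τ : ℝ} (hτ : |γ * τ| ≤ 1) :
    ‖inner ℂ (ψ.toLp 2) (interactionField γ τ f - interactionField γ τ (φ.toLp 2))‖ ≤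
      G * (9 / 2 * M * (A * H) * K + 3 * (1 + strichartzConst) * H ^ 3) := by
  have hS := strichartzConst_pos
  have hA0 : 0 ≤ A := (norm_nonneg _).trans hA
  have hG0 : 0 ≤ G := (norm_nonneg _).trans (hψ 0 0)
  set α := γ * τ with hα
  have hf' : ‖f - φ.toLp 2 volume‖ₑ ≤ ENNReal.ofReal H := by
    rw [← ofReal_norm]
    exact ENNReal.ofReal_le_ofReal hf
  have hA' : ‖φ.toLp 2 volume‖ₑ ≤ ENNReal.ofReal A := by
    rw [← ofReal_norm]
    exact ENNReal.ofReal_le_ofReal hA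
  rw [inner_sub_right, inner_interactionField, inner_interactionField,
    ← intervalIntegral.integral_sub (intervalIntegrable_inner_cube_add _ _ _)
      (intervalIntegrable_inner_cube_add _ _ _),
    intervalIntegral.integral_of_le zero_le_one, ← integral_Icc_eq_integral_Ioc, ← hα]
  have h := enorm_integral_le_lintegral_enorm (μ := volume.restrict (Icc (0 : ℝ) 1))
    fun σ => inner ℂ (schrodinger (σ + α) (ψ.toLp 2)) (cube (schrodinger (σ + α) f)) -
      inner ℂ (schrodinger (σ + α) (ψ.toLp 2)) (cube (schrodinger (σ + α) (φ.toLp 2)))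
  have hmeas : Measurable fun σ => ENNReal.ofReal (9 / 2 * (M * |σ + α| ^ (-p))) := by fun_prop
  have hstr : ∫⁻ σ in Icc (0 : ℝ) 1, sixthPower (schrodinger (σ + α) (f - φ.toLp 2 volume)) ≤
      ENNReal.ofReal (strichartzConst * H ^ 6) := by
    have h1 := lintegral_sixthPower_le (schrodinger α (f - φ.toLp 2 volume))
    simp only [schrodinger_schrodinger] at h1
    refine h1.trans ?_
    rw [ENNReal.ofReal_mul hS.le, ENNReal.ofReal_pow hH.le, ← ofReal_norm, norm_schrodinger,
      ofReal_norm]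
    gcongr
  have h2 : ∫⁻ σ in Icc (0 : ℝ) 1,
      ‖inner ℂ (schrodinger (σ + α) (ψ.toLp 2)) (cube (schrodinger (σ + α) f)) -
        inner ℂ (schrodinger (σ + α) (ψ.toLp 2)) (cube (schrodinger (σ + α) (φ.toLp 2)))‖ₑ ≤
      ENNReal.ofReal (G * (9 / 2 * M * (A * H) * K + 3 * (1 + strichartzConst) * H ^ 3)) := by
    calc _ ≤ ∫⁻ σ in Icc (0 : ℝ) 1, ENNReal.ofReal G *
          (ENNReal.ofReal (9 / 2 * M * (A * H)) * ENNReal.ofReal (|σ + α| ^ (-p)) +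
            (ENNReal.ofReal (3 * H ^ 3) + ENNReal.ofReal (3 * H⁻¹ ^ 3) *
              sixthPower (schrodinger (σ + α) (f - φ.toLp 2 volume)))) := by
          refine lintegral_mono_ae ?_
          have hc := ae_hasCube (schrodinger α f)
          filter_upwards [ae_restrict_add_ne_zero α, hc] with σ hσ hcσ
          rw [schrodinger_schrodinger] at hcσ
          -- The splitting parameter D is taken to be H, so that the L² and Strichartz parts of the
          -- cubic term both have size H³.
          have h3 := enorm_inner_cube_sub_le (Ψ := freeEvolution (σ + α) ψ)
            (Φ := freeEvolution (σ + α) φ) hcσ (hψ (σ + α)) (hφ _ hσ) hH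
          simp only [← schrodinger_toLp] at h3
          rw [← schrodinger_sub, inner_sub_right] at h3
          refine h3.trans ?_
          have h4 : ∀ g : L2, ‖schrodinger (σ + α) g‖ₑ = ‖g‖ₑ := fun g => by
            rw [← ofReal_norm, norm_schrodinger, ofReal_norm]
          rw [h4, h4]
          gcongr ENNReal.ofReal G * (?_ + (?_ + _))
          · calc _ ≤ ENNReal.ofReal (9 / 2 * (M * |σ + α| ^ (-p))) *
                  (ENNReal.ofReal A * ENNReal.ofReal H) := by gcongr
              _ = _ := by
                rw [← ENNReal.ofReal_mul hA0, ← ENNReal.ofReal_mul (by positivity),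
                  ← ENNReal.ofReal_mul (by positivity)]
                congr 1
                ring
          · calc _ ≤ ENNReal.ofReal (3 * H) * ENNReal.ofReal H ^ 2 := by gcongr
              _ = _ := by
                rw [← ENNReal.ofReal_pow hH.le, ← ENNReal.ofReal_mul (by positivity)]
                congr 1
                ring
      _ ≤ ENNReal.ofReal G * (ENNReal.ofReal (9 / 2 * M * (A * H)) * ENNReal.ofReal K +
            (ENNReal.ofReal (3 * H ^ 3) + ENNReal.ofReal (3 * H⁻¹ ^ 3) *
              ENNReal.ofReal (strichartzConst * H ^ 6))) := by
          rw [lintegral_const_mul' _ _ ENNReal.ofReal_ne_top,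
            lintegral_add_left (by fun_prop), lintegral_add_left (by fun_prop),
            lintegral_const_mul' _ _ ENNReal.ofReal_ne_top,
            lintegral_const_mul' _ _ ENNReal.ofReal_ne_top]
          have h5 : ∫⁻ _ in Icc (0 : ℝ) 1, ENNReal.ofReal (3 * H ^ 3) = ENNReal.ofReal (3 * H ^ 3) := by
            simp
          rw [h5]
          gcongr
          exact hK _ hτ
      _ = _ := by
          rw [← ENNReal.ofReal_mul (by positivity), ← ENNReal.ofReal_mul (by positivity),
            ← ENNReal.ofReal_add (by positivity) (by positivity),
            ← ENNReal.ofReal_add (by positivity) (by positivity), ← ENNReal.ofReal_mul hG0]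
          congr 1
          field_simp
  have h3 := h.trans h2
  rw [← ofReal_norm] at h3
  exact (ENNReal.ofReal_le_ofReal_iff (by positivity)).1 h3

/-- The shifted and unshifted σ windows differ by two intervals of length |γτ|, on which the
integrand is bounded crudely. The loss of powers of N in Q is affordable because |γτ| is very small.
-/
theorem norm_inner_interactionField_sub_integral_le {ψ : 𝓢(ℝ, ℂ)} {Q : ℝ}
    (hQ : ∀ σ x, ‖freeEvolution σ φ x‖ ≤ Q) (hA : ‖φ.toLp 2 volume‖ ≤ A) {γ τ : ℝ}
    (hτ : |γ * τ| ≤ 1) :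
    ‖inner ℂ (ψ.toLp 2) (interactionField γ τ (φ.toLp 2)) - ∫ σ in (0 : ℝ)..1,
      inner ℂ (schrodinger σ (ψ.toLp 2)) (cube (schrodinger σ (φ.toLp 2)))‖ ≤
      2 * |γ * τ| * (‖ψ.toLp 2 volume‖ * (Q ^ 2 * A)) := by
  set α := γ * τ with hα
  set q : ℝ → ℂ := fun σ =>
    inner ℂ (schrodinger σ (ψ.toLp 2)) (cube (schrodinger σ (φ.toLp 2))) with hq
  have hbound : ∀ σ, ‖q σ‖ ≤ ‖ψ.toLp 2 volume‖ * (Q ^ 2 * A) := by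
    intro σ
    refine (norm_inner_le_norm _ _).trans ?_
    rw [norm_schrodinger, schrodinger_toLp]
    have h1 := norm_cube_toLp_le (hQ σ)
    rw [← schrodinger_toLp, norm_schrodinger] at h1
    rw [← schrodinger_toLp]
    have : 0 ≤ Q ^ 2 := sq_nonneg Q
    gcongr
    exact h1.trans (by gcongr)
  have hint1 : ∀ β : ℝ, IntervalIntegrable q volume β (1 + β) := by
    intro β
    have h := (intervalIntegrable_inner_cube_add (ψ.toLp 2) (φ.toLp 2) β).comp_sub_right β
    simpa [hq] using h
  have hint : IntervalIntegrable q volume (-1) 2 := by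
    have h1 := hint1 (-1)
    have h2 := hint1 0
    have h3 := hint1 1
    norm_num at h1 h2 h3
    exact (h1.trans h2).trans h3
  rw [abs_le] at hτ
  have hsub : ∀ {a b : ℝ}, a ∈ Icc (-1 : ℝ) 2 → b ∈ Icc (-1 : ℝ) 2 →
      IntervalIntegrable q volume a b := fun ha hb =>
    hint.mono_set ((uIcc_subset_Icc ha hb).trans Icc_subset_uIcc)
  have h0 : (0 : ℝ) ∈ Icc (-1 : ℝ) 2 := by constructor <;> norm_num
  have h1 : (1 : ℝ) ∈ Icc (-1 : ℝ) 2 := by constructor <;> norm_num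
  have hα1 : α ∈ Icc (-1 : ℝ) 2 := ⟨hτ.1, by linarith⟩
  have hα2 : 1 + α ∈ Icc (-1 : ℝ) 2 := ⟨by linarith, by linarith⟩
  rw [inner_interactionField, intervalIntegral.integral_comp_add_right q, zero_add,
    intervalIntegral.integral_interval_sub_interval_comm (hsub hα1 hα2) (hsub h0 h1) (hsub hα1 h0)]
  refine (norm_sub_le _ _).trans ?_
  have e1 := intervalIntegral.norm_integral_le_of_norm_le_const (a := α) (b := 0)
    (fun σ _ => hbound σ)
  have e2 := intervalIntegral.norm_integral_le_of_norm_le_const (a := 1 + α) (b := 1)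
    (fun σ _ => hbound σ)
  rw [zero_sub, abs_neg] at e1
  rw [sub_add_cancel_left, abs_neg] at e2
  linarith

/-- Let m be the maximal drift on [0,t]. Mass conservation keeps the Lipschitz constant at
`nonlinearityConst` * A², so m ≤ t(F + `nonlinearityConst` * A² m), and the last term is absorbed.
-/
theorem IsSolution.norm_interaction_sub_le {γ T t A F : ℝ} {u₀ : L2} {u : ℝ → L2}
    (hu : IsSolution γ T u₀ u) (ht0 : 0 ≤ t) (ht : t < T) (hA0 : 0 < A) (hA : ‖u₀‖ ≤ A)
    (hF : ∀ τ ∈ Icc 0 t, ‖interactionField γ τ u₀‖ ≤ F)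
    (htA : t * (nonlinearityConst * A ^ 2) ≤ 1 / 2) {τ : ℝ} (hτ : τ ∈ Icc 0 t) :
    ‖schrodinger (-(γ * τ)) (u τ) - u₀‖ ≤ 2 * t * F := by
  have hC := nonlinearityConst_pos
  have hsub : Icc 0 t ⊆ Ioo (-T) T := fun x hx => ⟨by linarith [hx.1], hx.2.trans_lt ht⟩
  set w : ℝ → L2 := fun τ => schrodinger (-(γ * τ)) (u τ) with hw
  have hcont : ContinuousOn (fun τ => ‖w τ - u₀‖) (Icc 0 t) :=
    ((hu.continuousOn_interaction.mono hsub).sub continuousOn_const).norm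
  obtain ⟨τ₀, hτ₀, hmax⟩ := isCompact_Icc.exists_isMaxOn (nonempty_Icc.2 ht0) hcont
  set m := ‖w τ₀ - u₀‖ with hm
  have hm0 : 0 ≤ m := norm_nonneg _
  have hbd : ∀ τ' ∈ Icc 0 t, ‖interactionField γ τ' (w τ')‖ ≤
      F + nonlinearityConst * A ^ 2 * m := by
    intro τ' hτ'
    have h1 := norm_interactionField_sub_le γ τ' hA0 (f := w τ') (g := u₀)
      (by rw [hw]; simp only [norm_schrodinger]; rw [hu.norm_eq (hsub hτ')]; exact hA) hA
    have h2 : ‖w τ' - u₀‖ ≤ m := hmax hτ'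
    calc _ = ‖interactionField γ τ' u₀ +
          (interactionField γ τ' (w τ') - interactionField γ τ' u₀)‖ := by rw [add_sub_cancel]
      _ ≤ F + nonlinearityConst * A ^ 2 * ‖w τ' - u₀‖ :=
          (norm_add_le _ _).trans (add_le_add (hF τ' hτ') h1)
      _ ≤ _ := by gcongr
  have h3 : m ≤ (F + nonlinearityConst * A ^ 2 * m) * τ₀ := by
    have h4 : w τ₀ - u₀ = Complex.I • ∫ τ in (0 : ℝ)..τ₀, interactionField γ τ (w τ) := by
      rw [hw]
      simp only
      rw [hu.interaction_eq (hsub hτ₀), add_sub_cancel_left]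
    have h4' : m = ‖∫ τ in (0 : ℝ)..τ₀, interactionField γ τ (w τ)‖ := by
      rw [hm, h4, norm_smul, Complex.norm_I, one_mul]
    refine h4'.trans_le ?_
    have h5 := intervalIntegral.norm_integral_le_of_norm_le_const (a := 0) (b := τ₀)
      (f := fun τ => interactionField γ τ (w τ)) (C := F + nonlinearityConst * A ^ 2 * m)
      (fun x hx => by
        rw [uIoc_of_le hτ₀.1] at hx
        exact hbd x ⟨hx.1.le, hx.2.trans hτ₀.2⟩)
    rwa [sub_zero, abs_of_nonneg hτ₀.1] at h5
  have hF0 : 0 ≤ F := (norm_nonneg _).trans (hF τ₀ hτ₀)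
  have h6 : m ≤ (F + nonlinearityConst * A ^ 2 * m) * t :=
    h3.trans (mul_le_mul_of_nonneg_left hτ₀.2 (by positivity))
  have h7 : t * (nonlinearityConst * A ^ 2) * m ≤ 1 / 2 * m := by gcongr
  have h8 : ‖w τ - u₀‖ ≤ m := hmax hτ
  refine h8.trans ?_
  linarith

end Interaction

/-! ### Norm inflation -/

theorem IsTestFunction.im_integral_inner_cube_ge {ψ φ : 𝓢(ℝ, ℂ)} (hψ : IsTestFunction ψ) {N l : ℝ}
    (hφ : IsDatum N l φ) (hN : 4 ≤ N) (hl : 0 < l) :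
    l ^ 3 / (1024 * Real.pi ^ 2) ≤ (∫ σ in (0 : ℝ)..1,
      inner ℂ (schrodinger σ (ψ.toLp 2)) (cube (schrodinger σ (φ.toLp 2)))).im := by
  have hN0 : 0 < N := by linarith
  have h := intervalIntegral_im_inner_ge (κ := lowBump) (a := fun ζ => l * highBump (ζ / N))
    lowBump.continuous (continuous_const.mul (highBump.continuous.comp (continuous_id.div_const N)))
    hN hl (fun _ => lowBump.nonneg) (fun _ => mul_nonneg hl.le highBump.nonneg)
    (fun _ hx => lowBump_eq_zero hx) (fun _ hx => datumSymbol_eq_zero hN0 hx)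
    (fun _ hx => lowBump_eq_one hx)
    (fun x hx => by
      rw [highBump_eq_one, mul_one]
      refine ⟨?_, ?_⟩
      · rw [le_div_iff₀ hN0]
        linarith [hx.1]
      · rw [div_le_iff₀ hN0]
        exact hx.2) hψ hφ
  have h2 := intervalIntegrable_inner_cube_add (ψ.toLp 2) (φ.toLp 2) 0
  simp only [add_zero] at h2
  have h3 := Complex.imCLM.intervalIntegral_comp_comm h2
  simp only [Complex.imCLM_apply] at h3
  rwa [h3] at h

theorem norm_inner_interactionField_sub_quartic_le {γ τ t M p K A G Q H F d : ℝ}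
    {g ψ φ : 𝓢(ℝ, ℂ)} (hg : ∀ σ x, ‖freeEvolution σ g x‖ ≤ G)
    (hgψ : ‖g.toLp 2 volume - ψ.toLp 2 volume‖ ≤ d) (hQ : ∀ σ x, ‖freeEvolution σ φ x‖ ≤ Q)
    (hφ : HasDecay φ M p) (hM : 0 ≤ M) (hK0 : 0 ≤ K) (hK : IsDecayBound p K)
    (hA : ‖φ.toLp 2 volume‖ ≤ A) {f : L2} (hH : 0 < H) (hf : ‖f - φ.toLp 2 volume‖ ≤ H)
    (hF : ‖interactionField γ τ (φ.toLp 2)‖ ≤ F) (hτ : |γ * τ| ≤ t) (ht : t ≤ 1) :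
    ‖inner ℂ (g.toLp 2) (interactionField γ τ f) - ∫ σ in (0 : ℝ)..1,
      inner ℂ (schrodinger σ (ψ.toLp 2)) (cube (schrodinger σ (φ.toLp 2)))‖ ≤
      G * (9 / 2 * M * (A * H) * K + 3 * (1 + strichartzConst) * H ^ 3) + d * F +
        2 * t * (‖ψ.toLp 2 volume‖ * (Q ^ 2 * A)) := by
  have hA0 : 0 ≤ A := (norm_nonneg _).trans hA
  have hτ1 := hτ.trans ht
  have e1 := norm_inner_interactionField_sub_le hg hφ hM hK0 hK hA hH hf hτ1
  have e3 := norm_inner_interactionField_sub_integral_le (ψ := ψ) hQ hA hτ1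
  generalize (∫ σ in (0 : ℝ)..1,
      inner ℂ (schrodinger σ (ψ.toLp 2)) (cube (schrodinger σ (φ.toLp 2)))) = Z at e3 ⊢
  have e3' : 2 * |γ * τ| * (‖ψ.toLp 2 volume‖ * (Q ^ 2 * A)) ≤
      2 * t * (‖ψ.toLp 2 volume‖ * (Q ^ 2 * A)) := by
    gcongr
  generalize interactionField γ τ f = a at e1 ⊢
  generalize interactionField γ τ (φ.toLp 2) = b at e1 e3 hF
  generalize (g.toLp 2 volume) = g' at e1 hgψ ⊢
  generalize (ψ.toLp 2 volume) = ψ' at e3 e3' hgψ ⊢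
  have e2 : ‖inner ℂ (g' - ψ') b‖ ≤ d * F :=
    (norm_inner_le_norm _ _).trans
      (mul_le_mul hgψ hF (norm_nonneg _) ((norm_nonneg _).trans hgψ))
  -- Three separate errors: drift of the solution, motion of the test function, and shift of the σ
  -- window.
  have e : inner ℂ g' a - Z = inner ℂ g' (a - b) + inner ℂ (g' - ψ') b + (inner ℂ ψ' b - Z) := by
    rw [inner_sub_left, inner_sub_right]
    ring
  rw [e]
  exact norm_add₃_le.trans (add_le_add (add_le_add e1 e2) (e3.trans e3'))

theorem IsSolution.inner_eq {γ T t : ℝ} {u₀ g : L2} {u : ℝ → L2} (hu : IsSolution γ T u₀ u)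
    (ht : t ∈ Ioo (-T) T) :
    inner ℂ g (u t) = inner ℂ (schrodinger (-(γ * t)) g) u₀ + Complex.I * ∫ τ in (0 : ℝ)..t,
      inner ℂ (schrodinger (-(γ * t)) g)
        (interactionField γ τ (schrodinger (-(γ * τ)) (u τ))) := by
  have hint := intervalIntegrable_interactionField (γ := γ) hu.continuousOn_interaction ht
  have h1 : u t = schrodinger (γ * t) (schrodinger (-(γ * t)) (u t)) := by
    rw [schrodinger_schrodinger, add_neg_cancel, schrodinger_zero_left]
  have h2 := (innerSL ℂ (schrodinger (-(γ * t)) g)).intervalIntegral_comp_comm hint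
  simp only [innerSL_apply_apply] at h2
  rw [h1, inner_schrodinger_right, hu.interaction_eq ht, inner_add_right, inner_smul_right, ← h2]

theorem norm_integral_ge_of_norm_sub_le {t E c : ℝ} {f : ℝ → ℂ} {Z : ℂ} (ht : 0 ≤ t)
    (hf : IntervalIntegrable f volume 0 t) (hE : ∀ τ ∈ Icc 0 t, ‖f τ - Z‖ ≤ E) (hc : c ≤ Z.im) :
    t * (c - E) ≤ ‖∫ τ in (0 : ℝ)..t, f τ‖ := by
  have h1 : ‖(∫ τ in (0 : ℝ)..t, f τ) - t * Z‖ ≤ E * t := by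
    have h1 : (t : ℂ) * Z = ∫ _ in (0 : ℝ)..t, Z := by
      rw [intervalIntegral.integral_const, sub_zero, Complex.real_smul]
    rw [h1, ← intervalIntegral.integral_sub hf intervalIntegrable_const]
    have h2 := intervalIntegral.norm_integral_le_of_norm_le_const (a := 0) (b := t)
      (f := fun τ => f τ - Z) (C := E) fun τ hτ => by
        rw [uIoc_of_le ht] at hτ
        exact hE τ ⟨hτ.1.le, hτ.2⟩
    rwa [sub_zero, abs_of_nonneg ht] at h2
  have h3 : t * c ≤ ‖(t : ℂ) * Z‖ := by
    rw [norm_mul, Complex.norm_real, Real.norm_of_nonneg ht]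
    gcongr
    exact hc.trans ((le_abs_self _).trans (Complex.abs_im_le_norm Z))
  have h4 := norm_sub_norm_le ((t : ℂ) * Z) (∫ τ in (0 : ℝ)..t, f τ)
  rw [norm_sub_rev] at h4
  linarith

/-- The low-frequency part of a solution with high-frequency data is driven by the resonant quartic
form. -/
theorem IsSolution.norm_inner_testFunction_ge {γ T t N l M p K A : ℝ} {ψ φ : 𝓢(ℝ, ℂ)} {u : ℝ → L2}
    (hu : IsSolution γ T (φ.toLp 2) u) (hψ : IsTestFunction ψ) (hφ : IsDatum N l φ)
    (hN : 4 ≤ N) (hl : 0 < l) (ht0 : 0 < t) (ht : t < T) (hγt : |γ| * t ≤ 1)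
    (hd : HasDecay φ M p) (hM : 0 < M) (hK0 : 0 < K) (hK1 : IsDecayBound p K)
    (hK2 : IsDecayBound (2 * p) K) (hA0 : 0 < A) (hA : ‖φ.toLp 2 volume‖ ≤ A)
    (htA : t * (nonlinearityConst * A ^ 2) ≤ 1 / 2) :
    t * (l ^ 3 / (1024 * Real.pi ^ 2) -
      (2 * (9 / 2 * M * (A * (2 * t * (M ^ 2 * A * K))) * K +
          3 * (1 + strichartzConst) * (2 * t * (M ^ 2 * A * K)) ^ 3) +
        4 * Real.pi ^ 2 * (|γ| * t) * ‖ψ.toLp 2 volume‖ * (M ^ 2 * A * K) +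
        2 * (|γ| * t) * (‖ψ.toLp 2 volume‖ * ((4 * N * l) ^ 2 * A)))) ≤
      ‖inner ℂ (ψ.toLp 2) (u t)‖ := by
  have hN0 : 0 < N := by linarith
  have hH0 : 0 < 2 * t * (M ^ 2 * A * K) := by positivity
  have htT : t ∈ Ioo (-T) T := ⟨by linarith, ht⟩
  have hτle : ∀ τ ∈ Icc 0 t, |γ * τ| ≤ |γ| * t := fun τ hτ => by
    rw [abs_mul, abs_of_nonneg hτ.1]
    exact mul_le_mul_of_nonneg_left hτ.2 (abs_nonneg _)
  have hFb : ∀ τ ∈ Icc 0 t, ‖interactionField γ τ (φ.toLp 2)‖ ≤ M ^ 2 * A * K := fun τ hτ =>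
    norm_interactionField_toLp_le hd hK0.le hK2 hA ((hτle τ hτ).trans hγt)
  have hwb := fun τ (hτ : τ ∈ Icc 0 t) =>
    hu.norm_interaction_sub_le ht0.le ht hA0 hA hFb htA hτ
  -- The free flow does not change |ψ̂|, whose integral is at most 2.
  have hgb : ∀ σ x, ‖freeEvolution σ (freeEvolution (-(γ * t)) ψ) x‖ ≤ 2 := by
    intro σ x
    refine (norm_freeEvolution_le_integral_fourier σ _ x).trans ?_
    simp only [fourier_freeEvolution, norm_mul, norm_schrodingerSymbol, one_mul]
    exact hψ.integral_norm_fourier_le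
  have hQ : ∀ σ x, ‖freeEvolution σ φ x‖ ≤ 4 * N * l := fun σ x =>
    (norm_freeEvolution_le_integral_fourier σ φ x).trans
      (hφ.integral_norm_fourier_le hN0 hl.le)
  have hgsub := hψ.norm_schrodinger_sub_le (-(γ * t))
  rw [abs_neg, abs_mul, abs_of_pos ht0, schrodinger_toLp] at hgsub
  have hdiff := fun τ (hτ : τ ∈ Icc 0 t) => norm_inner_interactionField_sub_quartic_le hgb hgsub
    hQ hd hM.le hK0.le hK1 hA hH0 (hwb τ hτ) (hFb τ hτ) (hτle τ hτ) hγt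
  have hint0 := intervalIntegrable_interactionField (γ := γ) hu.continuousOn_interaction htT
  rw [hu.inner_eq htT, hψ.inner_schrodinger_datum hN hφ, zero_add, norm_mul, Complex.norm_I,
    one_mul, schrodinger_toLp]
  refine norm_integral_ge_of_norm_sub_le ht0.le
    ⟨(innerSL ℂ ((freeEvolution (-(γ * t)) ψ).toLp 2 volume)).integrable_comp hint0.1,
      (innerSL ℂ ((freeEvolution (-(γ * t)) ψ).toLp 2 volume)).integrable_comp hint0.2⟩
    hdiff (hψ.im_integral_inner_cube_ge hφ hN hl)

/-- Bookkeeping with n = N^k, r = N^{1/2}, M = C l n and A = 2 l r: every error is l³ times a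
constant times n⁻¹. The drift bound equals 4C²K l z with z = t l² n² r, and the normalisation `h1`
says n² r z = 1. -/
theorem error_le {C K S P G t l n r N : ℝ} (hC : 0 ≤ C) (hK : 0 ≤ K) (hS : 0 ≤ S) (hP : 0 ≤ P)
    (hG : 0 ≤ G) (ht : 0 ≤ t) (hl : 0 ≤ l) (hn : 1 ≤ n) (hr : 1 ≤ r) (hN : r ^ 2 = N)
    (h1 : t * l ^ 2 * n ^ 4 * r ^ 2 = 1) (h2 : t * n ^ 3 * r ≤ 1) (h3 : t * r ^ 5 * n ≤ 1) :
    2 * (9 / 2 * (C * l * n) * (2 * l * r * (2 * t * ((C * l * n) ^ 2 * (2 * l * r) * K))) * K +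
          3 * (1 + S) * (2 * t * ((C * l * n) ^ 2 * (2 * l * r) * K)) ^ 3) +
        4 * Real.pi ^ 2 * (G * t) * P * ((C * l * n) ^ 2 * (2 * l * r) * K) +
        2 * (G * t) * (P * ((4 * N * l) ^ 2 * (2 * l * r))) ≤
      (2 * (36 * C ^ 3 * K ^ 2 + 3 * (1 + S) * (4 * C ^ 2 * K) ^ 3) +
        8 * Real.pi ^ 2 * G * P * C ^ 2 * K + 64 * G * P) * l ^ 3 * n⁻¹ := by
  have hn0 : 0 < n := by linarith
  have hr0 : 0 < r := by linarith
  set z := t * l ^ 2 * n ^ 2 * r with hz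
  have hz0 : 0 ≤ z := by positivity
  have e1 : n * r * z = n⁻¹ := by
    refine eq_inv_of_mul_eq_one_left ?_
    rw [hz, ← h1]
    ring
  have hzn : z ≤ n⁻¹ := by
    rw [← e1]
    exact le_mul_of_one_le_left hz0 (one_le_mul_of_one_le_of_one_le hn hr)
  have hn1 : n⁻¹ ≤ 1 := inv_le_one_of_one_le₀ hn
  have hz3 : z ^ 3 ≤ n⁻¹ := by
    calc z ^ 3 = z ^ 2 * z := by ring
      _ ≤ 1 ^ 2 * n⁻¹ := by gcongr; exact hzn.trans hn1
      _ = n⁻¹ := by ring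
  have e2 : t * n ^ 2 * r ≤ n⁻¹ := by
    rw [inv_eq_one_div, le_div_iff₀ hn0]
    linarith
  have e3 : t * r ^ 5 ≤ n⁻¹ := by
    rw [inv_eq_one_div, le_div_iff₀ hn0]
    linarith
  calc _ = 2 * (36 * C ^ 3 * K ^ 2 * l ^ 3 * (n * r * z) +
          3 * (1 + S) * (4 * C ^ 2 * K) ^ 3 * l ^ 3 * z ^ 3) +
        8 * Real.pi ^ 2 * G * P * C ^ 2 * K * l ^ 3 * (t * n ^ 2 * r) +
        64 * G * P * l ^ 3 * (t * r ^ 5) := by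
        rw [hz, ← hN]
        ring
    _ ≤ 2 * (36 * C ^ 3 * K ^ 2 * l ^ 3 * n⁻¹ +
          3 * (1 + S) * (4 * C ^ 2 * K) ^ 3 * l ^ 3 * n⁻¹) +
        8 * Real.pi ^ 2 * G * P * C ^ 2 * K * l ^ 3 * n⁻¹ + 64 * G * P * l ^ 3 * n⁻¹ := by
        rw [e1]
        gcongr
    _ = _ := by ring

theorem exists_decayBound {k : ℝ} (hk0 : 0 < k) :
    ∃ K : ℝ, 0 < K ∧ IsDecayBound ((1 - k) / 2) K ∧ IsDecayBound (2 * ((1 - k) / 2)) K := by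
  obtain ⟨K₁, h1, h1'⟩ := exists_setLIntegral_abs_rpow_le (p := (1 - k) / 2) (by linarith)
  obtain ⟨K₂, h2, h2'⟩ := exists_setLIntegral_abs_rpow_le (p := 2 * ((1 - k) / 2)) (by linarith)
  exact ⟨K₁ + K₂, by positivity,
    fun α hα => (h1' α hα).trans (ENNReal.ofReal_le_ofReal (by linarith)),
    fun α hα => (h2' α hα).trans (ENNReal.ofReal_le_ofReal (by linarith))⟩

/-- Quantitative inflation at frequency `N`, in terms of the large parameter `n = N ^ k`. -/
theorem exists_inflation_at_frequency (γ : ℝ) {s : ℝ} (hs : s < -3 / 2) :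
    ∃ k c C : ℝ, 0 < k ∧ 0 < c ∧ 0 < C ∧ ∀ T N : ℝ, 4 ≤ N → C * (N ^ k)⁻¹ ≤ 1 → (N ^ k)⁻¹ < T →
      ∃ (φ : 𝓢(ℝ, ℂ)) (t : ℝ), 0 < t ∧ t ≤ (N ^ k)⁻¹ ∧
        sobolevNorm s (φ.toLp 2) ≤ ENNReal.ofReal (2 * (N ^ k)⁻¹) ∧
        ∀ u, IsSolution γ T (φ.toLp 2) u → ENNReal.ofReal (c * N ^ k) ≤ sobolevNorm s (u t) := by
  -- A positive k satisfying the last inequality exists precisely when s < -3/2; that inequality is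
  -- equivalent to -s - 3/2 - 5k ≥ k, the growth exponent.
  obtain ⟨k, hk0, hk1, hks⟩ : ∃ k : ℝ, 0 < k ∧ k ≤ 1 / 2 ∧ 6 * k ≤ -s - 3 / 2 :=
    ⟨min (1 / 2) ((-s - 3 / 2) / 6), lt_min (by norm_num) (by linarith), min_le_left _ _, by
      have := min_le_right (1 / 2) ((-s - 3 / 2) / 6)
      linarith⟩
  obtain ⟨ψ, hψ⟩ := exists_isTestFunction
  obtain ⟨C, hC0, hC⟩ := exists_norm_freeEvolution_datum_le
  obtain ⟨K, hK0, hK1, hK2⟩ := exists_decayBound hk0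
  have hS := strichartzConst_pos
  have hΛ := nonlinearityConst_pos
  have hpi := Real.pi_pos
  set P := ‖ψ.toLp 2 volume‖ with hP
  have hP0 : 0 ≤ P := norm_nonneg _
  set D := 2 * (36 * C ^ 3 * K ^ 2 + 3 * (1 + strichartzConst) * (4 * C ^ 2 * K) ^ 3) +
    8 * Real.pi ^ 2 * |γ| * P * C ^ 2 * K + 64 * |γ| * P with hD
  have hD0 : 0 < D := by positivity
  set c₀ := 1 / (1024 * Real.pi ^ 2) with hc₀
  have hc₀0 : 0 < c₀ := by positivity
  set R := (2 * (1 + 4 * Real.pi ^ 2) ^ (-s)) ^ (1 / 2 : ℝ) with hR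
  have hR0 : 0 < R := by positivity
  -- The three summands respectively make the error at most half of the main term, keep |γ|t ≤ 1,
  -- and permit absorption in the drift estimate.
  refine ⟨k, c₀ / 2 / R, 2 * D / c₀ + |γ| + 8 * nonlinearityConst, hk0, by positivity,
    by positivity, fun T N hN hCN hNT => ?_⟩
  have hN0 : 0 < N := by linarith
  have hN1 : 1 ≤ N := by linarith
  set n := N ^ k with hn
  -- The height puts the data at H^s size O(N^{-k}); the time below is then the one for which t l² N
  -- = N^{-4k}.
  set l := N ^ (-s - 1 / 2 - k) with hl
  set t := N ^ (2 * s - 2 * k) with ht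
  set r := N ^ (1 / 2 : ℝ) with hr
  have hn0 : 0 < n := by positivity
  have hl0 : 0 < l := by positivity
  have ht0 : 0 < t := by positivity
  have hr0 : 0 < r := by positivity
  have hn1 : 1 ≤ n := Real.one_le_rpow hN1 hk0.le
  have hr1 : 1 ≤ r := Real.one_le_rpow hN1 (by norm_num)
  have hrN : r ^ 2 = N := by
    rw [hr, ← Real.rpow_mul_natCast hN0.le]
    norm_num
  have hle : ∀ {a : ℝ}, a ≤ 0 → N ^ a ≤ 1 := fun ha => Real.rpow_le_one_of_one_le_of_nonpos hN1 ha
  have f1 : t * l ^ 2 * n ^ 4 * r ^ 2 = 1 := by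
    rw [ht, hl, hn, hr]
    simp only [← Real.rpow_mul_natCast hN0.le, ← Real.rpow_add hN0]
    rw [← Real.rpow_zero N]
    congr 1
    push_cast
    ring
  have f2 : t * n ^ 3 * r ≤ 1 := by
    rw [ht, hn, hr]
    simp only [← Real.rpow_mul_natCast hN0.le, ← Real.rpow_add hN0]
    refine hle ?_
    push_cast
    linarith
  have f3 : t * r ^ 5 * n ≤ 1 := by
    rw [ht, hn, hr]
    simp only [← Real.rpow_mul_natCast hN0.le, ← Real.rpow_add hN0]
    refine hle ?_
    push_cast
    linarith
  have f4 : n ≤ t * l ^ 3 := by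
    rw [ht, hn, hl]
    simp only [← Real.rpow_mul_natCast hN0.le, ← Real.rpow_add hN0]
    refine Real.rpow_le_rpow_of_exponent_le hN1 ?_
    push_cast
    linarith
  have f5 : t ≤ n⁻¹ := by
    rw [hn, ht, ← Real.rpow_neg hN0.le]
    exact Real.rpow_le_rpow_of_exponent_le hN1 (by linarith)
  have hn'0 : 0 < n⁻¹ := by positivity
  have g1 : D * n⁻¹ ≤ c₀ / 2 := by
    have h1 : 0 ≤ (|γ| + 8 * nonlinearityConst) * n⁻¹ := by positivity
    have h2 : 2 * D / c₀ * n⁻¹ ≤ 1 := by linarith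
    have h3 : 2 * D / c₀ * n⁻¹ = D * n⁻¹ / (c₀ / 2) := by field_simp
    rw [h3, div_le_one (by positivity)] at h2
    exact h2
  have g2 : |γ| * n⁻¹ ≤ 1 := by
    have h1 : 0 ≤ (2 * D / c₀ + 8 * nonlinearityConst) * n⁻¹ := by positivity
    linarith
  have g3 : 8 * nonlinearityConst * n⁻¹ ≤ 1 := by
    have h1 : 0 ≤ (2 * D / c₀ + |γ|) * n⁻¹ := by positivity
    linarith
  obtain ⟨φ, hφ⟩ := exists_isDatum hN0 l
  refine ⟨φ, t, ht0, f5, ?_, fun u hu => ?_⟩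
  · refine (hφ.sobolevNorm_le hN0 hl0.le (by linarith)).trans (le_of_eq ?_)
    congr 1
    rw [hl, hn, mul_assoc, ← Real.rpow_add hN0, ← Real.rpow_neg hN0.le]
    congr 2
    ring
  have htA : t * (nonlinearityConst * (2 * l * r) ^ 2) ≤ 1 / 2 := by
    have h1 : t * l ^ 2 * r ^ 2 ≤ n⁻¹ := by
      have h2 : t * l ^ 2 * r ^ 2 = n⁻¹ ^ 4 := by
        rw [inv_pow]
        refine eq_inv_of_mul_eq_one_left ?_
        rw [← f1]
        ring
      rw [h2]
      exact pow_le_of_le_one hn'0.le (inv_le_one_of_one_le₀ hn1) (by norm_num)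
    calc _ = 4 * nonlinearityConst * (t * l ^ 2 * r ^ 2) := by ring
      _ ≤ 4 * nonlinearityConst * n⁻¹ := by gcongr
      _ ≤ _ := by linarith
  have hmain := hu.norm_inner_testFunction_ge hψ hφ hN hl0 ht0 (f5.trans_lt hNT)
    ((mul_le_mul_of_nonneg_left f5 (abs_nonneg γ)).trans g2)
    (fun σ hσ x => hC hN0 hl0.le hk0.le (by linarith) hφ σ hσ x) (by positivity) hK0 hK1 hK2
    (by positivity : 0 < 2 * l * r) (hφ.norm_toLp_le hN0 hl0.le) htA
  have herr := error_le hC0.le hK0.le hS.le hP0 (abs_nonneg γ) ht0.le hl0.le hn1 hr1 hrN f1 f2 f3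
  rw [← hD] at herr
  have hlow : c₀ / 2 * n ≤ ‖inner ℂ (ψ.toLp 2) (u t)‖ := by
    refine le_trans ?_ hmain
    calc c₀ / 2 * n ≤ c₀ / 2 * (t * l ^ 3) := by gcongr
      _ = t * (l ^ 3 * c₀ - l ^ 3 * (c₀ / 2)) := by ring
      _ ≤ t * (l ^ 3 * c₀ - l ^ 3 * (D * n⁻¹)) := by gcongr
      _ ≤ _ := by
        refine mul_le_mul_of_nonneg_left (sub_le_sub (le_of_eq ?_) ?_) ht0.le
        · rw [hc₀]
          ring
        · refine herr.trans (le_of_eq ?_)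
          ring
  have hup := hψ.enorm_inner_le (s := s) (by linarith) (u t)
  rw [← hR, ← ofReal_norm] at hup
  have h1 := (ENNReal.ofReal_le_ofReal hlow).trans hup
  have h2 : c₀ / 2 * n = R * (c₀ / 2 / R * n) := by field_simp
  rw [h2, ENNReal.ofReal_mul hR0.le] at h1
  exact (ENNReal.mul_le_mul_iff_right (by simpa using hR0) ENNReal.ofReal_ne_top).1 h1

/-- Let N → ∞. The lower bound is asserted for every solution with the given data, so it serves both
the inflation statement and an arbitrary data-to-solution map. -/
theorem exists_inflation (γ : ℝ) {s : ℝ} (hs : s < -3 / 2) {T ε : ℝ} (hT : 0 < T) (hε : 0 < ε) :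
    ∃ (φ : 𝓢(ℝ, ℂ)) (t : ℝ), t ∈ Ioo (-T) T ∧ |t| < ε ∧
      sobolevNorm s (φ.toLp 2) < ENNReal.ofReal ε ∧
      ∀ u, IsSolution γ T (φ.toLp 2) u → ENNReal.ofReal ε⁻¹ < sobolevNorm s (u t) := by
  obtain ⟨k, c, C, hk, hc, hC, h⟩ := exists_inflation_at_frequency γ hs
  have hlim : Tendsto (fun N : ℝ => N ^ k) atTop atTop := tendsto_rpow_atTop hk
  have hinv : Tendsto (fun N : ℝ => (N ^ k)⁻¹) atTop (𝓝 0) := hlim.inv_tendsto_atTop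
  have hinvC : Tendsto (fun N : ℝ => C * (N ^ k)⁻¹) atTop (𝓝 0) := by
    simpa using hinv.const_mul C
  obtain ⟨N, hN4, hN1, hN2, hN3, hN4'⟩ := ((eventually_ge_atTop (4 : ℝ)).and
    ((hinvC.eventually_le_const one_pos).and ((hinv.eventually_lt_const hT).and
      ((hinv.eventually_lt_const (half_pos hε)).and
        ((hlim.const_mul_atTop hc).eventually_gt_atTop ε⁻¹))))).exists
  obtain ⟨φ, t, ht0, ht, hφ, hu⟩ := h T N hN4 hN1 hN2
  refine ⟨φ, t, ⟨by linarith, by linarith⟩, ?_, ?_, fun u hu' => ?_⟩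
  · rw [abs_of_pos ht0]
    linarith
  · refine hφ.trans_lt ((ENNReal.ofReal_lt_ofReal_iff hε).2 ?_)
    linarith
  · exact ((ENNReal.ofReal_lt_ofReal_iff ((inv_pos.2 hε).trans hN4')).2 hN4').trans_le (hu u hu')

theorem normInflation (γ : ℝ) {s : ℝ} (hs : s < -3 / 2) : NormInflation γ s := by
  intro ε hε
  obtain ⟨φ, t, ht, htε, hφ, hu⟩ := exists_inflation γ hs one_pos hε
  obtain ⟨u, hu'⟩ := exists_isSolution γ one_pos (φ.toLp 2)
  exact ⟨φ, 1, u, t, hu', ht, htε, hφ, hu u hu'⟩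

theorem IsDataToSolutionMap.not_continuousAtZero {γ s T : ℝ} (hs : s < -3 / 2) (hT : 0 < T)
    {S : L2 → ℝ → L2} (hS : IsDataToSolutionMap γ T S) : ¬ ContinuousAtZero s T S := by
  intro hcont
  obtain ⟨δ, hδ, h⟩ := hcont 1 one_pos
  -- Capping the parameter at 1 makes its inverse at least 1, which contradicts continuity tested
  -- with ε = 1.
  obtain ⟨φ, t, ht, -, hφ, hu⟩ := exists_inflation γ hs hT (lt_min hδ one_pos)
  have h1 := h φ (hφ.trans_le (ENNReal.ofReal_le_ofReal (min_le_left _ _)))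
  have h2 : S 0 t = 0 := ((hS 0).2 0 (isSolution_zero γ T) ht).symm
  have h3 := hu _ (hS (φ.toLp 2)).1
  generalize S (φ.toLp 2) = v at h1 h3
  have h4 : sobolevNorm s (v t - S 0 t) < ENNReal.ofReal 1 :=
    (le_iSup₂ (f := fun t (_ : t ∈ Ioo (-T) T) => sobolevNorm s (v t - S 0 t)) t ht).trans_lt h1
  rw [h2, sub_zero] at h4
  have h5 : ENNReal.ofReal 1 ≤ ENNReal.ofReal (min δ 1)⁻¹ :=
    ENNReal.ofReal_le_ofReal ((one_le_inv₀ (lt_min hδ one_pos)).2 (min_le_right _ _))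
  exact lt_asymm h4 (h5.trans_lt h3)

end GT

end

theorem mainTheorem3 (γ : ℝ) (hγ : γ ≠ 0) (s : ℝ) (hs : s < -3 / 2) :
    GT.NormInflation γ s ∧
      ∀ T : ℝ, 0 < T → ∃ S : GT.L2 → ℝ → GT.L2,
        GT.IsDataToSolutionMap γ T S ∧ ¬ GT.ContinuousAtZero s T S :=
  ⟨GT.normInflation γ hs, fun _ hT => ⟨_, GT.isDataToSolutionMap_choose γ hT,
    (GT.isDataToSolutionMap_choose γ hT).not_continuousAtZero hs hT⟩⟩
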